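/- \textbf{Definitions.} Let $S$ be a scheme. A \emph{symplectic module} over $S$ is a pair $(M,e)$ where $M\to S$ is a commutative finite étale group scheme and $e\colon M\times_S M\to\mathbb{G}_m$ is a bilinear alternating pairing which is nondegenerate, i.e. induces an isomorphism $M\cong\mathbf{Hom}(M,\mathbb{G}_m)$. A \emph{type} is a sequence $D=(d_1,\dots,d_g)$, $g\ge 1$, of positive integers with $d_i\mid d_{i+1}$ for $1\le i<g$; put $\#D=d_1\cdots d_g$. Let $K_D=\prod_i\mathbb{Z}/d_i\mathbb{Z}$ (a constant group scheme), $K_D^\vee=\mathbf{Hom}(K_D,\mathbb{G}_m)=\prod_i\mu_{d_i}$, $M_D=K_D\times K_D^\vee$ and $e_D((x,\chi),(x',\chi'))=\chi'(x)\chi(x')^{-1}$. The symplectic module $(M,e)$ \emph{has type $D$} if for every geometric point $\operatorname{Spec} k\to S$ with $k$ separably closed, $\#D$ is invertible in $k$ and the pullback of $(M,e)$ to $k$ is isomorphic to $(M_D,e_D)$. A \emph{theta group} for $(M,e)$ is a central extension of $S$-group schemes $1\to\mathbb{G}_m\to\mathcal{G}\to M\to 1$ whose commutator pairing is $e$. An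 \emph{isomorphism} of theta groups is an isomorphism of group schemes that is the identity on $\mathbb{G}_m$; it is \emph{framed} if it induces the identity on $M$. An \emph{inversion} on $\mathcal{G}$ is an automorphism $\iota$ of the theta group $\mathcal{G}$ inducing $-\mathrm{Id}_M$ on $M$; $\mathcal{G}$ is \emph{symmetric} if it has an inversion. A \emph{symmetrized theta group} is a pair $(\mathcal{G},\iota)$ with $\iota$ an inversion on the theta group $\mathcal{G}$; a \emph{framed isomorphism} $(\mathcal{G},\iota)\to(\mathcal{G}',\iota')$ is a framed isomorphism $f\colon\mathcal{G}\to\mathcal{G}'$ with $f\circ\iota=\iota'\circ f$. If $(M,e)$ has type $D$, a theta group $\mathcal{G}$ is \emph{linear} if there are a locally free $\mathcal{O}_S$-module $\mathcal{F}$ of rank $\#D$ and a homomorphism $\mathcal{G}\to\mathbf{Aut}(\mathcal{F})$ of sheaves of groups on $S$-schemes under which $\mathbb{G}_m$ acts by scalar multiplication; here $\mathbf{Aut}(\mathcal{F})(T)=\mathrm{Aut}_{\mathcal{O}_T}(f^*\mathcal{F})$ for $f\colon T\to S$. \textbf{Theorem.} Let $(M,e)$ be a symplectic module of type $D$ over a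 scheme $S$, and assume that $\#D$ is odd. Then: (1) there exists a symmetric theta group for $(M,e)$; (2) for any two symmetrized theta groups $(\mathcal{G},\iota)$ and $(\mathcal{G}',\iota')$ for $(M,e)$ there exists a unique framed isomorphism $(\mathcal{G},\iota)\to(\mathcal{G}',\iota')$; (3) every symmetric theta group for $(M,e)$ is linear. -/

import Mathlib

open CategoryTheory AlgebraicGeometry MonoidalCategory MonObj GrpObj

universe u

noncomputable section

namespace ThetaGroups

/-!
Conventions. Schemes over `S` are objects of `Over S`; for `X T : Over S` the set of `T`-points
`X(T)` is `T ⟶ X`, which is a group when `X` is a group scheme (a group object of `Over S`).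
The group scheme `𝔾ₘ` over `S` is used through its functor of points `T ↦ Γ(T, 𝒪_T)ˣ`;
by the Yoneda lemma a morphism of `S`-schemes into or out of `𝔾ₘ` is the same as a family of maps
on `T`-points which is natural in `T`.
-/

/-- The group `𝔾ₘ(T) = Γ(T, 𝒪_T)ˣ` of `T`-points of the multiplicative group. -/
abbrev GmPoints {S : Scheme.{u}} (T : Over S) : Type u := Γ(T.left, ⊤)ˣ

/-- The restriction map `𝔾ₘ(T) → 𝔾ₘ(T')` along a morphism of `S`-schemes `f : T' ⟶ T`. -/
def GmPoints.map {S : Scheme.{u}} {T' T : Over S} (f : T' ⟶ T) : GmPoints T →* GmPoints T' :=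
  Units.map f.left.appTop.hom.toMonoidHom

/-- `T`-points of the Cartier dual `𝐇𝐨𝐦(M, 𝔾ₘ)` of a group scheme `M` over `S`:
homomorphisms `M_T → 𝔾ₘ,T` of group schemes over `T`. -/
structure Character {S : Scheme.{u}} (M : Over S) [GrpObj M] (T : Over S) where
  /-- the homomorphism on `U`-points, for a `T`-scheme `f : U ⟶ T` -/
  toHom : ∀ (U : Over S), (U ⟶ T) → ((U ⟶ M) →* GmPoints U)
  natural : ∀ (U V : Over S) (h : V ⟶ U) (f : U ⟶ T) (m : U ⟶ M),
    toHom V (h ≫ f) (h ≫ m) = GmPoints.map h (toHom U f m)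

/-- A symplectic module over `S`: a commutative finite étale group scheme `M` over `S` with a
nondegenerate alternating bilinear pairing `e : M × M → 𝔾ₘ`. -/
structure SymplecticModule (S : Scheme.{u}) where
  /-- the underlying scheme over `S` -/
  M : Over S
  [grpObj : GrpObj M]
  [comm : IsCommMonObj M]
  [finite : IsFinite M.hom]
  [etale : Etale M.hom]
  /-- the pairing `e : M × M → 𝔾ₘ` on `T`-points -/
  e : ∀ T : Over S, (T ⟶ M) → (T ⟶ M) → GmPoints T
  e_natural : ∀ {T' T : Over S} (f : T' ⟶ T) (x y : T ⟶ M),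
    e T' (f ≫ x) (f ≫ y) = GmPoints.map f (e T x y)
  e_mul_left : ∀ (T : Over S) (x x' y : T ⟶ M), e T (x * x') y = e T x y * e T x' y
  e_mul_right : ∀ (T : Over S) (x y y' : T ⟶ M), e T x (y * y') = e T x y * e T x y'
  e_self : ∀ (T : Over S) (x : T ⟶ M), e T x x = 1
  /-- `x ↦ e(x, -)` is an isomorphism `M ⟶ 𝐇𝐨𝐦(M, 𝔾ₘ)`, i.e. bijective on `T`-points
  for all `T`. -/
  nondegenerate : ∀ (T : Over S) (χ : Character M T),
    ∃! x : T ⟶ M, ∀ (U : Over S) (f : U ⟶ T) (m : U ⟶ M), χ.toHom U f m = e U (f ≫ x) m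

attribute [instance] SymplecticModule.grpObj SymplecticModule.comm SymplecticModule.finite
  SymplecticModule.etale

/-- A type: a nonempty sequence `(d₁, …, d_g)` of positive integers with
`d₁ ∣ d₂ ∣ ⋯ ∣ d_g`. -/
structure ModuleType where
  /-- the length -/
  g : ℕ
  one_le_g : 1 ≤ g
  /-- the entries -/
  d : Fin g → ℕ
  d_pos : ∀ i, 0 < d i
  d_dvd : ∀ i j, i ≤ j → d i ∣ d j

/-- `#D = d₁ ⋯ d_g`. -/
def ModuleType.card (D : ModuleType) : ℕ := ∏ i, D.d i

/-- `T`-points of `M_D = K_D × K_D^∨`, where `K_D` is the constant group scheme attached to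
`ℤ/d₁ × ⋯ × ℤ/d_g` (so that its `T`-points are the locally constant functions on `T` with values
in this group) and `K_D^∨ = μ_{d₁} × ⋯ × μ_{d_g}` is its Cartier dual. -/
abbrev StdPoints (D : ModuleType) {S : Scheme.{u}} (T : Over S) : Type u :=
  LocallyConstant T.left (Multiplicative (∀ i, ZMod (D.d i))) ×
    (∀ i, rootsOfUnity (D.d i) Γ(T.left, ⊤))

/-- The evaluation `χ(a) = ∏ᵢ ζᵢ ^ aᵢ` of `χ = (ζᵢ) ∈ K_D^∨(T)` at a constant section
`a` of `K_D`. -/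
def stdEval (D : ModuleType) {S : Scheme.{u}} {T : Over S}
    (χ : ∀ i, rootsOfUnity (D.d i) Γ(T.left, ⊤)) (a : ∀ i, ZMod (D.d i)) : GmPoints T :=
  ∏ i, (χ i : GmPoints T) ^ (a i).val

/-- An isomorphism of symplectic modules between the pullback of `(M, e)` along
`s : Spec k ⟶ S` and the standard symplectic module `(M_D, e_D)` over `Spec k`.
The pairing of `M_D` is `e_D((a, χ), (a', χ')) = χ'(a) χ(a')⁻¹`; every section of `K_D` is
Zariski-locally constant, so that it suffices to compare the pairings on sections with
constant components in `K_D`. -/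
structure StdIso {S : Scheme.{u}} (X : SymplecticModule S) (D : ModuleType)
    {B : Scheme.{u}} (s : B ⟶ S) where
  /-- the isomorphism on `T`-points, for a `B`-scheme `T` -/
  toEquiv : ∀ T : Over B, ((Over.map s).obj T ⟶ X.M) ≃* StdPoints D T
  natural_fst : ∀ {T' T : Over B} (f : T' ⟶ T) (x : (Over.map s).obj T ⟶ X.M) (t : T'.left),
    (toEquiv T' ((Over.map s).map f ≫ x)).1 t = (toEquiv T x).1 (f.left t)
  natural_snd : ∀ {T' T : Over B} (f : T' ⟶ T) (x : (Over.map s).obj T ⟶ X.M) (i : Fin D.g),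
    ((toEquiv T' ((Over.map s).map f ≫ x)).2 i : GmPoints T') =
      GmPoints.map f ((toEquiv T x).2 i : GmPoints T)
  pairing : ∀ (T : Over B) (x x' : (Over.map s).obj T ⟶ X.M) (a a' : ∀ i, ZMod (D.d i)),
    (∀ t, (toEquiv T x).1 t = Multiplicative.ofAdd a) →
    (∀ t, (toEquiv T x').1 t = Multiplicative.ofAdd a') →
    (X.e ((Over.map s).obj T) x x' : GmPoints T) =
      stdEval D (toEquiv T x').2 a * (stdEval D (toEquiv T x).2 a')⁻¹

/-- `(M, e)` has type `D`: for every geometric point `s : Spec k ⟶ S` with `k` separably closed,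
`#D` is invertible in `k` (so that `(M_D, e_D)` is defined over `k`) and the pullback of
`(M, e)` along `s` is isomorphic to `(M_D, e_D)`. -/
def SymplecticModule.HasType {S : Scheme.{u}} (X : SymplecticModule S) (D : ModuleType) : Prop :=
  ∀ (k : Type u) [Field k] [IsSepClosed k] (s : Spec (.of k) ⟶ S),
    (D.card : k) ≠ 0 ∧ Nonempty (StdIso X D s)

/-- A theta group for `(M, e)`: a central extension of group schemes
`1 → 𝔾ₘ → G → M → 1` whose commutator pairing is `e`. -/
structure ThetaGroup {S : Scheme.{u}} (X : SymplecticModule S) where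
  /-- the underlying scheme over `S` -/
  G : Over S
  [grpObj : GrpObj G]
  /-- the homomorphism `𝔾ₘ → G` on `T`-points -/
  incl : ∀ T : Over S, GmPoints T →* (T ⟶ G)
  incl_natural : ∀ {T' T : Over S} (f : T' ⟶ T) (a : GmPoints T),
    incl T' (GmPoints.map f a) = f ≫ incl T a
  /-- the homomorphism `G → M` -/
  proj : G ⟶ X.M
  [proj_hom : IsMonHom proj]
  incl_injective : ∀ T, Function.Injective (incl T)
  exact : ∀ (T : Over S) (x : T ⟶ G), x ≫ proj = 1 ↔ ∃ a, incl T a = x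
  /-- `G → M` is an epimorphism of sheaves: points of `M` lift étale-locally. -/
  proj_surjective : ∀ (T : Over S) (m : T ⟶ X.M),
    ∃ (U : Over S) (f : U ⟶ T) (x : U ⟶ G),
      Etale f.left ∧ Surjective f.left ∧ x ≫ proj = f ≫ m
  central : ∀ (T : Over S) (a : GmPoints T) (x : T ⟶ G), incl T a * x = x * incl T a
  commutator : ∀ (T : Over S) (x y : T ⟶ G),
    x * y * x⁻¹ * y⁻¹ = incl T (X.e T (x ≫ proj) (y ≫ proj))

attribute [instance] ThetaGroup.grpObj ThetaGroup.proj_hom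

namespace ThetaGroup

variable {S : Scheme.{u}} {X : SymplecticModule S}

/-- An isomorphism of theta groups: an isomorphism of group schemes which is the identity
on `𝔾ₘ`. -/
structure IsThetaIso (𝒢 𝒢' : ThetaGroup X) (α : 𝒢.G ≅ 𝒢'.G) : Prop where
  isMonHom : IsMonHom α.hom
  incl_hom : ∀ (T : Over S) (a : GmPoints T), 𝒢.incl T a ≫ α.hom = 𝒢'.incl T a

/-- A framed isomorphism of theta groups: one which induces the identity on `M`. -/
structure IsFramedIso (𝒢 𝒢' : ThetaGroup X) (α : 𝒢.G ≅ 𝒢'.G) : Prop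
    extends IsThetaIso 𝒢 𝒢' α where
  hom_proj : α.hom ≫ 𝒢'.proj = 𝒢.proj

/-- An inversion on a theta group: an automorphism (identity on `𝔾ₘ`) which induces
`-Id` on `M`. -/
structure Inversion (𝒢 : ThetaGroup X) where
  /-- the underlying automorphism -/
  iso : 𝒢.G ≅ 𝒢.G
  isThetaIso : IsThetaIso 𝒢 𝒢 iso
  hom_proj : iso.hom ≫ 𝒢.proj = 𝒢.proj ≫ ι[X.M]

/-- A theta group is symmetric if it admits an inversion. -/
def IsSymmetric (𝒢 : ThetaGroup X) : Prop := Nonempty 𝒢.Inversion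

end ThetaGroup

/-- A symmetrized theta group: a theta group with a chosen inversion. -/
structure SymmetrizedThetaGroup {S : Scheme.{u}} (X : SymplecticModule S) where
  /-- the theta group -/
  theta : ThetaGroup X
  /-- the inversion -/
  inversion : theta.Inversion

/-- A framed isomorphism of symmetrized theta groups: a framed isomorphism of the theta groups
which intertwines the inversions. -/
structure SymmetrizedThetaGroup.IsFramedIso {S : Scheme.{u}} {X : SymplecticModule S}
    (A A' : SymmetrizedThetaGroup X) (α : A.theta.G ≅ A'.theta.G) : Prop
    extends ThetaGroup.IsFramedIso A.theta A'.theta α where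
  comm_inversion : A.inversion.iso.hom ≫ α.hom = α.hom ≫ A'.inversion.iso.hom

/-- An `𝒪_S`-module `F` is locally free of rank `n` if locally on `S` there are sections
`b₁, …, b_n` which form a basis of `F(V)` over `𝒪(V)` for all smaller opens `V`, i.e. define an
isomorphism `𝒪_U^n ≅ F|_U`. -/
def IsLocallyFreeOfRank {S : Scheme.{u}} (F : S.Modules) (n : ℕ) : Prop :=
  ∀ x : S, ∃ (U : S.Opens) (_ : x ∈ U) (b : Fin n → Γ(F, U)),
    ∀ (V : S.Opens) (h : V ≤ U), Function.Bijective
      (fun c : Fin n → Γ(S, V) => ∑ i, c i • F.presheaf.map (homOfLE h).op (b i))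

/-- The canonical isomorphism `f^*(F_T) ≅ F_{T'}` for a morphism `f : T' ⟶ T` of `S`-schemes,
where `F_T` is the pullback of `F` to `T`. -/
def pullbackIso {S : Scheme.{u}} (F : S.Modules) {T' T : Over S} (f : T' ⟶ T) :
    (Scheme.Modules.pullback f.left).obj ((Scheme.Modules.pullback T.hom).obj F) ≅
      (Scheme.Modules.pullback T'.hom).obj F :=
  (Scheme.Modules.pullbackComp f.left T.hom ≪≫ Scheme.Modules.pullbackCongr (Over.w f)).app F

/-- A representation of a group scheme `G` over `S`: a quasi-coherent sheaf `F` on `S` with a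
homomorphism of sheaves of groups `ρ : G → 𝐀𝐮𝐭(F)`, where `𝐀𝐮𝐭(F)(T)` is the group of
`𝒪_T`-linear automorphisms of the pullback `F_T`. -/
structure Representation {S : Scheme.{u}} (G : Over S) [GrpObj G] where
  /-- the underlying sheaf of modules -/
  F : S.Modules
  quasicoherent : SheafOfModules.IsQuasicoherent.{u} F
  /-- the action of `T`-points -/
  ρ : ∀ T : Over S, (T ⟶ G) →* Aut ((Scheme.Modules.pullback T.hom).obj F)
  natural : ∀ {T' T : Over S} (f : T' ⟶ T) (x : T ⟶ G),
    (pullbackIso F f).hom ≫ (ρ T' (f ≫ x)).hom =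
      (Scheme.Modules.pullback f.left).map (ρ T x).hom ≫ (pullbackIso F f).hom

/-- A representation of a theta group has weight `1` if `𝔾ₘ` acts by scalar multiplication. -/
def Representation.IsWeightOne {S : Scheme.{u}} {X : SymplecticModule S} {𝒢 : ThetaGroup X}
    (R : Representation 𝒢.G) : Prop :=
  ∀ (T : Over S) (a : GmPoints T) (U : T.left.Opens)
    (v : Γ((Scheme.Modules.pullback T.hom).obj R.F, U)),
    (R.ρ T (𝒢.incl T a)).hom.app U v =
      (T.left.presheaf.map (homOfLE (le_top : U ≤ ⊤)).op (a : Γ(T.left, ⊤))) • v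

/-- A Schrödinger representation of a theta group of type `D`: a representation of weight `1`
on a locally free sheaf of rank `#D`. -/
structure Representation.IsSchrodinger {S : Scheme.{u}} {X : SymplecticModule S}
    {𝒢 : ThetaGroup X} (R : Representation 𝒢.G) (D : ModuleType) : Prop where
  weightOne : R.IsWeightOne
  locallyFree : IsLocallyFreeOfRank R.F D.card

/-- A theta group for a symplectic module of type `D` is linear if it has a Schrödinger
representation. -/
def ThetaGroup.IsLinear {S : Scheme.{u}} {X : SymplecticModule S} (𝒢 : ThetaGroup X)
    (D : ModuleType) : Prop :=
  ∃ R : Representation 𝒢.G, R.IsSchrodinger D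

end ThetaGroups

end

/-!
Write `n = #D`, an odd number which annihilates `M` and is invertible on `S`. The pairing `e` then
has the square root `e^{1/2} = e^{(n+1)/2}`, and everything rests on a Heisenberg group built
from it.

*Existence and uniqueness.* The scheme `𝔾ₘ × M` with the multiplication
`(a, x) (b, y) = (a b e^{1/2}(x, y), x y)` is a theta group (`stdTheta`), and `(a, x) ↦ (a, x⁻¹)`
is an inversion of it (`stdInversion`). Conversely let `(𝒢, ι)` be a symmetrized theta group. Every
point `m` of `M` has exactly one lift `σ(m)` to `𝒢` with `ι(σ(m)) = σ(m)⁻¹` and `σ(m)ⁿ = 1`: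
two of them differ by a scalar `c` with `c² = 1 = cⁿ`, and if `x` lifts `m^{(n+1)/2}` étale-locally
then `x ι(x)⁻¹` is one of them; by uniqueness the local lifts descend. One finds
`σ(m) σ(m') = e^{1/2}(m, m') σ(m m')`, so that `(a, m) ↦ a σ(m)` identifies `(𝒢, ι)` with the standard
symmetrized theta group (`SymmetrizedThetaGroup.pointsEquiv`), and it is the only framed
isomorphism.

*Linearity.* A frame of `M` over `T` is a pair of homomorphisms from `K_D` to `M(T)` with isotropic
images in perfect duality. It defines the Heisenberg matrices `W(m)`, for `m ∈ M(T)`, on functions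
on `K_D`, with `W(m) W(m') = e^{1/2}(m, m') W(m m')` (`Frame.W_mul`). Frames are the points of an open
and closed subscheme of a power of `M`, so that there is a frame over some finite étale covering
`P → S` (`exists_frame_cover`). Two frames have intertwiners, obtained by averaging, which are unique
up to a scalar by Schur's lemma. All of them commute with the parity operator `f(t) ↦ f(-t)`, and
an intertwiner is called normalized if its determinants on the even functions and modulo the even
functions are equal. As the ranks `(n+1)/2` and `(n-1)/2` differ by one, exactly one multiple of a
given intertwiner is normalized. The normalized intertwiners (`Frame.trans`) therefore satisfy the
cocycle condition exactly. No Brauer obstruction remains: they are a descent datum along `P → S` for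
the free module with basis `K_D`, and it commutes with the Heisenberg action. Flat descent over
affine open subsets of `S` (`span_descended`) and the finiteness of `P → S` show that the twisted
form has bases Zariski-locally (`Cocycle.locallyFreeOn_bigModule`).

This twisted form is constructed as a sheaf of modules on all `S`-schemes, a `BigModule`, and the
action of the theta group is defined on its sections. A locally free `BigModule` restricts on
every `S`-scheme to the pullback of its restriction to `S`, because it has the universal property of
the pullback (`BigModule.existsUnique_extension`); this turns the action into the required
representation (`BigModule.Action.isLinear`).
-/

noncomputable section

namespace ThetaGroups

/-! ### Heisenberg matrices -/

section Heisenberg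

set_option linter.unusedSectionVars false

variable {K : Type} [AddCommGroup K] [Fintype K] [DecidableEq K]

/-- Division by two in a finite abelian group of odd order `n`: multiplication by `(n + 1) / 2`. -/
def half (a : K) : K := ((Fintype.card K + 1) / 2) • a

lemma half_add (a b : K) : half (a + b) = half a + half b := smul_add _ _ _

lemma half_neg (a : K) : half (-a) = -half a := smul_neg _ _

lemma half_add_half (hK : Odd (Fintype.card K)) (a : K) : half a + half a = a := by
  obtain ⟨k, hk⟩ := hK
  have h2 : (Fintype.card K + 1) / 2 + (Fintype.card K + 1) / 2 = Fintype.card K + 1 := by omega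
  rw [half, ← add_smul, h2, succ_nsmul, card_nsmul_eq_zero, zero_add]

lemma half_injective (hK : Odd (Fintype.card K)) : Function.Injective (half (K := K)) := by
  intro a b h
  rw [← half_add_half hK a, ← half_add_half hK b, h]

lemma eq_zero_of_neg_eq (hK : Odd (Fintype.card K)) {a : K} (h : a = -a) : a = 0 := by
  rw [← half_add_half hK a]
  nth_rw 1 [h]
  rw [half_neg]; simp

variable {R : Type u} [CommRing R]

/-- A bimultiplicative pairing on the finite group `K` with values in the units of `R`, which is
perfect in the strong sense that the nontrivial characters of `K` which it defines have sum
zero. -/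
structure PerfectPairing (K : Type) [AddCommGroup K] [Fintype K] (R : Type u) [CommRing R] where
  /-- the values of the pairing -/
  val : K → K → Rˣ
  add_left : ∀ a a' b, val (a + a') b = val a b * val a' b
  add_right : ∀ a b b', val a (b + b') = val a b * val a b'
  sum_right : ∀ a, a ≠ 0 → ∑ b, (val a b : R) = 0
  sum_left : ∀ b, b ≠ 0 → ∑ a, (val a b : R) = 0

namespace PerfectPairing

variable (c : PerfectPairing K R)

@[simp] lemma zero_left (b : K) : c.val 0 b = 1 := by
  have := c.add_left 0 0 b
  simpa using this

@[simp] lemma zero_right (a : K) : c.val a 0 = 1 := by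
  have := c.add_right a 0 0
  simpa using this

lemma neg_left (a b : K) : c.val (-a) b = (c.val a b)⁻¹ := by
  rw [eq_inv_iff_mul_eq_one, ← c.add_left]; simp

lemma neg_right (a b : K) : c.val a (-b) = (c.val a b)⁻¹ := by
  rw [eq_inv_iff_mul_eq_one, ← c.add_right]; simp

lemma nsmul_left (k : ℕ) (a b : K) : c.val (k • a) b = c.val a b ^ k := by
  induction k with
  | zero => simp
  | succ k ih => rw [succ_nsmul, c.add_left, ih, pow_succ]

lemma sum_right_eq (a : K) :
    ∑ b, (c.val a b : R) = if a = 0 then (Fintype.card K : R) else 0 := by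
  split_ifs with h
  · simp [h]
  · exact c.sum_right a h

lemma sum_left_eq (b : K) :
    ∑ a, (c.val a b : R) = if b = 0 then (Fintype.card K : R) else 0 := by
  split_ifs with h
  · simp [h]
  · exact c.sum_left b h

/-- The Heisenberg matrix of `(α, β)`: on functions `f` on `K` it is the operator
`(W f)(t) = c(t + α/2, β) f(t + α)`. -/
def heis (α β : K) : Matrix K K R :=
  Matrix.of fun t s => if s = t + α then (c.val (half (t + s)) β : R) else 0

lemma heis_zero : c.heis 0 0 = 1 := by
  ext t s
  simp [heis, Matrix.one_apply, eq_comm]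

lemma half_twice (hK : Odd (Fintype.card K)) (t α : K) : half (t + (t + α)) = t + half α := by
  rw [half_add, half_add, ← add_assoc, half_add_half hK]

lemma heis_mul (hK : Odd (Fintype.card K)) (α β α' β' : K) :
    c.heis α β * c.heis α' β' =
      ((c.val (half α) β' * (c.val (half α') β)⁻¹ : Rˣ) : R) • c.heis (α + α') (β + β') := by
  ext t s
  simp only [heis, Matrix.mul_apply, Matrix.of_apply, Matrix.smul_apply, ite_mul, zero_mul,
    Finset.sum_ite_eq', Finset.mem_univ, if_true, smul_eq_mul]
  simp only [add_assoc]
  by_cases h : s = t + (α + α')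
  · subst h
    simp only [if_true, ← Units.val_mul]
    congr 1
    have e1 : half (t + (t + α)) = t + half α := half_twice hK _ _
    have e2 : half (t + (α + (t + (α + α')))) = t + half α + half α + half α' := by
      rw [show t + (α + (t + (α + α'))) = (t + α) + ((t + α) + α') by abel, half_twice hK]
      nth_rw 1 [← half_add_half hK α]; abel
    have e3 : half (t + (t + (α + α'))) = t + half α + half α' := by
      rw [half_twice hK, half_add]; abel
    rw [e1, e2, e3]
    simp only [c.add_left, c.add_right]
    rw [eq_comm, mul_comm (c.val (half α) β'), _root_.mul_assoc, inv_mul_eq_iff_eq_mul]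
    ac_rfl
  · simp [h]

lemma heis_mul_neg (hK : Odd (Fintype.card K)) (α β : K) :
    c.heis α β * c.heis (-α) (-β) = 1 := by
  rw [c.heis_mul hK, half_neg, c.neg_left, c.neg_right]
  simp [heis_zero]

/-- The orthogonality relations of the Heisenberg matrices, from which Schur's lemma follows. -/
lemma heis_completeness (hK : Odd (Fintype.card K)) (i j k l : K) :
    ∑ x : K × K, c.heis x.1 x.2 i j * c.heis (-x.1) (-x.2) k l =
      if i = l ∧ j = k then (Fintype.card K : R) else 0 := by
  rw [Fintype.sum_prod_type]
  have h1 : ∀ α β : K, c.heis α β i j * c.heis (-α) (-β) k l =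
      if α = j - i then (if l = k - α then (c.val (half (i + j) - half (k + l)) β : R) else 0)
        else 0 := by
    intro α β
    simp only [heis, Matrix.of_apply]
    by_cases hα : α = j - i
    · subst hα
      simp only [add_sub_cancel, if_true, ← sub_eq_add_neg]
      split_ifs
      · rw [sub_eq_add_neg, c.add_left, c.neg_right, c.neg_left, Units.val_mul]
      · simp
    · have : ¬ j = i + α := fun h => hα (by rw [h]; abel)
      simp [hα, this]
  simp only [h1]
  rw [Finset.sum_eq_single (j - i)]
  · simp only [if_true]
    by_cases hl : l = k - (j - i)
    · simp only [hl, if_true]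
      rw [c.sum_right_eq]
      have e : half (i + j) - half (k + (k - (j - i))) = 0 ↔ i = k - (j - i) ∧ j = k := by
        rw [sub_eq_zero]
        constructor
        · intro h
          have h := half_injective hK h
          have h2 : j + j = k + k := by
            have : i + j + (j - i) = k + (k - (j - i)) + (j - i) := by rw [h]
            rwa [show i + j + (j - i) = j + j by abel,
              show k + (k - (j - i)) + (j - i) = k + k by abel] at this
          have h3 : j = k := by
            rw [← half_add_half hK j, ← half_add_half hK k, ← half_add, h2, half_add]
          subst h3
          exact ⟨by abel, rfl⟩
        · rintro ⟨h, rfl⟩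
          rw [← h, add_comm]
      simp only [e]
    · rw [if_neg]
      · simp [hl]
      · rintro ⟨rfl, rfl⟩
        exact hl (by abel)
  · intro b _ hb
    simp [hb]
  · simp

lemma trace_heis (hK : Odd (Fintype.card K)) (α β : K) :
    (c.heis α β).trace = if α = 0 ∧ β = 0 then (Fintype.card K : R) else 0 := by
  simp only [Matrix.trace, Matrix.diag_apply, heis, Matrix.of_apply, left_eq_add]
  by_cases hα : α = 0
  · subst hα
    simp only [if_true, half_add, half_add_half hK, true_and]
    exact c.sum_left_eq β
  · simp [hα]

/-- Schur's lemma for the Heisenberg matrices: conjugating a matrix by all of them and adding up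
gives a multiple of the identity. -/
lemma eq_smul_one_of_commute (hK : Odd (Fintype.card K)) (hn : IsUnit (Fintype.card K : R))
    (A : Matrix K K R) (hA : ∀ α β, c.heis α β * A = A * c.heis α β) :
    ∃ a : R, A = a • (1 : Matrix K K R) := by
  have h1 : ∑ x : K × K, c.heis x.1 x.2 * A * c.heis (-x.1) (-x.2) =
      ((Fintype.card K : R) * A.trace) • (1 : Matrix K K R) := by
    ext i l
    have : ∀ x : K × K, (c.heis x.1 x.2 * A * c.heis (-x.1) (-x.2)) i l =
        ∑ k, ∑ j, A j k * (c.heis x.1 x.2 i j * c.heis (-x.1) (-x.2) k l) := by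
      intro x
      simp only [Matrix.mul_apply, Finset.sum_mul]
      exact Finset.sum_congr rfl fun k _ => Finset.sum_congr rfl fun j _ => by ring
    rw [Matrix.sum_apply, Finset.sum_congr rfl fun x _ => this x, Finset.sum_comm]
    simp_rw [Finset.sum_comm (s := (Finset.univ : Finset (K × K))), ← Finset.mul_sum,
      c.heis_completeness hK]
    by_cases hil : i = l
    · simp [hil, Matrix.trace, Finset.mul_sum, mul_comm]
    · simp [hil]
  have h2 : ∀ x : K × K, c.heis x.1 x.2 * A * c.heis (-x.1) (-x.2) = A := by
    intro x
    rw [hA, _root_.mul_assoc, c.heis_mul_neg hK, _root_.mul_one]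
  simp only [h2, Finset.sum_const, Finset.card_univ, Fintype.card_prod] at h1
  obtain ⟨v, hv⟩ := (hn.mul hn)
  refine ⟨(↑v⁻¹ : R) * ((Fintype.card K : R) * A.trace), ?_⟩
  rw [mul_smul, ← h1, ← Nat.cast_smul_eq_nsmul R, Nat.cast_mul, ← hv, smul_smul]
  simp

end PerfectPairing

/-! ### The parity operator and its odd part -/

variable (K R) in
/-- The operator `(I f)(t) = f(-t)` on functions on `K`. -/
def parity : Matrix K K R := Matrix.of fun t s => if s = -t then 1 else 0

lemma parity_mul (A : Matrix K K R) (t s : K) : (parity K R * A) t s = A (-t) s := by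
  simp [parity, Matrix.mul_apply]

lemma mul_parity (A : Matrix K K R) (t s : K) : (A * parity K R) t s = A t (-s) := by
  have : ∀ x : K, (s = -x) ↔ x = -s := fun x => by rw [eq_neg_iff_add_eq_zero,
    eq_neg_iff_add_eq_zero, add_comm]
  simp [parity, Matrix.mul_apply, this]

lemma parity_mul_parity : parity K R * parity K R = 1 := by
  ext t s
  rw [parity_mul]
  simp [parity, Matrix.one_apply, eq_comm]

lemma trace_parity (hK : Odd (Fintype.card K)) : (parity K R).trace = 1 := by
  simp only [Matrix.trace, Matrix.diag_apply, parity, Matrix.of_apply]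
  rw [Finset.sum_eq_single 0]
  · simp
  · intro b _ hb
    rw [if_neg fun h => hb (eq_zero_of_neg_eq hK h)]
  · simp

lemma parity_heis_parity (c : PerfectPairing K R) (α β : K) :
    parity K R * c.heis α β * parity K R = c.heis (-α) (-β) := by
  ext t s
  rw [mul_parity, parity_mul]
  simp only [PerfectPairing.heis, Matrix.of_apply]
  have : (-s = -t + α) ↔ s = t + -α := by
    rw [← neg_inj]; simp [add_comm]
  simp only [this]
  congr 2
  rw [show -t + -s = -(t + s) by abel, half_neg, c.neg_left, c.neg_right]

variable (K) in
/-- A set of representatives for the nonzero elements of `K` up to sign. -/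
abbrev HalfSystem : Type := {a : K // Fintype.equivFin K a < Fintype.equivFin K (-a)}

instance : DecidablePred fun a : K => Fintype.equivFin K a < Fintype.equivFin K (-a) :=
  fun _ => inferInstance

lemma sum_eq_halfSystem (hK : Odd (Fintype.card K)) {A : Type*} [AddCommMonoid A] (f : K → A) :
    ∑ a, f a = f 0 + ∑ a : HalfSystem K, (f a + f (-a)) := by
  have hneg : ∑ a : HalfSystem K, f (-a) =
      ∑ a : {a : K // Fintype.equivFin K (-a) < Fintype.equivFin K a}, f a := by
    exact Fintype.sum_equiv ((Equiv.neg K).subtypeEquiv fun a => by simp) _ _ fun a => rfl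
  have h0 : ∑ a : {a : K // a = 0}, f a = f 0 :=
    Fintype.sum_unique fun a : {a : K // a = 0} => f a
  rw [Finset.sum_add_distrib, hneg, ← h0,
    ← Finset.sum_subtype (Finset.univ.filter fun a : K => a = 0) (by simp) f,
    ← Finset.sum_subtype (Finset.univ.filter fun a : K =>
      Fintype.equivFin K a < Fintype.equivFin K (-a)) (by simp) f,
    ← Finset.sum_subtype (Finset.univ.filter fun a : K =>
      Fintype.equivFin K (-a) < Fintype.equivFin K a) (by simp) f,
    ← Finset.sum_union, ← Finset.sum_union]
  · refine (Finset.sum_subset (Finset.subset_univ _) fun a _ ha => ?_).symm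
    exfalso
    simp only [Finset.mem_union, Finset.mem_filter, Finset.mem_univ, true_and, not_or, not_lt] at ha
    exact ha.1 (eq_zero_of_neg_eq hK ((Fintype.equivFin K).injective (le_antisymm ha.2.2 ha.2.1)))
  · rw [Finset.disjoint_left]
    intro a ha hb
    simp only [Finset.mem_union, Finset.mem_filter, Finset.mem_univ, true_and] at ha hb
    subst ha
    simp at hb
  · rw [Finset.disjoint_left]
    intro a ha hb
    simp only [Finset.mem_filter, Finset.mem_univ, true_and] at ha hb
    exact lt_asymm ha hb

lemma card_eq_halfSystem (hK : Odd (Fintype.card K)) :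
    Fintype.card K = 1 + 2 * Fintype.card (HalfSystem K) := by
  have := sum_eq_halfSystem hK (fun _ : K => 1)
  simpa [mul_comm] using this

lemma pow_card (hK : Odd (Fintype.card K)) (a : R) :
    a ^ Fintype.card K = a * (a ^ Fintype.card (HalfSystem K)) ^ 2 :=
  (congrArg (a ^ ·) (card_eq_halfSystem hK)).trans (by ring)

/-- The matrix of the operator induced by `A` on the quotient of the functions on `K` by the even
functions, if `A` commutes with the parity operator. -/
def oddPart (A : Matrix K K R) : Matrix (HalfSystem K) (HalfSystem K) R :=
  Matrix.of fun t s => A t s - A (-t) s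

lemma apply_neg_neg_of_commute {A : Matrix K K R} (hA : parity K R * A = A * parity K R)
    (t s : K) : A (-t) (-s) = A t s := by
  rw [← mul_parity A, ← hA, parity_mul, neg_neg]

lemma oddPart_one : oddPart (1 : Matrix K K R) = 1 := by
  ext t s
  have h : -(t : K) ≠ s := by
    intro h
    have h1 := t.2
    have h2 := s.2
    rw [← h, neg_neg] at h2
    exact lt_asymm h1 h2
  simp [oddPart, Matrix.one_apply, h, Subtype.ext_iff]

lemma oddPart_smul (a : R) (A : Matrix K K R) : oddPart (a • A) = a • oddPart A := by
  ext t s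
  simp [oddPart, mul_sub]

lemma oddPart_mul (hK : Odd (Fintype.card K)) {A : Matrix K K R}
    (hA : parity K R * A = A * parity K R) (B : Matrix K K R) :
    oddPart (A * B) = oddPart A * oddPart B := by
  ext t s
  simp only [oddPart, Matrix.of_apply, Matrix.mul_apply, ← Finset.sum_sub_distrib, ← sub_mul]
  rw [sum_eq_halfSystem hK]
  have h0 : A t 0 - A (-t) 0 = 0 := by
    rw [← apply_neg_neg_of_commute hA (-t) 0]; simp
  rw [h0, zero_mul, zero_add]
  refine Finset.sum_congr rfl fun r _ => ?_
  have h1 : A t (-r) = A (-t) r := by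
    rw [← apply_neg_neg_of_commute hA, neg_neg]
  have h2 : A (-t) (-r) = A t r := apply_neg_neg_of_commute hA _ _
  rw [h1, h2]
  ring

lemma oddPart_map {R' : Type u} [CommRing R'] (f : R →+* R') (A : Matrix K K R) :
    oddPart (A.map f) = (oddPart A).map f := by
  ext t s
  simp [oddPart]

/-- An invertible matrix which commutes with the parity operator is normalized if its determinants
on the even functions and on the quotient by the even functions agree. The latter is the determinant
of `oddPart A` and the product of both is `det A`, which gives the condition below. Since the ranks
of the two spaces differ by one, a matrix as above has exactly one normalized multiple. -/
structure IsNormalized (A : Matrix K K R) : Prop where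
  isUnit_det : IsUnit A.det
  parity_comm : parity K R * A = A * parity K R
  det_eq : A.det = (oddPart A).det ^ 2

lemma IsNormalized.one : IsNormalized (1 : Matrix K K R) :=
  ⟨by simp, by simp, by simp [oddPart_one]⟩

lemma IsNormalized.mul (hK : Odd (Fintype.card K)) {A B : Matrix K K R} (hA : IsNormalized A)
    (hB : IsNormalized B) : IsNormalized (A * B) where
  isUnit_det := by rw [Matrix.det_mul]; exact hA.isUnit_det.mul hB.isUnit_det
  parity_comm := by rw [← _root_.mul_assoc, hA.parity_comm, _root_.mul_assoc, hB.parity_comm, _root_.mul_assoc]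
  det_eq := by
    rw [oddPart_mul hK hA.parity_comm, Matrix.det_mul, Matrix.det_mul, hA.det_eq, hB.det_eq,
      mul_pow]

lemma parity_map {R' : Type u} [CommRing R'] (f : R →+* R') :
    (parity K R).map f = parity K R' := by
  ext t s
  simp only [parity, Matrix.map_apply, Matrix.of_apply]
  split_ifs <;> simp

lemma IsNormalized.map {R' : Type u} [CommRing R'] (f : R →+* R') {A : Matrix K K R}
    (hA : IsNormalized A) : IsNormalized (A.map f) where
  isUnit_det := by
    have := hA.isUnit_det.map f
    rwa [RingHom.map_det] at this
  parity_comm := by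
    have := congrArg (fun B : Matrix K K R => B.map f) hA.parity_comm
    simpa only [Matrix.map_mul, parity_map] using this
  det_eq := by
    have := congrArg f hA.det_eq
    rw [map_pow, RingHom.map_det, RingHom.map_det] at this
    rw [oddPart_map]
    exact this

lemma IsNormalized.eq_one_of_smul (hK : Odd (Fintype.card K)) {A : Matrix K K R} {a : R}
    (hA : IsNormalized A) (haA : IsNormalized (a • A)) : a = 1 := by
  have h1 := haA.det_eq
  have h2 := haA.isUnit_det
  rw [Matrix.det_smul, pow_card hK] at h1 h2
  rw [oddPart_smul, Matrix.det_smul, mul_pow, ← hA.det_eq, _root_.mul_assoc] at h1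
  rw [_root_.mul_assoc] at h2
  exact (isUnit_of_mul_isUnit_right h2).mul_right_cancel (by rw [h1, _root_.one_mul])

lemma IsNormalized.exists_smul (hK : Odd (Fintype.card K)) {A B : Matrix K K R}
    (hA : parity K R * A = A * parity K R) (hAB : A * B = 1) :
    ∃ a : R, IsNormalized (a • A) := by
  have hd : A.det * B.det = 1 := by rw [← Matrix.det_mul, hAB, Matrix.det_one]
  have ho : (oddPart A).det * (oddPart B).det = 1 := by
    rw [← Matrix.det_mul, ← oddPart_mul hK hA, hAB, oddPart_one, Matrix.det_one]
  have hu : IsUnit A.det := IsUnit.of_mul_eq_one _ hd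
  have hou : IsUnit (oddPart A).det := IsUnit.of_mul_eq_one _ ho
  have hb : IsUnit B.det := IsUnit.of_mul_eq_one _ ((mul_comm _ _).trans hd)
  refine ⟨(oddPart A).det ^ 2 * B.det, ?_, ?_, ?_⟩
  · rw [Matrix.det_smul]
    exact (((hou.pow 2).mul hb).pow _).mul hu
  · rw [mul_smul_comm, smul_mul_assoc, hA]
  · rw [Matrix.det_smul, oddPart_smul, Matrix.det_smul, pow_card hK]
    linear_combination ((oddPart A).det ^ 2) * (((oddPart A).det ^ 2 * B.det) ^
      (Fintype.card (HalfSystem K))) ^ 2 * hd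

end Heisenberg

/-! ### Averaged intertwiners -/

section Averaging

variable {I G : Type} [AddCommGroup G] [Fintype G] [Fintype I] [DecidableEq I]
  {R : Type u} [CommRing R]

/-- The sum of `W x * A * W' (-x)` over a finite group, which intertwines the projective
representations `W'` and `W`. -/
def average (W W' : G → Matrix I I R) (A : Matrix I I R) : Matrix I I R :=
  ∑ x, W x * A * W' (-x)

variable {W W' : G → Matrix I I R} {φ : G → G → R}

/-- The scalars `φ x y` cancel because the average involves `W x` and `W' (-x)`. -/
lemma mul_average_mul (hφ : ∀ x y, φ x y * φ (-y) (-x) = 1)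
    (hW : ∀ x y, W x * W y = φ x y • W (x + y)) (hW' : ∀ x y, W' x * W' y = φ x y • W' (x + y))
    (A : Matrix I I R) (x : G) : W x * average W W' A * W' (-x) = average W W' A := by
  rw [average, Finset.mul_sum, Finset.sum_mul]
  refine Fintype.sum_equiv (Equiv.addLeft x) _ _ fun y => ?_
  calc W x * (W y * A * W' (-y)) * W' (-x) = (W x * W y) * A * (W' (-y) * W' (-x)) := by
        noncomm_ring
    _ = W (x + y) * A * W' (-(x + y)) := by
        rw [hW, hW', smul_mul_assoc, smul_mul_assoc, mul_smul_comm, smul_smul, hφ, one_smul,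
          neg_add_rev]

lemma mul_average (hφ : ∀ x y, φ x y * φ (-y) (-x) = 1)
    (hW : ∀ x y, W x * W y = φ x y • W (x + y)) (hW' : ∀ x y, W' x * W' y = φ x y • W' (x + y))
    (hinv : ∀ x, W' x * W' (-x) = 1) (A : Matrix I I R) (x : G) :
    W x * average W W' A = average W W' A * W' x := by
  conv_rhs => rw [← mul_average_mul hφ hW hW' A x]
  have := hinv (-x)
  rw [neg_neg] at this
  rw [_root_.mul_assoc (W x * average W W' A), this, _root_.mul_one]

lemma trace_average_mul (hinv : ∀ x, W (-x) * W x = 1) {B : Matrix I I R}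
    (hB : ∀ x, W' x * B = B * W x) (A : Matrix I I R) :
    (average W W' A * B).trace = Fintype.card G * (A * B).trace := by
  rw [average, Finset.sum_mul, Matrix.trace_sum]
  have : ∀ x, (W x * A * W' (-x) * B).trace = (A * B).trace := by
    intro x
    rw [_root_.mul_assoc, hB, ← _root_.mul_assoc, Matrix.trace_mul_comm, _root_.mul_assoc, ← _root_.mul_assoc, ← _root_.mul_assoc,
      hinv, _root_.one_mul]
  simp [this]

/-- Some entry of the average of some elementary matrix is invertible locally, since the sum of
suitable entries is the rank. -/
lemma sum_average_single (h1 : W 0 = 1) (hn : ∀ x, x ≠ 0 → (W' x).trace = 0)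
    (h1' : W' 0 = 1) (b : I) :
    ∑ a, average W' W (Matrix.single a b 1) a b = Fintype.card I := by
  have h : ∀ a, average W' W (Matrix.single a b 1) a b =
      ∑ x, W' x a a * W (-x) b b := by
    intro a
    simp only [average, Matrix.sum_apply]
    refine Finset.sum_congr rfl fun x _ => ?_
    rw [Matrix.mul_apply, Finset.sum_eq_single b]
    · simp [Matrix.mul_apply, Matrix.single_apply]
    · intro j _ hj
      simp [Matrix.mul_apply, hj.symm]
    · simp
  simp only [h]
  rw [Finset.sum_comm]
  simp only [← Finset.sum_mul]
  rw [Finset.sum_eq_single 0]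
  · simp [h1, h1']
  · intro x _ hx
    have := hn x hx
    simp only [Matrix.trace, Matrix.diag_apply] at this
    rw [this, zero_mul]
  · simp

end Averaging

/-! ### Functions, open subschemes and equalizers -/

section Basic

variable {S : Scheme.{u}}

/-- Restriction of functions along a morphism of `S`-schemes. -/
def res {T' T : Over S} (f : T' ⟶ T) : Γ(T.left, ⊤) →+* Γ(T'.left, ⊤) := f.left.appTop.hom

@[simp] lemma res_id (T : Over S) : res (𝟙 T) = RingHom.id _ := by
  simp [res]

lemma res_comp {T'' T' T : Over S} (g : T'' ⟶ T') (f : T' ⟶ T) :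
    res (g ≫ f) = (res g).comp (res f) := by
  rw [res, Over.comp_left, Scheme.Hom.comp_appTop]
  rfl

lemma res_res {T'' T' T : Over S} (g : T'' ⟶ T') (f : T' ⟶ T) (a : Γ(T.left, ⊤)) :
    res g (res f a) = res (g ≫ f) a := by rw [res_comp]; rfl

@[simp] lemma GmPoints.val_map {T' T : Over S} (f : T' ⟶ T) (a : GmPoints T) :
    (GmPoints.map f a : Γ(T'.left, ⊤)) = res f (a : Γ(T.left, ⊤)) := rfl

/-- The open subscheme of an `S`-scheme, as an `S`-scheme. -/
abbrev opn (T : Over S) (U : T.left.Opens) : Over S := Over.mk (U.ι ≫ T.hom)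

/-- The inclusion of an open subscheme. -/
abbrev inc (T : Over S) (U : T.left.Opens) : opn T U ⟶ T := Over.homMk U.ι

instance (T : Over S) (U : T.left.Opens) : IsOpenImmersion (inc T U).left :=
  inferInstanceAs (IsOpenImmersion U.ι)

instance (T : Over S) (U : T.left.Opens) : Mono (inc T U) :=
  Over.mono_of_mono_left _

lemma inc_apply_mem (T : Over S) (U : T.left.Opens) (t : (opn T U).left) :
    (inc T U).left t ∈ U := by
  have : U.ι t ∈ Set.range U.ι := ⟨t, rfl⟩
  rwa [Scheme.Opens.range_ι] at this

lemma exists_inc_apply (T : Over S) (U : T.left.Opens) (t : T.left) (ht : t ∈ U) :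
    ∃ z : (opn T U).left, (inc T U).left z = t := by
  have : t ∈ Set.range U.ι := by rwa [Scheme.Opens.range_ι]
  exact this

/-- A morphism to `T` with image in an open `U` is a morphism to `U`. -/
def opnLift {W T : Over S} (U : T.left.Opens) (f : W ⟶ T) (hf : ∀ w, f.left w ∈ U) : W ⟶ opn T U :=
  Over.homMk (IsOpenImmersion.lift U.ι f.left (by
    rw [Scheme.Opens.range_ι]; rintro _ ⟨w, rfl⟩; exact hf w)) (by
    have := IsOpenImmersion.lift_fac U.ι f.left (by
      rw [Scheme.Opens.range_ι]; rintro _ ⟨w, rfl⟩; exact hf w)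
    simp only [Over.mk_left, Over.mk_hom]
    rw [reassoc_of% this, Over.w])

@[simp]
lemma opnLift_inc {W T : Over S} (U : T.left.Opens) (f : W ⟶ T) (hf : ∀ w, f.left w ∈ U) :
    opnLift U f hf ≫ inc T U = f := by
  ext1
  exact IsOpenImmersion.lift_fac _ _ _

/-- The inclusion of a smaller open subscheme. -/
abbrev incLE {T : Over S} {V U : T.left.Opens} (h : V ≤ U) : opn T V ⟶ opn T U :=
  opnLift U (inc T V) fun w => h (inc_apply_mem T V w)

/-- Functions on the open subscheme `U` of `T` are sections of `𝒪_T` over `U`. -/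
def toSection {T : Over S} (U : T.left.Opens) : Γ((opn T U).left, ⊤) ≃+* Γ(T.left, U) :=
  U.topIso.commRingCatIsoToRingEquiv

lemma toSection_res_inc {T : Over S} (U : T.left.Opens) (a : Γ(T.left, ⊤)) :
    toSection U (res (inc T U) a) = T.left.presheaf.map (homOfLE le_top : U ⟶ ⊤).op a := by
  have : U.ι.appTop ≫ U.topIso.hom = T.left.presheaf.map (homOfLE le_top : U ⟶ ⊤).op := by
    rw [Scheme.Opens.ι_appTop, Scheme.Opens.topIso_hom]
    exact (T.left.presheaf.map_comp _ _).symm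
  exact ConcreteCategory.congr_hom this a

lemma toSection_res_incLE {T : Over S} {V U : T.left.Opens} (h : V ≤ U)
    (a : Γ((opn T U).left, ⊤)) :
    toSection V (res (incLE h) a) = T.left.presheaf.map (homOfLE h).op (toSection U a) := by
  have h1 : (incLE h).left = T.left.homOfLE h := by
    rw [← cancel_mono U.ι, Scheme.homOfLE_ι]
    exact congrArg CommaMorphism.left (opnLift_inc U (inc T V) _)
  have : (incLE h).left.appTop ≫ V.topIso.hom =
      U.topIso.hom ≫ T.left.presheaf.map (homOfLE h).op := by
    rw [h1, Scheme.homOfLE_appTop, Scheme.Opens.topIso_hom, Scheme.Opens.topIso_hom]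
    refine (T.left.presheaf.map_comp _ _).symm.trans (Eq.trans ?_
      (T.left.presheaf.map_comp (eqToHom U.ι_image_top.symm).op (homOfLE h).op))
    congr 1
  exact ConcreteCategory.congr_hom this a

lemma res_inc_eq_iff {T : Over S} (U : T.left.Opens) (a b : Γ(T.left, ⊤)) :
    res (inc T U) a = res (inc T U) b ↔
      T.left.presheaf.map (homOfLE le_top : U ⟶ ⊤).op a =
        T.left.presheaf.map (homOfLE le_top : U ⟶ ⊤).op b := by
  rw [← toSection_res_inc, ← toSection_res_inc, (toSection U).injective.eq_iff]

lemma res_eq_of_locally {T : Over S} (a b : Γ(T.left, ⊤))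
    (h : ∀ t : T.left, ∃ U : T.left.Opens, t ∈ U ∧ res (inc T U) a = res (inc T U) b) : a = b := by
  choose U hU hab using h
  refine T.left.sheaf.eq_of_locally_eq' U ⊤ (fun t => homOfLE le_top) (fun t _ => ?_) a b fun t => ?_
  · exact TopologicalSpace.Opens.mem_iSup.mpr ⟨t, hU t⟩
  · exact (res_inc_eq_iff (U t) a b).mp (hab t)

lemma exists_res_eq {T : Over S} {I : Type u} (U : I → T.left.Opens) (hU : ∀ t, ∃ i, t ∈ U i)
    (a : ∀ i, Γ((opn T (U i)).left, ⊤))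
    (ha : ∀ (i j : I) (W : Over S) (f : W ⟶ opn T (U i)) (g : W ⟶ opn T (U j)),
      f ≫ inc T (U i) = g ≫ inc T (U j) → res f (a i) = res g (a j)) :
    ∃ b : Γ(T.left, ⊤), ∀ i, res (inc T (U i)) b = a i := by
  obtain ⟨b, hb, -⟩ := T.left.sheaf.existsUnique_gluing' U ⊤ (fun i => homOfLE le_top)
    (fun t _ => by
      obtain ⟨i, hi⟩ := hU t
      exact TopologicalSpace.Opens.mem_iSup.mpr ⟨i, hi⟩)
    (fun i => toSection (U i) (a i)) (fun i j => by
      have h := ha i j _ (incLE inf_le_left) (incLE inf_le_right) (by simp)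
      have h := congrArg (toSection (U i ⊓ U j)) h
      rw [toSection_res_incLE, toSection_res_incLE] at h
      exact h)
  refine ⟨b, fun i => (toSection (U i)).injective ?_⟩
  exact (toSection_res_inc (U i) b).trans (hb i)

/-- The locus where two points of an étale `S`-scheme agree, which is open since the diagonal is an
open immersion. -/
def eqLocus {T M : Over S} [Etale M.hom] (x y : T ⟶ M) : T.left.Opens :=
  haveI : IsOpenImmersion (Limits.pullback.diagonal M.hom) := inferInstance
  (Limits.pullback.fst (Limits.pullback.lift x.left y.left (by simp))
    (Limits.pullback.diagonal M.hom)).opensRange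

lemma comp_eq_comp_iff {W T M : Over S} [Etale M.hom] (x y : T ⟶ M) (f : W ⟶ T) :
    f ≫ x = f ≫ y ↔ ∀ w, f.left w ∈ eqLocus x y := by
  have hxy : x.left ≫ M.hom = y.left ≫ M.hom := by rw [Over.w, Over.w]
  set l := Limits.pullback.lift x.left y.left hxy with hl
  have hd : IsOpenImmersion (Limits.pullback.diagonal M.hom) := inferInstance
  constructor
  · intro h w
    have h' : f.left ≫ x.left = f.left ≫ y.left := congrArg CommaMorphism.left h
    have e : f.left ≫ l = (f.left ≫ x.left) ≫ Limits.pullback.diagonal M.hom := by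
      apply Limits.pullback.hom_ext
      · rw [Category.assoc, Category.assoc, hl, Limits.pullback.lift_fst,
          Limits.pullback.diagonal_fst, Category.comp_id]
      · rw [Category.assoc, Category.assoc, hl, Limits.pullback.lift_snd,
          Limits.pullback.diagonal_snd, Category.comp_id, h']
    have : f.left w = Limits.pullback.fst l (Limits.pullback.diagonal M.hom)
        (Limits.pullback.lift f.left _ e w) := by
      rw [← Scheme.Hom.comp_apply, Limits.pullback.lift_fst]
    rw [this]
    exact ⟨_, rfl⟩
  · intro h
    have hr : Set.range f.left ⊆
        Set.range (Limits.pullback.fst l (Limits.pullback.diagonal M.hom)) := by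
      rintro _ ⟨w, rfl⟩
      exact h w
    have hc := Limits.pullback.condition (f := l) (g := Limits.pullback.diagonal M.hom)
    have h1 := hc =≫ Limits.pullback.fst _ _
    have h2 := hc =≫ Limits.pullback.snd _ _
    simp only [hl, Category.assoc, Limits.pullback.lift_fst, Limits.pullback.lift_snd,
      Limits.pullback.diagonal_fst, Limits.pullback.diagonal_snd, Category.comp_id] at h1 h2
    ext1
    simp only [Over.comp_left]
    rw [← IsOpenImmersion.lift_fac _ f.left hr, Category.assoc, Category.assoc]
    exact congrArg _ (h1.trans h2.symm)

lemma isClosed_eqLocus {T M : Over S} [Etale M.hom] [IsFinite M.hom] (x y : T ⟶ M) :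
    IsClosed (eqLocus x y : Set T.left) := by
  exact (Limits.pullback.fst (Limits.pullback.lift x.left y.left (by simp))
    (Limits.pullback.diagonal M.hom)).isClosedEmbedding.isClosed_range

lemma isUnit_iff_forall_mem {T : Over S} (a : Γ(T.left, ⊤)) :
    IsUnit a ↔ ∀ t, t ∈ T.left.basicOpen a := by
  constructor
  · intro h t
    rw [Scheme.basicOpen_of_isUnit _ h]
    trivial
  · intro h
    exact RingedSpace.isUnit_of_isUnit_germ T.left.toRingedSpace ⊤ a fun t ht =>
      (T.left.mem_basicOpen a t ht).mp (h t)

lemma isUnit_res_iff {W T : Over S} (f : W ⟶ T) (a : Γ(T.left, ⊤)) :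
    IsUnit (res f a) ↔ ∀ w, f.left w ∈ T.left.basicOpen a := by
  rw [isUnit_iff_forall_mem, res]
  have : W.left.basicOpen (f.left.appTop.hom a) = f.left ⁻¹ᵁ T.left.basicOpen a :=
    (Scheme.preimage_basicOpen f.left a).symm
  rw [this]
  rfl

/-- A function is invertible if it is invertible at the image of every point of a family of
`T`-schemes which covers `T`. -/
lemma isUnit_of_forall {T : Over S} (a : Γ(T.left, ⊤))
    (h : ∀ t : T.left, ∃ (Q : Over S) (q : Q ⟶ T) (z : Q.left), q.left z = t ∧ IsUnit (res q a)) :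
    IsUnit a := by
  rw [isUnit_iff_forall_mem]
  intro t
  obtain ⟨Q, q, z, rfl, hq⟩ := h t
  exact (isUnit_res_iff q a).mp hq z

end Basic

/-! ### Frames and geometric points -/

/-- A frame of a symplectic module over `T`: two homomorphisms from a finite abelian group `K` to
`M(T)` with isotropic image, which are in perfect duality. The duality is expressed through a map
`ε : K → K` which selects for every nonzero `b` an element on which the character defined by `b`
is nontrivial at every point of `T`. -/
structure IsFrame {S : Scheme.{u}} (X : SymplecticModule S) {K : Type} [AddCommGroup K] (ε : K → K)
    {T : Over S} (x y : K → (T ⟶ X.M)) : Prop where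
  x_add : ∀ a b, x (a + b) = x a * x b
  y_add : ∀ a b, y (a + b) = y a * y b
  x_x : ∀ a b, X.e T (x a) (x b) = 1
  y_y : ∀ a b, X.e T (y a) (y b) = 1
  isUnit_left : ∀ b, b ≠ 0 → IsUnit ((X.e T (x (ε b)) (y b) : Γ(T.left, ⊤)) - 1)
  isUnit_right : ∀ b, b ≠ 0 → IsUnit ((X.e T (x b) (y (ε b)) : Γ(T.left, ⊤)) - 1)

instance (D : ModuleType) (i : Fin D.g) : NeZero (D.d i) := ⟨(D.d_pos i).ne'⟩

/-- The finite group `ℤ/d₁ × ⋯ × ℤ/d_g`. -/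
abbrev ModuleType.K (D : ModuleType) : Type := ∀ i, ZMod (D.d i)

lemma ModuleType.card_K (D : ModuleType) : Fintype.card D.K = D.card := by
  simp [ModuleType.card, ZMod.card]

open Classical in
/-- For a nonzero `b` a basis vector with index `i` such that `bᵢ ≠ 0`. -/
def ModuleType.eps (D : ModuleType) (b : D.K) : D.K :=
  if h : ∃ i, b i ≠ 0 then Pi.single h.choose 1 else 0

section StdPairing

variable {S : Scheme.{u}} {T : Over S} (D : ModuleType)

/-- The characters of `K` attached to roots of unity `ζᵢ` and `b ∈ K`. -/
def rootPow (z : ∀ i, rootsOfUnity (D.d i) Γ(T.left, ⊤)) (b : D.K) :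
    ∀ i, rootsOfUnity (D.d i) Γ(T.left, ⊤) := fun i => z i ^ (b i).val

lemma rootPow_add (z : ∀ i, rootsOfUnity (D.d i) Γ(T.left, ⊤)) (b b' : D.K) :
    rootPow D z (b + b') = rootPow D z b * rootPow D z b' := by
  funext i
  simp only [rootPow, Pi.mul_apply, Pi.add_apply, ZMod.val_add, ← pow_add]
  refine (pow_eq_pow_mod _ ?_).symm
  exact Subtype.ext ((mem_rootsOfUnity _ _).mp (z i).2)

lemma stdEval_one (a : D.K) :
    stdEval D (1 : ∀ i, rootsOfUnity (D.d i) Γ(T.left, ⊤)) a = 1 := by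
  simp [stdEval]

lemma stdEval_zero (z : ∀ i, rootsOfUnity (D.d i) Γ(T.left, ⊤)) :
    stdEval D z 0 = 1 := by
  simp [stdEval]

variable {D} in
lemma eps_spec {b : D.K} (hb : b ≠ 0) : ∃ i, b i ≠ 0 ∧ D.eps b = Pi.single i 1 := by
  classical
  have h : ∃ i, b i ≠ 0 := by
    by_contra h
    push Not at h
    exact hb (funext h)
  refine ⟨h.choose, h.choose_spec, ?_⟩
  rw [ModuleType.eps, dif_pos h]

/-- A basis vector detects the character attached to `b`, and is detected by it, through the power
of the root of unity with exponent `bᵢ`. -/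
lemma stdEval_rootPow_single (z : ∀ i, rootsOfUnity (D.d i) Γ(T.left, ⊤)) (b : D.K) (i : Fin D.g)
    (hi : b i ≠ 0) :
    stdEval D (rootPow D z b) (Pi.single i 1) = (z i : GmPoints T) ^ (b i).val ∧
      stdEval D (rootPow D z (Pi.single i 1)) b = (z i : GmPoints T) ^ (b i).val := by
  have h1 : (1 : ZMod (D.d i)).val = 1 := by
    have : Fact (1 < D.d i) := ⟨by
      by_contra h
      have h1 : D.d i = 1 := le_antisymm (not_lt.mp h) (D.d_pos i)
      have : Subsingleton (ZMod (D.d i)) := by rw [h1]; infer_instance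
      exact hi (Subsingleton.elim _ _)⟩
    exact ZMod.val_one _
  constructor
  · rw [stdEval, Finset.prod_eq_single i]
    · simp [rootPow, h1]
    · intro j _ hj
      simp [Pi.single_eq_of_ne hj]
    · simp
  · rw [stdEval, Finset.prod_eq_single i]
    · simp [rootPow, h1]
    · intro j _ hj
      simp [rootPow, Pi.single_eq_of_ne hj]
    · simp

end StdPairing

/-- Every point `t` of an `S`-scheme `T` is the image of a geometric point `Q`, at which the
symplectic module is standard. The consequences of this which matter later are that `#D` is
invertible at `Q` and annihilates `M(Q)`, that `M(Q)` has at most `(#D)²` points, and that there is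
a frame over `Q`. -/
lemma exists_geometricPoint {S : Scheme.{u}} {X : SymplecticModule S} {D : ModuleType}
    (hX : X.HasType D) (T : Over S) (t : T.left) :
    ∃ (Q : Over S) (q : Q ⟶ T) (z : Q.left), q.left z = t ∧ IsField Γ(Q.left, ⊤) ∧
      IsUnit (D.card : Γ(Q.left, ⊤)) ∧ (∀ m : Q ⟶ X.M, m ^ D.card = 1) ∧ Finite (Q ⟶ X.M) ∧
      Nat.card (Q ⟶ X.M) ≤ D.card * D.card ∧
      ∃ x y : D.K → (Q ⟶ X.M), IsFrame X D.eps x y := by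
  let k := AlgebraicClosure (T.left.residueField t)
  let s₀ : Spec (.of k) ⟶ T.left :=
    Spec.map (CommRingCat.ofHom (algebraMap (T.left.residueField t) k)) ≫
      T.left.fromSpecResidueField t
  let s := s₀ ≫ T.hom
  obtain ⟨hDk, ⟨φ⟩⟩ := hX k s
  let B : Over (Spec (.of k)) := Over.mk (𝟙 _)
  let Q : Over S := (Over.map s).obj B
  have eF : k ≃+* Γ(Q.left, ⊤) := (Scheme.ΓSpecIso (.of k)).commRingCatIsoToRingEquiv.symm
  have hF : IsField Γ(Q.left, ⊤) := MulEquiv.isField (Field.toIsField k) eF.symm.toMulEquiv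
  have : IsDomain Γ(B.left, ⊤) := hF.isDomain
  have hsub : ∀ z z' : Q.left, z = z' := fun z z' =>
    Subsingleton.elim (α := PrimeSpectrum k) z z'
  have hdk : ∀ i, NeZero (D.d i : k) := fun i => ⟨fun h => hDk (by
    have : D.d i ∣ D.card := Finset.dvd_prod_of_mem _ (Finset.mem_univ i)
    obtain ⟨m, hm⟩ := this
    rw [hm, Nat.cast_mul, h, zero_mul])⟩
  have hroot : ∀ i, ∃ z : rootsOfUnity (D.d i) Γ(B.left, ⊤),
      IsPrimitiveRoot ((z : Γ(B.left, ⊤)ˣ) : Γ(B.left, ⊤)) (D.d i) := by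
    intro i
    obtain ⟨w, hw⟩ := HasEnoughRootsOfUnity.exists_primitiveRoot k (D.d i)
    have := hw.map_of_injective (f := eF) eF.injective
    exact ⟨this.toRootsOfUnity, this⟩
  choose z hz using hroot
  let z₀ : Q.left := (⊥ : PrimeSpectrum k)
  have hpow : ∀ p : StdPoints D B, p ^ D.card = 1 := by
    intro p
    refine Prod.ext ?_ ?_
    · refine LocallyConstant.ext fun w => ?_
      change (p.1 w) ^ D.card = 1
      rw [← D.card_K]
      exact (congrArg (_ ^ ·) (Fintype.card_congr Multiplicative.ofAdd)).trans pow_card_eq_one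
    · funext i
      obtain ⟨m, hm⟩ : D.d i ∣ D.card := Finset.dvd_prod_of_mem _ (Finset.mem_univ i)
      change (p.2 i) ^ D.card = 1
      rw [hm, pow_mul]
      have : (p.2 i) ^ D.d i = 1 := Subtype.ext ((mem_rootsOfUnity _ _).mp (p.2 i).2)
      rw [this, one_pow]
  have hfin : Finite (StdPoints D B) := by
    have h1 : Function.Injective (fun (f : LocallyConstant B.left (Multiplicative D.K)) => f z₀) := by
      intro f g h
      refine LocallyConstant.ext fun w => ?_
      rw [hsub w z₀]
      exact h
    have := Finite.of_injective _ h1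
    have : Finite (∀ i, rootsOfUnity (D.d i) Γ(B.left, ⊤)) := by
      have : ∀ i, Finite (rootsOfUnity (D.d i) Γ(B.left, ⊤)) := fun i => inferInstance
      infer_instance
    infer_instance
  have hcard : Nat.card (StdPoints D B) ≤ D.card * D.card := by
    rw [Nat.card_prod]
    refine Nat.mul_le_mul ?_ ?_
    · have h1 : Function.Injective
          (fun (f : LocallyConstant B.left (Multiplicative D.K)) => f z₀) := by
        intro f g h
        refine LocallyConstant.ext fun w => ?_
        rw [hsub w z₀]
        exact h
      refine (Nat.card_le_card_of_injective _ h1).trans ?_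
      rw [← D.card_K, Nat.card_eq_fintype_card]
      exact le_of_eq (Fintype.card_congr Multiplicative.toAdd)
    · rw [Nat.card_pi]
      refine Finset.prod_le_prod' fun i _ => ?_
      exact card_rootsOfUnity _ _
  refine ⟨Q, Over.homMk s₀ (by simp [Q, B, s]), z₀, ?_, hF, ?_, ?_, ?_, ?_, ?_⟩
  · have : (T.left.fromSpecResidueField t) (Spec.map (CommRingCat.ofHom
        (algebraMap (T.left.residueField t) k)) z₀) = t := Scheme.fromSpecResidueField_apply _ _
    exact this
  · have : IsUnit (D.card : k) := isUnit_iff_ne_zero.mpr hDk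
    have := this.map eF
    rwa [map_natCast] at this
  · intro m
    apply (φ.toEquiv B).injective
    rw [map_pow, hpow, map_one]
  · exact Finite.of_equiv _ (φ.toEquiv B).toEquiv.symm
  · rw [Nat.card_congr (φ.toEquiv B).toEquiv]
    exact hcard
  let x : D.K → (Q ⟶ X.M) := fun a =>
    (φ.toEquiv B).symm (LocallyConstant.const _ (Multiplicative.ofAdd a), 1)
  let y : D.K → (Q ⟶ X.M) := fun b => (φ.toEquiv B).symm (1, rootPow D z b)
  have ex : ∀ a, φ.toEquiv B (x a) = (LocallyConstant.const _ (Multiplicative.ofAdd a), 1) :=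
    fun a => (φ.toEquiv B).apply_symm_apply _
  have ey : ∀ b, φ.toEquiv B (y b) = (1, rootPow D z b) :=
    fun b => (φ.toEquiv B).apply_symm_apply _
  have hxy : ∀ a b, X.e Q (x a) (y b) = stdEval D (rootPow D z b) a := by
    intro a b
    refine (φ.pairing B (x a) (y b) a 0 (fun t => by rw [ex]; rfl)
      (fun t => by rw [ey]; rfl)).trans ?_
    rw [ex, ey, stdEval_one, inv_one]
    exact MulOneClass.mul_one _
  have hunit : ∀ i (b : D.K), b i ≠ 0 →
      IsUnit ((((z i : GmPoints B) ^ (b i).val : GmPoints B) : Γ(B.left, ⊤)) - 1) := by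
    intro i b hb
    have hne : (((z i : GmPoints B) ^ (b i).val : GmPoints B) : Γ(B.left, ⊤)) - 1 ≠ 0 := by
      intro h
      rw [sub_eq_zero, Units.val_pow_eq_pow_val, (hz i).pow_eq_one_iff_dvd] at h
      have := Nat.le_of_dvd (Nat.pos_of_ne_zero fun h0 => hb ((ZMod.val_eq_zero _).mp h0)) h
      exact absurd (ZMod.val_lt (b i)) (not_lt.mpr this)
    obtain ⟨v, hv⟩ := hF.mul_inv_cancel hne
    exact IsUnit.of_mul_eq_one _ hv
  refine ⟨x, y, ?_, ?_, ?_, ?_, ?_, ?_⟩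
  · intro a b
    apply (φ.toEquiv B).injective
    rw [map_mul, ex, ex, ex]
    exact Prod.ext rfl (MulOneClass.mul_one _).symm
  · intro a b
    apply (φ.toEquiv B).injective
    rw [map_mul, ey, ey, ey, rootPow_add]
    exact Prod.ext (MulOneClass.mul_one _).symm rfl
  · intro a b
    refine (φ.pairing B (x a) (x b) a b (fun t => by rw [ex]; rfl)
      (fun t => by rw [ex]; rfl)).trans ?_
    rw [ex, ex, stdEval_one, stdEval_one, mul_inv_cancel]
  · intro a b
    refine (φ.pairing B (y a) (y b) 0 0 (fun t => by rw [ey]; rfl)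
      (fun t => by rw [ey]; rfl)).trans ?_
    rw [ey, ey, stdEval_zero, stdEval_zero, mul_inv_cancel]
  · intro b hb
    obtain ⟨i, hi, hε⟩ := eps_spec hb
    rw [hxy, hε, (stdEval_rootPow_single D z b i hi).1]
    exact hunit i b hi
  · intro b hb
    obtain ⟨i, hi, hε⟩ := eps_spec hb
    rw [hxy, hε, (stdEval_rootPow_single D z b i hi).2]
    exact hunit i b hi

/-! ### Torsion and the square root of the pairing -/

section Torsion

variable {S : Scheme.{u}} {X : SymplecticModule S} {D : ModuleType}

/-- By the rigidity of étale schemes it is enough to check this at geometric points. -/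
lemma SymplecticModule.HasType.pow_card (hX : X.HasType D) {T : Over S} (m : T ⟶ X.M) :
    m ^ D.card = 1 := by
  rw [← Category.id_comp (m ^ D.card), ← Category.id_comp (1 : T ⟶ X.M), comp_eq_comp_iff]
  intro t
  obtain ⟨Q, q, z, rfl, -, -, h, -⟩ := exists_geometricPoint hX T t
  refine (comp_eq_comp_iff _ _ q).mp ?_ z
  rw [MonObj.comp_pow, h, MonObj.comp_one]

lemma SymplecticModule.HasType.isUnit_card (hX : X.HasType D) (T : Over S) :
    IsUnit (D.card : Γ(T.left, ⊤)) := by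
  refine isUnit_of_forall _ fun t => ?_
  obtain ⟨Q, q, z, rfl, -, h, -⟩ := exists_geometricPoint hX T t
  exact ⟨Q, q, z, rfl, by rwa [map_natCast]⟩

/-- The homomorphism `e(-, y)`. -/
def SymplecticModule.eLeft (X : SymplecticModule S) {T : Over S} (y : T ⟶ X.M) :
    (T ⟶ X.M) →* GmPoints T :=
  MonoidHom.mk' (fun x => X.e T x y) fun x x' => X.e_mul_left T x x' y

/-- The homomorphism `e(x, -)`. -/
def SymplecticModule.eRight (X : SymplecticModule S) {T : Over S} (x : T ⟶ X.M) :
    (T ⟶ X.M) →* GmPoints T :=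
  MonoidHom.mk' (fun y => X.e T x y) fun y y' => X.e_mul_right T x y y'

namespace SymplecticModule

variable (X) {T : Over S}

lemma e_one_left (y : T ⟶ X.M) : X.e T 1 y = 1 := map_one (X.eLeft y)

lemma e_one_right (x : T ⟶ X.M) : X.e T x 1 = 1 := map_one (X.eRight x)

lemma e_pow_left (x y : T ⟶ X.M) (k : ℕ) : X.e T (x ^ k) y = X.e T x y ^ k :=
  map_pow (X.eLeft y) x k

lemma e_inv_left (x y : T ⟶ X.M) : X.e T x⁻¹ y = (X.e T x y)⁻¹ := map_inv (X.eLeft y) x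

lemma e_inv_right (x y : T ⟶ X.M) : X.e T x y⁻¹ = (X.e T x y)⁻¹ := map_inv (X.eRight x) y

lemma e_mul_e_swap (x y : T ⟶ X.M) : X.e T x y * X.e T y x = 1 := by
  have h := X.e_self T (x * y)
  rwa [X.e_mul_left, X.e_mul_right, X.e_mul_right, X.e_self, X.e_self, _root_.one_mul,
    _root_.mul_one] at h

/-- The square root `e^{(n+1)/2}` of the pairing `e`, for `n` odd. -/
def half (n : ℕ) (x y : T ⟶ X.M) : GmPoints T := X.e T x y ^ ((n + 1) / 2)

variable (n : ℕ)

lemma half_natural {T' : Over S} (f : T' ⟶ T) (x y : T ⟶ X.M) :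
    X.half n (f ≫ x) (f ≫ y) = GmPoints.map f (X.half n x y) := by
  rw [half, X.e_natural, half, map_pow]

lemma half_mul_left (x x' y : T ⟶ X.M) : X.half n (x * x') y = X.half n x y * X.half n x' y := by
  rw [half, X.e_mul_left, mul_pow]; rfl

lemma half_mul_right (x y y' : T ⟶ X.M) :
    X.half n x (y * y') = X.half n x y * X.half n x y' := by
  rw [half, X.e_mul_right, mul_pow]; rfl

@[simp] lemma half_self (x : T ⟶ X.M) : X.half n x x = 1 := by rw [half, X.e_self, one_pow]

@[simp] lemma half_one_left (x : T ⟶ X.M) : X.half n 1 x = 1 := by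
  rw [half, X.e_one_left, one_pow]

@[simp] lemma half_one_right (x : T ⟶ X.M) : X.half n x 1 = 1 := by
  rw [half, X.e_one_right, one_pow]

lemma half_inv_left (x y : T ⟶ X.M) : X.half n x⁻¹ y = (X.half n x y)⁻¹ := by
  rw [half, X.e_inv_left, inv_pow]; rfl

lemma half_inv_right (x y : T ⟶ X.M) : X.half n x y⁻¹ = (X.half n x y)⁻¹ := by
  rw [half, X.e_inv_right, inv_pow]; rfl

lemma half_swap (x y : T ⟶ X.M) : X.half n y x = (X.half n x y)⁻¹ := by
  rw [eq_inv_iff_mul_eq_one, half, half, ← mul_pow, X.e_mul_e_swap, one_pow]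

end SymplecticModule

lemma SymplecticModule.HasType.e_pow_card (hX : X.HasType D) {T : Over S} (x y : T ⟶ X.M) :
    X.e T x y ^ D.card = 1 := by
  rw [← X.e_pow_left, hX.pow_card, X.e_one_left]

lemma SymplecticModule.HasType.half_mul_half (hX : X.HasType D) (hD : Odd D.card) {T : Over S}
    (x y : T ⟶ X.M) : X.half D.card x y * X.half D.card x y = X.e T x y := by
  obtain ⟨k, hk⟩ := hD
  rw [SymplecticModule.half, ← pow_add, show (D.card + 1) / 2 + (D.card + 1) / 2 = D.card + 1 by
    omega, pow_succ, hX.e_pow_card, _root_.one_mul]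

lemma SymplecticModule.HasType.half_pow_card (hX : X.HasType D) {T : Over S}
    (x y : T ⟶ X.M) : X.half D.card x y ^ D.card = 1 := by
  rw [SymplecticModule.half, ← pow_mul, mul_comm, pow_mul, hX.e_pow_card, one_pow]

lemma eq_one_of_sq_of_pow_odd {G : Type*} [Monoid G] {n : ℕ} (hn : Odd n) (c : G)
    (h2 : c * c = 1) (h : c ^ n = 1) : c = 1 := by
  obtain ⟨k, rfl⟩ := hn
  rwa [pow_succ, pow_mul, pow_two, h2, one_pow, _root_.one_mul] at h

end Torsion

/-! ### The affine line and the multiplicative group as schemes -/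

section Gm

variable (S : Scheme.{u})

/-- The affine line over `S`. -/
def affineLine : Over S := Over.mk (𝔸(PUnit.{u + 1}; S) ↘ S)

/-- The coordinate of the affine line. -/
def coordinate : Γ((affineLine S).left, ⊤) := AffineSpace.coord S PUnit.unit

variable {S}

/-- The morphism to the affine line given by a function. -/
def homAffineLine {T : Over S} (a : Γ(T.left, ⊤)) : T ⟶ affineLine S :=
  Over.homMk (AffineSpace.homOfVector T.hom fun _ => a) (AffineSpace.homOfVector_over _ _)

@[simp] lemma res_homAffineLine {T : Over S} (a : Γ(T.left, ⊤)) :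
    res (homAffineLine a) (coordinate S) = a :=
  AffineSpace.homOfVector_appTop_coord T.hom (fun _ => a) PUnit.unit

lemma affineLine_hom_ext {T : Over S} {f g : T ⟶ affineLine S}
    (h : res f (coordinate S) = res g (coordinate S)) : f = g := by
  ext1
  refine AffineSpace.hom_ext ((Over.w f).trans (Over.w g).symm) fun i => ?_
  exact h

variable (S) in
/-- The multiplicative group as a scheme over `S`: the locus in the affine line where the
coordinate is invertible. -/
abbrev gm : Over S := opn (affineLine S) ((affineLine S).left.basicOpen (coordinate S))

variable (S) in
/-- The inclusion of the multiplicative group in the affine line. -/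
abbrev gmInc : gm S ⟶ affineLine S := inc _ _

lemma isUnit_res_gmInc {T : Over S} (f : T ⟶ gm S) :
    IsUnit (res (f ≫ gmInc S) (coordinate S)) := by
  rw [isUnit_res_iff]
  exact fun w => inc_apply_mem _ _ (f.left w)

/-- The scheme `gm S` represents the functor of invertible functions. -/
def gmEquiv (T : Over S) : (T ⟶ gm S) ≃ GmPoints T where
  toFun f := (isUnit_res_gmInc f).unit
  invFun a := opnLift _ (homAffineLine (a : Γ(T.left, ⊤))) ((isUnit_res_iff _ _).mp (by simp))
  left_inv f := by
    apply (cancel_mono (gmInc S)).mp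
    refine (opnLift_inc _ _ _).trans (affineLine_hom_ext ?_)
    rw [res_homAffineLine]
    rfl
  right_inv a := by
    ext
    refine (congrArg (fun g => res g (coordinate S)) (opnLift_inc _ _ _)).trans ?_
    rw [res_homAffineLine]

lemma gmEquiv_comp {T' T : Over S} (f : T' ⟶ T) (a : T ⟶ gm S) :
    gmEquiv T' (f ≫ a) = GmPoints.map f (gmEquiv T a) := by
  ext
  refine (congrArg (fun g => res g (coordinate S)) (Category.assoc f a (gmInc S))).trans ?_
  rw [← res_res]
  rfl

end Gm

/-! ### Group structures on points -/

section Points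

variable {C : Type*} [Category* C] [CartesianMonoidalCategory C]

/-- A natural family of group structures on the sets `T ⟶ G` makes `G` a group object. -/
abbrev grpObjOfPoints {G : C} (gr : ∀ T : C, Group (T ⟶ G))
    (h : ∀ {T' T : C} (f : T' ⟶ T) (x y : T ⟶ G), f ≫ (gr T).mul x y = (gr T').mul (f ≫ x) (f ≫ y)) :
    GrpObj G :=
  GrpObj.ofRepresentableBy G
    { obj T := @GrpCat.of (T.unop ⟶ G) (gr T.unop)
      map {T T'} f :=
        letI := gr T.unop
        letI := gr T'.unop
        GrpCat.ofHom (MonoidHom.mk' (fun x : T.unop ⟶ G => f.unop ≫ x) (fun x y => h f.unop x y))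
      map_id T := by ext x; exact Category.id_comp x
      map_comp f g := by ext x; exact Category.assoc _ _ x }
    { homEquiv := Equiv.refl _
      homEquiv_comp := fun _ _ => rfl }

lemma grpObjOfPoints_mul {G : C} (gr : ∀ T : C, Group (T ⟶ G))
    (h : ∀ {T' T : C} (f : T' ⟶ T) (x y : T ⟶ G), f ≫ (gr T).mul x y = (gr T').mul (f ≫ x) (f ≫ y))
    {T : C} (x y : T ⟶ G) :
    let := grpObjOfPoints gr h
    x * y = (gr T).mul x y := by
  let := grpObjOfPoints gr h
  have : x * y = CartesianMonoidalCategory.lift x y ≫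
    (gr _).mul (SemiCartesianMonoidalCategory.fst G G) (SemiCartesianMonoidalCategory.snd G G) := rfl
  refine this.trans ((h _ _ _).trans ?_)
  rw [CartesianMonoidalCategory.lift_fst, CartesianMonoidalCategory.lift_snd]

lemma isMonHom_of_points {G H : C} [GrpObj G] [GrpObj H] (f : G ⟶ H)
    (h : ∀ (T : C) (x y : T ⟶ G), (x * y) ≫ f = (x ≫ f) * (y ≫ f)) : IsMonHom f where
  one_hom := by
    have := h _ (1 : 𝟙_ C ⟶ G) 1
    rw [_root_.one_mul] at this
    rw [MonObj.one_eq_one, MonObj.one_eq_one]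
    exact (mul_eq_left.mp this.symm)
  mul_hom := by
    rw [MonObj.mul_eq_mul, h, MonObj.mul_eq_mul, MonObj.comp_mul]
    simp

/-- An endomorphism of order two as an isomorphism. -/
@[simps] def isoOfInvolution {G : C} (f : G ⟶ G) (h : f ≫ f = 𝟙 G) : G ≅ G := ⟨f, f, h, h⟩

end Points

/-! ### The standard symmetric theta group -/

section Standard

variable {S : Scheme.{u}} (X : SymplecticModule S)

/-- The `T`-points of the standard theta group: the set `𝔾ₘ(T) × M(T)` with the multiplication
`(a, x) (b, y) = (a b e^{1/2}(x, y), x y)`, where `e^{1/2} = e^{(n+1)/2}`. The underlying set does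
not depend on the number `n`, which is a parameter of the type because the multiplication does. -/
@[ext] structure StdTheta (_ : ℕ) (T : Over S) where
  /-- the component in `𝔾ₘ` -/
  fst : GmPoints T
  /-- the component in `M` -/
  snd : T ⟶ X.M

variable (n : ℕ)

namespace StdTheta

variable {X n} {T : Over S}

instance : Group (StdTheta X n T) where
  mul p q := ⟨p.1 * q.1 * X.half n p.2 q.2, p.2 * q.2⟩
  one := ⟨1, 1⟩
  inv p := ⟨p.1⁻¹, p.2⁻¹⟩
  mul_assoc p q r := by
    refine StdTheta.ext ?_ (_root_.mul_assoc _ _ _)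
    change p.1 * q.1 * X.half n p.2 q.2 * r.1 * X.half n (p.2 * q.2) r.2 =
      p.1 * (q.1 * r.1 * X.half n q.2 r.2) * X.half n p.2 (q.2 * r.2)
    rw [X.half_mul_left, X.half_mul_right]
    ac_rfl
  one_mul p := by
    refine StdTheta.ext ?_ (_root_.one_mul _)
    change 1 * p.1 * X.half n 1 p.2 = p.1
    simp
  mul_one p := by
    refine StdTheta.ext ?_ (_root_.mul_one _)
    change p.1 * 1 * X.half n p.2 1 = p.1
    simp
  inv_mul_cancel p := by
    refine StdTheta.ext ?_ (inv_mul_cancel _)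
    change p.1⁻¹ * p.1 * X.half n p.2⁻¹ p.2 = 1
    rw [X.half_inv_left, X.half_self]
    simp

lemma mul_fst (p q : StdTheta X n T) : (p * q).1 = p.1 * q.1 * X.half n p.2 q.2 := rfl
lemma mul_snd (p q : StdTheta X n T) : (p * q).2 = p.2 * q.2 := rfl
lemma one_fst : (1 : StdTheta X n T).1 = 1 := rfl
lemma one_snd : (1 : StdTheta X n T).2 = 1 := rfl
lemma inv_fst (p : StdTheta X n T) : (p⁻¹).1 = p.1⁻¹ := rfl
lemma inv_snd (p : StdTheta X n T) : (p⁻¹).2 = p.2⁻¹ := rfl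

/-- Restriction of points of the standard theta group. -/
def map {T' T : Over S} (f : T' ⟶ T) (p : StdTheta X n T) : StdTheta X n T' :=
  ⟨GmPoints.map f p.1, f ≫ p.2⟩

lemma map_mul {T' T : Over S} (f : T' ⟶ T) (p q : StdTheta X n T) :
    map f (p * q) = map f p * map f q := by
  refine StdTheta.ext ?_ (MonObj.comp_mul _ _ _)
  change GmPoints.map f (p.1 * q.1 * X.half n p.2 q.2) =
    GmPoints.map f p.1 * GmPoints.map f q.1 * X.half n (f ≫ p.2) (f ≫ q.2)
  rw [X.half_natural, _root_.map_mul, _root_.map_mul]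

variable (X n T) in
/-- The scheme `𝔾ₘ × M` represents the functor `StdTheta X n`. -/
def equiv : (T ⟶ gm S ⊗ X.M) ≃ StdTheta X n T where
  toFun f := ⟨gmEquiv T (f ≫ SemiCartesianMonoidalCategory.fst _ _),
    f ≫ SemiCartesianMonoidalCategory.snd _ _⟩
  invFun p := CartesianMonoidalCategory.lift ((gmEquiv T).symm p.1) p.2
  left_inv f := by
    apply CartesianMonoidalCategory.hom_ext <;> simp
  right_inv p := by
    ext1 <;> simp

lemma equiv_comp {T' T : Over S} (f : T' ⟶ T) (p : T ⟶ gm S ⊗ X.M) :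
    equiv X n T' (f ≫ p) = map f (equiv X n T p) := by
  refine StdTheta.ext ?_ (Category.assoc _ _ _)
  exact (congrArg (gmEquiv T') (Category.assoc _ _ _)).trans (gmEquiv_comp _ _)

lemma equiv_symm_comp {T' T : Over S} (f : T' ⟶ T) (p : StdTheta X n T) :
    f ≫ (equiv X n T).symm p = (equiv X n T').symm (map f p) := by
  rw [Equiv.eq_symm_apply, equiv_comp, Equiv.apply_symm_apply]

end StdTheta

/-- The underlying scheme of the standard theta group. The parameter is the number `n` in the
definition of its group structure. -/
def stdThetaScheme (_ : ℕ) : Over S := gm S ⊗ X.M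

/-- The points of the scheme underlying the standard theta group. -/
def stdThetaEquiv (T : Over S) : (T ⟶ stdThetaScheme X n) ≃ StdTheta X n T :=
  StdTheta.equiv X n T

variable {X n} in
lemma stdThetaEquiv_comp {T' T : Over S} (f : T' ⟶ T) (p : T ⟶ stdThetaScheme X n) :
    stdThetaEquiv X n T' (f ≫ p) = StdTheta.map f (stdThetaEquiv X n T p) :=
  StdTheta.equiv_comp f p

variable {X n} in
lemma comp_stdThetaEquiv_symm {T' T : Over S} (f : T' ⟶ T) (p : StdTheta X n T) :
    f ≫ (stdThetaEquiv X n T).symm p = (stdThetaEquiv X n T').symm (StdTheta.map f p) :=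
  StdTheta.equiv_symm_comp f p

variable {X n} in
lemma comp_stdThetaEquiv_group_mul {T' T : Over S} (f : T' ⟶ T) (x y : T ⟶ stdThetaScheme X n) :
    f ≫ (stdThetaEquiv X n T).group.mul x y =
      (stdThetaEquiv X n T').group.mul (f ≫ x) (f ≫ y) := by
  change f ≫ (stdThetaEquiv X n _).symm (stdThetaEquiv X n _ x * stdThetaEquiv X n _ y) =
    (stdThetaEquiv X n _).symm (stdThetaEquiv X n _ (f ≫ x) * stdThetaEquiv X n _ (f ≫ y))
  rw [comp_stdThetaEquiv_symm, StdTheta.map_mul, stdThetaEquiv_comp, stdThetaEquiv_comp]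

instance : GrpObj (stdThetaScheme X n) :=
  grpObjOfPoints (fun T => (stdThetaEquiv X n T).group) comp_stdThetaEquiv_group_mul

variable {X n} in
lemma stdThetaEquiv_mul {T : Over S} (x y : T ⟶ stdThetaScheme X n) :
    stdThetaEquiv X n T (x * y) = stdThetaEquiv X n T x * stdThetaEquiv X n T y := by
  refine (congrArg (stdThetaEquiv X n T) (grpObjOfPoints_mul
    (fun T => (stdThetaEquiv X n T).group) comp_stdThetaEquiv_group_mul x y)).trans ?_
  exact Equiv.apply_symm_apply _ _

/-- `stdThetaEquiv` as an isomorphism of groups. -/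
def stdThetaMulEquiv (T : Over S) : (T ⟶ stdThetaScheme X n) ≃* StdTheta X n T :=
  { stdThetaEquiv X n T with map_mul' := stdThetaEquiv_mul }

/-- The projection of the standard theta group to `M`. -/
def stdThetaProj : stdThetaScheme X n ⟶ X.M := SemiCartesianMonoidalCategory.snd _ _

lemma comp_stdThetaProj {T : Over S} (x : T ⟶ stdThetaScheme X n) :
    x ≫ stdThetaProj X n = (stdThetaMulEquiv X n T x).2 := rfl

instance : IsMonHom (stdThetaProj X n) := isMonHom_of_points _ fun T x y => by
  simp only [comp_stdThetaProj, map_mul, StdTheta.mul_snd]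

/-- The automorphism `(a, x) ↦ (a, x⁻¹)`. -/
def stdThetaNeg : stdThetaScheme X n ⟶ stdThetaScheme X n :=
  CartesianMonoidalCategory.lift (SemiCartesianMonoidalCategory.fst _ _)
    (SemiCartesianMonoidalCategory.snd (gm S) X.M ≫ ι[X.M])

variable {X n} in
lemma stdThetaEquiv_stdThetaNeg {T : Over S} (x : T ⟶ stdThetaScheme X n) :
    stdThetaEquiv X n T (x ≫ stdThetaNeg X n) =
      ⟨(stdThetaEquiv X n T x).1, (stdThetaEquiv X n T x).2⁻¹⟩ := by
  refine StdTheta.ext (congrArg (gmEquiv T) ?_) ?_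
  · exact (Category.assoc _ _ _).trans (congrArg (x ≫ ·) (CartesianMonoidalCategory.lift_fst _ _))
  · refine (Category.assoc _ _ _).trans
      ((congrArg (x ≫ ·) (CartesianMonoidalCategory.lift_snd _ _)).trans ?_)
    exact (Category.assoc _ _ _).symm

lemma stdThetaNeg_comp_stdThetaNeg : stdThetaNeg X n ≫ stdThetaNeg X n = 𝟙 _ := by
  apply (stdThetaEquiv X n _).injective
  have h := stdThetaEquiv_stdThetaNeg (𝟙 (stdThetaScheme X n))
  rw [Category.id_comp] at h
  rw [stdThetaEquiv_stdThetaNeg, h]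
  exact StdTheta.ext rfl (_root_.inv_inv _)

variable {D : ModuleType} {X}

/-- The standard theta group of a symplectic module of odd type. -/
def stdTheta (hX : X.HasType D) (hD : Odd D.card) : ThetaGroup X where
  G := stdThetaScheme X D.card
  incl T := (stdThetaMulEquiv X D.card T).symm.toMonoidHom.comp
    (MonoidHom.mk' (fun a => ⟨a, 1⟩) fun a b => by
      refine StdTheta.ext ?_ (_root_.one_mul _).symm
      rw [StdTheta.mul_fst, SymplecticModule.half_self, _root_.mul_one])
  incl_natural {T' T} f a := by
    refine Eq.trans ?_ (comp_stdThetaEquiv_symm f _).symm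
    refine congrArg (stdThetaEquiv X D.card T').symm (StdTheta.ext rfl (MonObj.comp_one _).symm)
  proj := stdThetaProj X D.card
  incl_injective T a b h := by
    have := (stdThetaMulEquiv X D.card T).symm.injective h
    exact congrArg StdTheta.fst this
  exact T x := by
    rw [comp_stdThetaProj]
    constructor
    · intro h
      refine ⟨(stdThetaMulEquiv X D.card T x).1, ?_⟩
      rw [MonoidHom.comp_apply]
      refine (MulEquiv.symm_apply_eq _).mpr (StdTheta.ext rfl h.symm)
    · rintro ⟨a, rfl⟩
      exact congrArg StdTheta.snd ((stdThetaMulEquiv X D.card T).apply_symm_apply _)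
  proj_surjective T m := by
    refine ⟨T, 𝟙 T, (stdThetaMulEquiv X D.card T).symm ⟨1, m⟩, ?_, ?_, ?_⟩
    · rw [Over.id_left]; infer_instance
    · rw [Over.id_left]; infer_instance
    · rw [comp_stdThetaProj, MulEquiv.apply_symm_apply, Category.id_comp]
  central T a x := by
    apply (stdThetaMulEquiv X D.card T).injective
    rw [map_mul, map_mul]
    refine StdTheta.ext ?_ ?_
    · simp [StdTheta.mul_fst, mul_comm]
    · simp [StdTheta.mul_snd]
  commutator T x y := by
    apply (stdThetaMulEquiv X D.card T).injective
    simp only [map_mul, map_inv, comp_stdThetaProj]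
    generalize stdThetaMulEquiv X D.card T x = p
    generalize stdThetaMulEquiv X D.card T y = q
    refine StdTheta.ext ?_ ?_
    · simp only [StdTheta.mul_fst, StdTheta.mul_snd, StdTheta.inv_fst, StdTheta.inv_snd,
        X.half_inv_right, X.half_mul_left, X.half_inv_left, X.half_self, X.half_swap _ p.2 q.2,
        MonoidHom.comp_apply]
      refine Eq.trans ?_ (congrArg StdTheta.fst
        ((stdThetaMulEquiv X D.card T).apply_symm_apply _)).symm
      refine Eq.trans ?_ (hX.half_mul_half hD p.2 q.2)
      generalize X.half D.card p.2 q.2 = c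
      simp only [_root_.one_mul, _root_.inv_inv, _root_.mul_one, mul_inv_cancel, inv_one]
      calc _ = p.1 * p.1⁻¹ * (q.1 * q.1⁻¹) * (c * c) := by ac_rfl
        _ = c * c := by simp
    · refine Eq.trans ?_ (congrArg StdTheta.snd
        ((stdThetaMulEquiv X D.card T).apply_symm_apply _)).symm
      simp only [StdTheta.mul_snd, StdTheta.inv_snd]
      rw [mul_comm p.2 q.2]
      simp

/-- The inversion `(a, x) ↦ (a, x⁻¹)` of the standard theta group. -/
def stdInversion (hX : X.HasType D) (hD : Odd D.card) : (stdTheta hX hD).Inversion where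
  iso := isoOfInvolution (stdThetaNeg X D.card) (stdThetaNeg_comp_stdThetaNeg X D.card)
  isThetaIso :=
    { isMonHom := isMonHom_of_points _ fun T x y => by
        apply (stdThetaEquiv X D.card _).injective
        refine (stdThetaEquiv_stdThetaNeg _).trans ?_
        refine Eq.trans ?_ (stdThetaEquiv_mul _ _).symm
        refine Eq.trans ?_ (congrArg₂ (· * ·) (stdThetaEquiv_stdThetaNeg x)
          (stdThetaEquiv_stdThetaNeg y)).symm
        have h : stdThetaEquiv X D.card _ (x * y) = stdThetaEquiv X D.card _ x *
            stdThetaEquiv X D.card _ y := stdThetaEquiv_mul x y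
        rw [h]
        refine StdTheta.ext ?_ ?_
        · simp only [StdTheta.mul_fst, X.half_inv_left, X.half_inv_right, _root_.inv_inv]
        · simp only [StdTheta.mul_snd, _root_.mul_inv]
      incl_hom := fun T a => by
        apply (stdThetaEquiv X D.card _).injective
        refine (stdThetaEquiv_stdThetaNeg _).trans ?_
        have : stdThetaEquiv X D.card T ((stdTheta hX hD).incl T a) = ⟨a, 1⟩ :=
          Equiv.apply_symm_apply _ _
        rw [this, inv_one] }
  hom_proj := CartesianMonoidalCategory.lift_snd _ _

end Standard

/-! ### Descent of points -/

section Descent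

variable {S : Scheme.{u}}

lemma hom_eq_of_comp_eq {U T Z : Over S} (f : U ⟶ T) [Epi f.left] {x y : T ⟶ Z}
    (h : f ≫ x = f ≫ y) : x = y := by
  ext1
  rw [← cancel_epi f.left]
  exact congrArg CommaMorphism.left h

/-- Points of `S`-schemes descend along étale coverings, which are effective epimorphisms. -/
lemma exists_comp_eq {U T Z : Over S} (f : U ⟶ T) [EffectiveEpi f.left] (x : U ⟶ Z)
    (h : ∀ (W : Over S) (p q : W ⟶ U), p ≫ f = q ≫ f → p ≫ x = q ≫ x) :
    ∃ y : T ⟶ Z, f ≫ y = x := by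
  have h' : ∀ {W : Scheme.{u}} (p q : W ⟶ U.left), p ≫ f.left = q ≫ f.left →
      p ≫ x.left = q ≫ x.left := by
    intro W p q hpq
    have hq : q ≫ U.hom = p ≫ U.hom := by
      rw [← Over.w f, ← Category.assoc, ← hpq, Category.assoc]
    have := h (Over.mk (p ≫ U.hom)) (Over.homMk p) (Over.homMk q hq) (by ext1; exact hpq)
    exact congrArg CommaMorphism.left this
  have hd := EffectiveEpi.fac f.left x.left h'
  refine ⟨Over.homMk (EffectiveEpi.desc f.left x.left h') ?_, by ext1; exact hd⟩
  rw [← cancel_epi f.left, reassoc_of% hd, Over.w, Over.w]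

/-- A natural family of bijections on points comes from an isomorphism. -/
def isoOfPoints {C : Type*} [Category* C] {G H : C} (φ : ∀ T : C, (T ⟶ G) ≃ (T ⟶ H))
    (h : ∀ {T' T : C} (f : T' ⟶ T) (x : T ⟶ G), φ T' (f ≫ x) = f ≫ φ T x) : G ≅ H where
  hom := φ G (𝟙 G)
  inv := (φ H).symm (𝟙 H)
  hom_inv_id := by
    apply (φ G).injective
    rw [h, Equiv.apply_symm_apply, Category.comp_id]
  inv_hom_id := by
    rw [← h, Category.comp_id, Equiv.apply_symm_apply]

lemma comp_isoOfPoints_hom {C : Type*} [Category* C] {G H : C} (φ : ∀ T : C, (T ⟶ G) ≃ (T ⟶ H))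
    (h : ∀ {T' T : C} (f : T' ⟶ T) (x : T ⟶ G), φ T' (f ≫ x) = f ≫ φ T x) {T : C} (x : T ⟶ G) :
    x ≫ (isoOfPoints φ h).hom = φ T x := by
  rw [isoOfPoints, ← h, Category.comp_id]

end Descent

/-! ### The canonical lifting in a symmetrized theta group -/

/-- The power of a product of two elements whose commutator is central. -/
lemma mul_pow_of_mul_eq {G : Type*} [Group G] {x y z : G} (hz : ∀ w, z * w = w * z)
    (h : y * x = z * (x * y)) (k : ℕ) : (x * y) ^ k = z ^ (k * (k - 1) / 2) * (x ^ k * y ^ k) := by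
  have hzp : ∀ (i : ℕ) (w : G), z ^ i * w = w * z ^ i := fun i w =>
    ((show Commute z w from hz w).pow_left i)
  have hy : ∀ k : ℕ, y ^ k * x = z ^ k * (x * y ^ k) := by
    intro k
    induction k with
    | zero => simp
    | succ k ih =>
      rw [pow_succ', _root_.mul_assoc, ih, ← _root_.mul_assoc, ← hzp, _root_.mul_assoc,
        ← _root_.mul_assoc y x, h, pow_succ]
      simp only [_root_.mul_assoc]
  induction k with
  | zero => simp
  | succ k ih =>
    have e : (k + 1) * (k + 1 - 1) / 2 = k * (k - 1) / 2 + k := by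
      have := Nat.triangle_succ k
      simpa [mul_comm] using this
    rw [pow_succ, ih, e, pow_add, pow_succ x, pow_succ y]
    calc z ^ (k * (k - 1) / 2) * (x ^ k * y ^ k) * (x * y)
        = z ^ (k * (k - 1) / 2) * (x ^ k * (y ^ k * x) * y) := by simp only [_root_.mul_assoc]
      _ = z ^ (k * (k - 1) / 2) * (x ^ k * z ^ k * (x * y ^ k) * y) := by
        rw [hy]; simp only [_root_.mul_assoc]
      _ = _ := by rw [← hzp]; simp only [_root_.mul_assoc]

namespace SymmetrizedThetaGroup

variable {S : Scheme.{u}} {X : SymplecticModule S} {D : ModuleType} (A : SymmetrizedThetaGroup X)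

/-- The inversion as a group homomorphism on points. -/
def inv (T : Over S) : (T ⟶ A.theta.G) →* (T ⟶ A.theta.G) :=
  MonoidHom.mk' (fun x => x ≫ A.inversion.iso.hom) fun _ _ => by
    have := A.inversion.isThetaIso.isMonHom
    exact MonObj.mul_comp _ _ _

/-- The projection to `M` as a group homomorphism on points. -/
def pr (T : Over S) : (T ⟶ A.theta.G) →* (T ⟶ X.M) :=
  MonoidHom.mk' (fun x => x ≫ A.theta.proj) fun _ _ => MonObj.mul_comp _ _ _

lemma inv_apply {T : Over S} (x : T ⟶ A.theta.G) : A.inv T x = x ≫ A.inversion.iso.hom := rfl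

lemma pr_apply {T : Over S} (x : T ⟶ A.theta.G) : A.pr T x = x ≫ A.theta.proj := rfl

lemma inv_comp {T' T : Over S} (f : T' ⟶ T) (x : T ⟶ A.theta.G) :
    A.inv T' (f ≫ x) = f ≫ A.inv T x := by rw [inv_apply, Category.assoc, inv_apply]

lemma pr_comp {T' T : Over S} (f : T' ⟶ T) (x : T ⟶ A.theta.G) :
    A.pr T' (f ≫ x) = f ≫ A.pr T x := by rw [pr_apply, Category.assoc, pr_apply]

variable {T : Over S}

lemma inv_incl (a : GmPoints T) : A.inv T (A.theta.incl T a) = A.theta.incl T a :=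
  A.inversion.isThetaIso.incl_hom T a

lemma pr_incl (a : GmPoints T) : A.pr T (A.theta.incl T a) = 1 :=
  (A.theta.exact T _).mpr ⟨a, rfl⟩

lemma pr_inv (x : T ⟶ A.theta.G) : A.pr T (A.inv T x) = (A.pr T x)⁻¹ := by
  change (x ≫ A.inversion.iso.hom) ≫ A.theta.proj = (x ≫ A.theta.proj)⁻¹
  rw [Category.assoc, A.inversion.hom_proj, Hom.inv_def, Category.assoc]

lemma exists_eq_incl_mul {x y : T ⟶ A.theta.G} (h : A.pr T x = A.pr T y) :
    ∃ a, x = A.theta.incl T a * y := by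
  obtain ⟨a, ha⟩ := (A.theta.exact T (x * y⁻¹)).mp
    (show A.pr T (x * y⁻¹) = 1 by rw [map_mul, map_inv, h, mul_inv_cancel])
  exact ⟨a, by rw [ha, inv_mul_cancel_right]⟩

/-- A point `g` of a symmetrized theta group is antisymmetric, of level `n`, if `ι(g) = g⁻¹` and
`gⁿ = 1`. For `n` odd every point of `M` which is killed by `n` has exactly one such lift. -/
structure IsAntisymmetric (n : ℕ) (g : T ⟶ A.theta.G) : Prop where
  inv_eq : A.inv T g = g⁻¹
  pow_eq : g ^ n = 1

variable {A} {n : ℕ}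

lemma IsAntisymmetric.comp {g : T ⟶ A.theta.G} (hg : A.IsAntisymmetric n g) {T' : Over S}
    (f : T' ⟶ T) : A.IsAntisymmetric n (f ≫ g) :=
  ⟨by rw [A.inv_comp, hg.inv_eq, GrpObj.comp_inv], by
    rw [← MonObj.comp_pow, hg.pow_eq, MonObj.comp_one]⟩

lemma IsAntisymmetric.inv_pt {g : T ⟶ A.theta.G} (hg : A.IsAntisymmetric n g) :
    A.IsAntisymmetric n g⁻¹ :=
  ⟨by rw [map_inv, hg.inv_eq], by rw [inv_pow, hg.pow_eq, inv_one]⟩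

/-- Two antisymmetric lifts of the same point differ by a scalar `c` such that `c² = 1` and `cⁿ =
1`. -/
lemma IsAntisymmetric.unique (hn : Odd n) {g g' : T ⟶ A.theta.G} (hg : A.IsAntisymmetric n g)
    (hg' : A.IsAntisymmetric n g') (h : A.pr T g' = A.pr T g) : g' = g := by
  obtain ⟨c, rfl⟩ := A.exists_eq_incl_mul h
  have hc : c = 1 := by
    refine eq_one_of_sq_of_pow_odd hn c ?_ ?_
    · apply A.theta.incl_injective T
      have := hg'.inv_eq
      rw [map_mul, A.inv_incl, hg.inv_eq, _root_.mul_inv_rev, ← map_inv, ← A.theta.central,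
        mul_left_inj, map_inv, eq_inv_iff_mul_eq_one] at this
      rw [map_mul, this, map_one]
    · apply A.theta.incl_injective T
      have := hg'.pow_eq
      rwa [(show Commute (A.theta.incl T c) g from A.theta.central T c g).mul_pow, hg.pow_eq,
        _root_.mul_one, ← map_pow, ← map_one (A.theta.incl T)] at this
  rw [hc, map_one, _root_.one_mul]

/-- If `x` lifts a square root of a point of `M`, then `x ι(x)⁻¹` is an antisymmetric lift of this
point. The point `ι(x)` is a scalar multiple of `x⁻¹`, hence commutes with `x`, and `xⁿ` is a
scalar, hence is fixed by `ι`. -/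
lemma isAntisymmetric_mul_inv {x : T ⟶ A.theta.G} (hx : A.pr T x ^ n = 1) :
    A.IsAntisymmetric n (x * (A.inv T x)⁻¹) := by
  obtain ⟨b, hb⟩ := A.exists_eq_incl_mul (x := A.inv T x) (y := x⁻¹) (by rw [A.pr_inv, map_inv])
  obtain ⟨a, ha⟩ := A.exists_eq_incl_mul (x := x ^ n) (y := 1) (by rw [map_pow, hx, map_one])
  rw [_root_.mul_one] at ha
  have hbc := A.theta.central T b
  have hjj : A.inv T (A.inv T x) = x := by
    rw [hb, map_mul, A.inv_incl, map_inv, hb, _root_.mul_inv_rev, _root_.inv_inv,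
      ← _root_.mul_assoc, hbc, mul_inv_cancel_right]
  refine ⟨by rw [map_mul, map_inv, hjj, _root_.mul_inv_rev, _root_.inv_inv], ?_⟩
  have hcx : Commute x (A.inv T x)⁻¹ := by
    rw [hb]
    refine Commute.inv_right ?_
    exact ((show Commute (A.theta.incl T b) x from hbc x).symm).mul_right
      (Commute.inv_right (Commute.refl x))
  rw [hcx.mul_pow, inv_pow, ← map_pow, ha, A.inv_incl, mul_inv_cancel]

/-- The antisymmetric lifts multiply with the cocycle `e^{1/2}`. -/
lemma IsAntisymmetric.mul (hX : X.HasType D) (hD : Odd D.card) {g g' : T ⟶ A.theta.G}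
    (hg : A.IsAntisymmetric D.card g) (hg' : A.IsAntisymmetric D.card g') :
    A.IsAntisymmetric D.card
      (A.theta.incl T (X.half D.card (A.pr T g) (A.pr T g'))⁻¹ * (g * g')) := by
  set h := X.half D.card (A.pr T g) (A.pr T g') with hh
  have hc : ∀ a w, A.theta.incl T a * w = w * A.theta.incl T a := A.theta.central T
  have h2 : h * h = X.e T (A.pr T g) (A.pr T g') := hX.half_mul_half hD _ _
  have hcomm : g * g' = A.theta.incl T (h * h) * (g' * g) := by
    have := A.theta.commutator T g g'
    rw [mul_inv_eq_iff_eq_mul, mul_inv_eq_iff_eq_mul] at this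
    rw [this, h2, _root_.mul_assoc]
    rfl
  have hn : h ^ D.card = 1 := hX.half_pow_card _ _
  constructor
  · rw [map_mul, map_mul, A.inv_incl, hg.inv_eq, hg'.inv_eq, map_inv, inv_mul_eq_iff_eq_mul,
      hcomm, ← map_inv, ← _root_.mul_assoc (A.theta.incl T _), ← map_mul, inv_mul_cancel_left,
      _root_.mul_inv_rev (A.theta.incl T h), ← map_inv, ← hc,
      ← _root_.mul_assoc, ← map_mul, mul_inv_cancel, map_one, _root_.one_mul, _root_.mul_inv_rev]
  · have hcm : g' * g = A.theta.incl T (h * h)⁻¹ * (g * g') := by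
      rw [hcomm, ← _root_.mul_assoc, ← map_mul, inv_mul_cancel, map_one, _root_.one_mul]
    rw [(show Commute _ (g * g') from hc h⁻¹ (g * g')).mul_pow,
      mul_pow_of_mul_eq (hc (h * h)⁻¹) hcm, hg.pow_eq, hg'.pow_eq, ← map_pow, ← map_pow,
      _root_.mul_one, _root_.mul_one, ← map_mul, inv_pow, hn]
    obtain ⟨k, hk⟩ := hD
    have e : D.card * (D.card - 1) / 2 = D.card * k := by
      rw [hk, Nat.add_sub_cancel, mul_left_comm, Nat.mul_div_cancel_left _ two_pos]
    rw [e, pow_mul, inv_pow, mul_pow, hn]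
    simp

/-- Every point of `M` has an antisymmetric lift. -/
lemma exists_isAntisymmetric (A : SymmetrizedThetaGroup X) (hX : X.HasType D) (hD : Odd D.card)
    (m : T ⟶ X.M) : ∃ g : T ⟶ A.theta.G, A.pr T g = m ∧ A.IsAntisymmetric D.card g := by
  obtain ⟨U, f, x, _, _, hx⟩ := A.theta.proj_surjective T (m ^ ((D.card + 1) / 2))
  have hx' : A.pr U x = f ≫ m ^ ((D.card + 1) / 2) := hx
  have hg : A.IsAntisymmetric D.card (x * (A.inv U x)⁻¹) :=
    isAntisymmetric_mul_inv (hX.pow_card _)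
  have hp : A.pr U (x * (A.inv U x)⁻¹) = f ≫ m := by
    rw [map_mul, map_inv, A.pr_inv, _root_.inv_inv, hx', MonObj.comp_pow, ← pow_add]
    obtain ⟨k, hk⟩ := hD
    rw [show (D.card + 1) / 2 + (D.card + 1) / 2 = D.card + 1 by omega, pow_succ, hX.pow_card,
      _root_.one_mul]
  obtain ⟨g, hfg⟩ := exists_comp_eq f (x * (A.inv U x)⁻¹) fun W p q hpq =>
    (hg.comp q).unique hD (hg.comp p) (by
      rw [A.pr_comp, A.pr_comp, hp, ← Category.assoc, hpq, Category.assoc])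
  refine ⟨g, hom_eq_of_comp_eq f ?_, hom_eq_of_comp_eq f ?_, hom_eq_of_comp_eq f ?_⟩
  · rw [← A.pr_comp, hfg, hp]
  · rw [← A.inv_comp, hfg, hg.inv_eq, ← hfg, GrpObj.comp_inv]
  · rw [MonObj.comp_pow, hfg, hg.pow_eq, MonObj.comp_one]

section Lift

variable (A) (hX : X.HasType D) (hD : Odd D.card)

/-- The antisymmetric lift of a point of `M`. -/
def lift (m : T ⟶ X.M) : T ⟶ A.theta.G := (A.exists_isAntisymmetric hX hD m).choose

lemma pr_lift (m : T ⟶ X.M) : A.pr T (A.lift hX hD m) = m :=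
  (A.exists_isAntisymmetric hX hD m).choose_spec.1

lemma isAntisymmetric_lift (m : T ⟶ X.M) : A.IsAntisymmetric D.card (A.lift hX hD m) :=
  (A.exists_isAntisymmetric hX hD m).choose_spec.2

lemma comp_lift {T' : Over S} (f : T' ⟶ T) (m : T ⟶ X.M) :
    f ≫ A.lift hX hD m = A.lift hX hD (f ≫ m) :=
  (A.isAntisymmetric_lift hX hD _).unique hD ((A.isAntisymmetric_lift hX hD _).comp f)
    (by rw [A.pr_comp, A.pr_lift, A.pr_lift])

lemma lift_inv (m : T ⟶ X.M) : A.lift hX hD m⁻¹ = (A.lift hX hD m)⁻¹ :=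
  (A.isAntisymmetric_lift hX hD _).inv_pt.unique hD (A.isAntisymmetric_lift hX hD _)
    (by rw [map_inv, A.pr_lift, A.pr_lift])

lemma lift_mul_lift (m m' : T ⟶ X.M) : A.lift hX hD m * A.lift hX hD m' =
    A.theta.incl T (X.half D.card m m') * A.lift hX hD (m * m') := by
  have h := (A.isAntisymmetric_lift hX hD m).mul hX hD (A.isAntisymmetric_lift hX hD m')
  have := h.unique hD (A.isAntisymmetric_lift hX hD (m * m'))
    (by simp only [map_mul, A.pr_lift, A.pr_incl, _root_.one_mul])
  rw [this, ← _root_.mul_assoc, ← map_mul, A.pr_lift, A.pr_lift, mul_inv_cancel, map_one,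
    _root_.one_mul]

/-- A symmetrized theta group is the standard one: its points are the products of a scalar and
an antisymmetric lift. -/
def pointsEquiv (T : Over S) : StdTheta X D.card T ≃* (T ⟶ A.theta.G) :=
  MulEquiv.ofBijective
    (MonoidHom.mk' (fun p : StdTheta X D.card T => A.theta.incl T p.1 * A.lift hX hD p.2)
      fun p q => by
        rw [StdTheta.mul_fst, StdTheta.mul_snd, map_mul, _root_.mul_assoc, ← A.lift_mul_lift,
          map_mul]
        simp only [_root_.mul_assoc]
        rw [← _root_.mul_assoc (A.lift hX hD p.2), ← A.theta.central]
        simp only [_root_.mul_assoc]) <| by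
    constructor
    · intro p q h
      have h : A.theta.incl T p.1 * A.lift hX hD p.2 = A.theta.incl T q.1 * A.lift hX hD q.2 := h
      have h2 : p.2 = q.2 := by
        have := congrArg (A.pr T) h
        simpa only [map_mul, A.pr_incl, A.pr_lift, _root_.one_mul] using this
      rw [h2, mul_left_inj] at h
      exact StdTheta.ext (A.theta.incl_injective T h) h2
    · intro x
      obtain ⟨a, ha⟩ := A.exists_eq_incl_mul (x := x) (y := A.lift hX hD (A.pr T x))
        (by rw [A.pr_lift])
      exact ⟨⟨a, A.pr T x⟩, ha.symm⟩

lemma pointsEquiv_apply (p : StdTheta X D.card T) :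
    A.pointsEquiv hX hD T p = A.theta.incl T p.1 * A.lift hX hD p.2 := rfl

lemma comp_pointsEquiv {T' : Over S} (f : T' ⟶ T) (p : StdTheta X D.card T) :
    f ≫ A.pointsEquiv hX hD T p = A.pointsEquiv hX hD T' (p.map f) := by
  rw [pointsEquiv_apply, pointsEquiv_apply, MonObj.comp_mul, ← A.theta.incl_natural,
    A.comp_lift]
  rfl

lemma pointsEquiv_symm_comp {T' : Over S} (f : T' ⟶ T) (x : T ⟶ A.theta.G) :
    (A.pointsEquiv hX hD T').symm (f ≫ x) = ((A.pointsEquiv hX hD T).symm x).map f := by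
  rw [MulEquiv.symm_apply_eq, ← comp_pointsEquiv, MulEquiv.apply_symm_apply]

lemma pointsEquiv_symm_incl (a : GmPoints T) :
    (A.pointsEquiv hX hD T).symm (A.theta.incl T a) = ⟨a, 1⟩ := by
  have h1 : A.lift hX hD (1 : T ⟶ X.M) = 1 :=
    (IsAntisymmetric.unique hD ⟨by rw [map_one, inv_one], one_pow _⟩
      (A.isAntisymmetric_lift hX hD _) (by rw [A.pr_lift, map_one]))
  rw [MulEquiv.symm_apply_eq, pointsEquiv_apply, h1, _root_.mul_one]

lemma pr_pointsEquiv (p : StdTheta X D.card T) : A.pr T (A.pointsEquiv hX hD T p) = p.2 := by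
  rw [pointsEquiv_apply, map_mul, A.pr_incl, A.pr_lift, _root_.one_mul]

lemma inv_pointsEquiv (p : StdTheta X D.card T) :
    A.inv T (A.pointsEquiv hX hD T p) = A.pointsEquiv hX hD T ⟨p.1, p.2⁻¹⟩ := by
  rw [pointsEquiv_apply, map_mul, A.inv_incl, (A.isAntisymmetric_lift hX hD _).inv_eq,
    pointsEquiv_apply, lift_inv]

end Lift

/-- Two symmetrized theta groups are isomorphic by a unique framed isomorphism. -/
theorem existsUnique_isFramedIso (hX : X.HasType D) (hD : Odd D.card)
    (A A' : SymmetrizedThetaGroup X) : ∃! α : A.theta.G ≅ A'.theta.G, IsFramedIso A A' α := by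
  let φ (T : Over S) := ((A.pointsEquiv hX hD T).symm.trans (A'.pointsEquiv hX hD T)).toEquiv
  have hφ : ∀ {T' T : Over S} (f : T' ⟶ T) (x : T ⟶ A.theta.G), φ T' (f ≫ x) = f ≫ φ T x := by
    intro T' T f x
    change A'.pointsEquiv hX hD T' ((A.pointsEquiv hX hD T').symm (f ≫ x)) =
      f ≫ A'.pointsEquiv hX hD T ((A.pointsEquiv hX hD T).symm x)
    rw [pointsEquiv_symm_comp, comp_pointsEquiv]
  have hα : ∀ {T : Over S} (x : T ⟶ A.theta.G), x ≫ (isoOfPoints φ hφ).hom =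
      A'.pointsEquiv hX hD T ((A.pointsEquiv hX hD T).symm x) :=
    fun x => comp_isoOfPoints_hom φ hφ x
  refine ⟨isoOfPoints φ hφ, ⟨⟨⟨?_, ?_⟩, ?_⟩, ?_⟩, ?_⟩
  · refine isMonHom_of_points _ fun T x y => ?_
    rw [hα, hα, hα, map_mul, map_mul]
  · intro T a
    rw [hα, A.pointsEquiv_symm_incl, ← A'.pointsEquiv_symm_incl hX hD, MulEquiv.apply_symm_apply]
  · rw [← Category.id_comp (isoOfPoints φ hφ).hom, hα, ← pr_apply, A'.pr_pointsEquiv hX hD,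
      ← A.pr_pointsEquiv hX hD, MulEquiv.apply_symm_apply, pr_apply, Category.id_comp]
  · rw [hα, ← Category.id_comp (isoOfPoints φ hφ).hom, hα]
    have h := A.inv_pointsEquiv hX hD ((A.pointsEquiv hX hD _).symm (𝟙 A.theta.G))
    rw [MulEquiv.apply_symm_apply] at h
    have h' : A.inv A.theta.G (𝟙 A.theta.G) = A.inversion.iso.hom := by
      rw [inv_apply, Category.id_comp]
    rw [h'] at h
    rw [h, MulEquiv.symm_apply_apply]
    exact (A'.inv_pointsEquiv hX hD _).symm
  · intro β hβ
    have hm := hβ.isMonHom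
    have hl : ∀ {T : Over S} (m : T ⟶ X.M), A.lift hX hD m ≫ β.hom = A'.lift hX hD m := by
      intro T m
      have h := A.isAntisymmetric_lift hX hD m
      refine (A'.isAntisymmetric_lift hX hD m).unique hD ⟨?_, ?_⟩ ?_
      · rw [inv_apply, Category.assoc, ← hβ.comm_inversion, ← Category.assoc, ← inv_apply, h.inv_eq,
          GrpObj.inv_comp]
      · rw [← MonObj.pow_comp, h.pow_eq, MonObj.one_comp]
      · rw [pr_apply, Category.assoc, hβ.hom_proj, A'.pr_lift, ← pr_apply, A.pr_lift]
    ext1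
    rw [← Category.id_comp β.hom, ← Category.id_comp (isoOfPoints φ hφ).hom, hα]
    obtain ⟨p, hp⟩ := (A.pointsEquiv hX hD _).surjective (𝟙 A.theta.G)
    rw [← hp, MulEquiv.symm_apply_apply, pointsEquiv_apply, MonObj.mul_comp, hβ.incl_hom, hl]
    rfl

end SymmetrizedThetaGroup

/-! ### Frames and their Heisenberg matrices -/

/-- The type of frames of a symplectic module over `T`, for the group `K` of the type `D`. -/
structure Frame {S : Scheme.{u}} (X : SymplecticModule S) (D : ModuleType) (T : Over S) where
  /-- the first half of the frame -/
  x : D.K → (T ⟶ X.M)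
  /-- the second half of the frame -/
  y : D.K → (T ⟶ X.M)
  isFrame : IsFrame X D.eps x y

section Local

variable {S : Scheme.{u}} {T : Over S}

lemma matrix_eq_of_locally {I J : Type*} {A B : Matrix I J Γ(T.left, ⊤)}
    (h : ∀ t : T.left, ∃ U : T.left.Opens, t ∈ U ∧ A.map (res (inc T U)) = B.map (res (inc T U))) :
    A = B := by
  ext i j
  refine res_eq_of_locally _ _ fun t => ?_
  obtain ⟨U, ht, hU⟩ := h t
  exact ⟨U, ht, congrFun (congrFun hU i) j⟩

lemma subsingleton_of_isUnit_sub_one {R : Type*} [CommRing R] {a : R} (h : IsUnit (a - 1))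
    (ha : a = 1) : Subsingleton R := by
  rw [ha, sub_self, isUnit_zero_iff] at h
  exact subsingleton_of_zero_eq_one h

end Local

namespace Frame

variable {S : Scheme.{u}} {X : SymplecticModule S} {D : ModuleType} {T : Over S}

/-- The pullback of a frame. -/
@[simps] def pull (p : Frame X D T) {T' : Over S} (f : T' ⟶ T) : Frame X D T' where
  x a := f ≫ p.x a
  y a := f ≫ p.y a
  isFrame :=
    { x_add := fun a b => by rw [p.isFrame.x_add, MonObj.comp_mul]
      y_add := fun a b => by rw [p.isFrame.y_add, MonObj.comp_mul]
      x_x := fun a b => by rw [X.e_natural, p.isFrame.x_x, map_one]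
      y_y := fun a b => by rw [X.e_natural, p.isFrame.y_y, map_one]
      isUnit_left := fun b hb => by
        rw [X.e_natural, GmPoints.val_map, ← map_one (res f), ← map_sub]
        exact (p.isFrame.isUnit_left b hb).map _
      isUnit_right := fun b hb => by
        rw [X.e_natural, GmPoints.val_map, ← map_one (res f), ← map_sub]
        exact (p.isFrame.isUnit_right b hb).map _ }

lemma pull_pull (p : Frame X D T) {T' T'' : Over S} (f : T' ⟶ T) (g : T'' ⟶ T') :
    (p.pull f).pull g = p.pull (g ≫ f) := by
  simp [pull]

/-- The point `x α + y β` of the symplectic module. -/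
def pt (p : Frame X D T) (c : D.K × D.K) : T ⟶ X.M := p.x c.1 * p.y c.2

lemma comp_pt (p : Frame X D T) {T' : Over S} (f : T' ⟶ T) (c : D.K × D.K) :
    f ≫ p.pt c = (p.pull f).pt c := MonObj.comp_mul _ _ _

lemma x_zero (p : Frame X D T) : p.x 0 = 1 := by
  have := p.isFrame.x_add 0 0
  rwa [add_zero, left_eq_mul] at this

lemma y_zero (p : Frame X D T) : p.y 0 = 1 := by
  have := p.isFrame.y_add 0 0
  rwa [add_zero, left_eq_mul] at this

lemma pt_add (p : Frame X D T) (c d : D.K × D.K) : p.pt (c + d) = p.pt c * p.pt d := by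
  simp only [pt, Prod.fst_add, Prod.snd_add, p.isFrame.x_add, p.isFrame.y_add]
  exact mul_mul_mul_comm _ _ _ _

lemma pt_zero (p : Frame X D T) : p.pt 0 = 1 := by
  simp only [pt, Prod.fst_zero, Prod.snd_zero, p.x_zero, p.y_zero, _root_.mul_one]

lemma pt_neg (p : Frame X D T) (c : D.K × D.K) : p.pt (-c) = (p.pt c)⁻¹ := by
  rw [eq_inv_iff_mul_eq_one, ← pt_add, neg_add_cancel, pt_zero]

lemma e_pt_y (p : Frame X D T) (c : D.K × D.K) (b : D.K) :
    X.e T (p.pt c) (p.y b) = X.e T (p.x c.1) (p.y b) := by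
  rw [pt, X.e_mul_left, p.isFrame.y_y, _root_.mul_one]

lemma e_x_pt (p : Frame X D T) (a : D.K) (c : D.K × D.K) :
    X.e T (p.x a) (p.pt c) = X.e T (p.x a) (p.y c.2) := by
  rw [pt, X.e_mul_right, p.isFrame.x_x, _root_.one_mul]

lemma subsingleton_of_pt_eq_one (p : Frame X D T) {c : D.K × D.K} (hc : c ≠ 0)
    (h : p.pt c = 1) : Subsingleton Γ(T.left, ⊤) := by
  by_cases h1 : c.1 = 0
  · have h2 : c.2 ≠ 0 := fun h2 => hc (Prod.ext h1 h2)
    refine subsingleton_of_isUnit_sub_one (p.isFrame.isUnit_left _ h2) ?_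
    rw [← p.e_x_pt, h, X.e_one_right, Units.val_one]
  · refine subsingleton_of_isUnit_sub_one (p.isFrame.isUnit_right _ h1) ?_
    rw [← p.e_pt_y, h, X.e_one_left, Units.val_one]

/-- Locally every point of a symplectic module is of the form `x α + y β`. -/
lemma exists_eq_pt (hX : X.HasType D) (p : Frame X D T) (m : T ⟶ X.M) (t : T.left) :
    ∃ U : T.left.Opens, t ∈ U ∧ ∃ c, inc T U ≫ m = (p.pull (inc T U)).pt c := by
  obtain ⟨Q, q, z, rfl, hQ, -, -, hfin, hcard, -⟩ := exists_geometricPoint hX T t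
  have : Nontrivial Γ(Q.left, ⊤) := hQ.nontrivial
  have hinj : Function.Injective (p.pull q).pt := by
    intro c d hcd
    by_contra hne
    have : (p.pull q).pt (c + -d) = 1 := by rw [pt_add, pt_neg, hcd, mul_inv_cancel]
    have := (p.pull q).subsingleton_of_pt_eq_one
      (fun h => hne (add_neg_eq_zero.mp h)) this
    exact not_subsingleton Γ(Q.left, ⊤) this
  have hbij : Function.Bijective (p.pull q).pt := by
    refine hinj.bijective_of_nat_card_le ?_
    rwa [Nat.card_prod, Nat.card_eq_fintype_card (α := D.K), D.card_K]
  obtain ⟨c, hc⟩ := hbij.surjective (q ≫ m)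
  refine ⟨eqLocus m (p.pt c), ?_, c, ?_⟩
  · exact (comp_eq_comp_iff _ _ q).mp (by rw [comp_pt, hc]) z
  · rw [← comp_pt]
    exact (comp_eq_comp_iff _ _ _).mpr (inc_apply_mem _ _)

/-- An identity of matrices which depends on a point `m` of the symplectic module follows if it
holds over all `T`-schemes for the points `x α + y β`. -/
lemma matrix_eq_of_pt (hX : X.HasType D) (p : Frame X D T) {I J : Type*} (m : T ⟶ X.M)
    {A B : Matrix I J Γ(T.left, ⊤)}
    (h : ∀ (T' : Over S) (f : T' ⟶ T) (c : D.K × D.K), f ≫ m = (p.pull f).pt c →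
      A.map (res f) = B.map (res f)) : A = B := by
  refine matrix_eq_of_locally fun t => ?_
  obtain ⟨U, ht, c, hc⟩ := p.exists_eq_pt hX m t
  exact ⟨U, ht, h _ _ c hc⟩

lemma sum_eq_zero_of_isUnit {R : Type*} [CommRing R] {K : Type*} [AddGroup K] [Fintype K]
    (f : K → R) (hf : ∀ a b, f (a + b) = f a * f b) {a : K} (ha : IsUnit (f a - 1)) :
    ∑ b, f b = 0 := by
  have h : (f a - 1) * ∑ b, f b = 0 := by
    rw [sub_mul, _root_.one_mul, sub_eq_zero, Finset.mul_sum]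
    exact Fintype.sum_equiv (Equiv.addLeft a) _ _ fun b => (hf a b).symm
  exact (ha.mul_right_eq_zero).mp h

/-- The perfect pairing between the two halves of a frame. -/
def pairing (p : Frame X D T) : PerfectPairing D.K Γ(T.left, ⊤) where
  val a b := X.e T (p.x a) (p.y b)
  add_left a a' b := by rw [p.isFrame.x_add, X.e_mul_left]
  add_right a b b' := by rw [p.isFrame.y_add, X.e_mul_right]
  sum_right a ha := sum_eq_zero_of_isUnit (fun b => (X.e T (p.x a) (p.y b) : Γ(T.left, ⊤)))
    (fun b b' => by rw [p.isFrame.y_add, X.e_mul_right, Units.val_mul])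
    (p.isFrame.isUnit_right a ha)
  sum_left b hb := sum_eq_zero_of_isUnit (fun a => (X.e T (p.x a) (p.y b) : Γ(T.left, ⊤)))
    (fun a a' => by rw [p.isFrame.x_add, X.e_mul_left, Units.val_mul])
    (p.isFrame.isUnit_left b hb)

lemma pairing_val (p : Frame X D T) (a b : D.K) : p.pairing.val a b = X.e T (p.x a) (p.y b) := rfl

lemma half_nsmul (a : D.K) : half a = ((D.card + 1) / 2) • a := by
  rw [half, D.card_K]

lemma pairing_half (p : Frame X D T) (a b : D.K) :
    p.pairing.val (half a) b = X.half D.card (p.x a) (p.y b) := by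
  rw [half_nsmul, PerfectPairing.nsmul_left]
  rfl

/-- The locally constant function on `T` which indicates where `m` has first component `a`. -/
def coef (p : Frame X D T) (m : T ⟶ X.M) (a : D.K) : Γ(T.left, ⊤) :=
  Ring.inverse (D.card : Γ(T.left, ⊤)) *
    ∑ b, ((X.e T m (p.y b) * (X.e T (p.x a) (p.y b))⁻¹ : GmPoints T) : Γ(T.left, ⊤))

/-- The Heisenberg matrix of a point `m` of the symplectic module, with respect to a frame. It is
characterized by being natural in `T`, and equal to `PerfectPairing.heis α β` for
`m = x α + y β`. -/
def W (p : Frame X D T) (m : T ⟶ X.M) : Matrix D.K D.K Γ(T.left, ⊤) :=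
  Matrix.of fun t s => p.coef m (s - t) * (X.e T (p.x (half (t + s))) m : Γ(T.left, ⊤))

lemma coef_comp (hX : X.HasType D) (p : Frame X D T) {T' : Over S} (f : T' ⟶ T) (m : T ⟶ X.M)
    (a : D.K) : (p.pull f).coef (f ≫ m) a = res f (p.coef m a) := by
  have hinv : res f (Ring.inverse (D.card : Γ(T.left, ⊤))) =
      Ring.inverse (D.card : Γ(T'.left, ⊤)) := by
    have h1 := congrArg (res f) (Ring.inverse_mul_cancel _ (hX.isUnit_card T))
    have h2 := Ring.mul_inverse_cancel _ (hX.isUnit_card T')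
    rw [map_mul, map_one, map_natCast] at h1
    exact left_inv_eq_right_inv h1 h2
  rw [coef, coef, RingHom.map_mul, hinv, map_sum]
  simp only [pull_x, pull_y, X.e_natural, ← map_inv, ← map_mul]
  rfl

lemma W_comp (hX : X.HasType D) (p : Frame X D T) {T' : Over S} (f : T' ⟶ T) (m : T ⟶ X.M) :
    (p.pull f).W (f ≫ m) = (p.W m).map (res f) := by
  ext t s
  simp only [W, Matrix.of_apply, Matrix.map_apply, coef_comp hX, map_mul, pull_x, X.e_natural]
  rfl

/-- For `m = x α + y β` the function `coef m a` is the sum of the character `b ↦ e(x (α - a), y b)`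
divided by the order of the group. -/
lemma coef_pt (hX : X.HasType D) (p : Frame X D T) (c : D.K × D.K) (a : D.K) :
    p.coef (p.pt c) a = if a = c.1 then 1 else 0 := by
  have h : ∀ b, X.e T (p.pt c) (p.y b) * (X.e T (p.x a) (p.y b))⁻¹ =
      p.pairing.val (c.1 - a) b := by
    intro b
    rw [e_pt_y, sub_eq_add_neg, PerfectPairing.add_left, PerfectPairing.neg_left, pairing_val,
      pairing_val]
  simp only [coef, h, PerfectPairing.sum_right_eq, sub_eq_zero, eq_comm (a := c.1)]
  split_ifs
  · rw [D.card_K, Ring.inverse_mul_cancel _ (hX.isUnit_card T)]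
  · rw [mul_zero]

lemma W_pt (hX : X.HasType D) (p : Frame X D T) (c : D.K × D.K) :
    p.W (p.pt c) = p.pairing.heis c.1 c.2 := by
  ext t s
  simp only [W, PerfectPairing.heis, Matrix.of_apply, coef_pt hX, ite_mul, _root_.one_mul, zero_mul,
    e_x_pt, pairing_val, sub_eq_iff_eq_add, add_comm c.1]

lemma W_one (hX : X.HasType D) (p : Frame X D T) : p.W 1 = 1 := by
  rw [← p.pt_zero, W_pt hX]
  exact PerfectPairing.heis_zero _

lemma half_pt (p : Frame X D T) (c d : D.K × D.K) : X.half D.card (p.pt c) (p.pt d) =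
    p.pairing.val (half c.1) d.2 * (p.pairing.val (half d.1) c.2)⁻¹ := by
  rw [pairing_half, pairing_half]
  simp only [pt, X.half_mul_left, X.half_mul_right]
  have h1 : X.half D.card (p.x c.1) (p.x d.1) = 1 := by
    rw [SymplecticModule.half, p.isFrame.x_x, one_pow]
  have h2 : X.half D.card (p.y c.2) (p.y d.2) = 1 := by
    rw [SymplecticModule.half, p.isFrame.y_y, one_pow]
  rw [h1, h2, X.half_swap _ (p.x d.1) (p.y c.2)]
  simp

lemma map_smul_matrix {R R' : Type*} [CommRing R] [CommRing R'] {I J : Type*} (f : R →+* R')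
    (a : R) (A : Matrix I J R) : (a • A).map f = f a • A.map f := by
  ext; simp

lemma W_mul (hX : X.HasType D) (hD : Odd D.card) (p : Frame X D T) (m m' : T ⟶ X.M) :
    p.W m * p.W m' = (X.half D.card m m' : Γ(T.left, ⊤)) • p.W (m * m') := by
  refine p.matrix_eq_of_pt hX m fun T₁ f₁ c hc => ?_
  rw [Matrix.map_mul, map_smul_matrix, ← W_comp hX, ← W_comp hX, ← W_comp hX,
    ← GmPoints.val_map, ← X.half_natural, MonObj.comp_mul, hc]
  generalize p.pull f₁ = p₁
  generalize f₁ ≫ m' = m₁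
  refine p₁.matrix_eq_of_pt hX m₁ fun T₂ f₂ d hd => ?_
  rw [Matrix.map_mul, map_smul_matrix, ← W_comp hX, ← W_comp hX, ← W_comp hX,
    ← GmPoints.val_map, ← X.half_natural, MonObj.comp_mul, hd, comp_pt, ← pt_add, W_pt hX, W_pt hX,
    W_pt hX, PerfectPairing.heis_mul _ (by rwa [D.card_K]), half_pt]
  rfl

lemma W_mul_W_inv (hX : X.HasType D) (hD : Odd D.card) (p : Frame X D T) (m : T ⟶ X.M) :
    p.W m * p.W m⁻¹ = 1 := by
  rw [W_mul hX hD, mul_inv_cancel, W_one hX, X.half_inv_right, X.half_self]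
  simp

lemma W_inv_mul_W (hX : X.HasType D) (hD : Odd D.card) (p : Frame X D T) (m : T ⟶ X.M) :
    p.W m⁻¹ * p.W m = 1 := by
  rw [W_mul hX hD, inv_mul_cancel, W_one hX, X.half_inv_left, X.half_self]
  simp

lemma parity_W_parity (hX : X.HasType D) (p : Frame X D T) (m : T ⟶ X.M) :
    parity D.K Γ(T.left, ⊤) * p.W m * parity D.K Γ(T.left, ⊤) = p.W m⁻¹ := by
  refine p.matrix_eq_of_pt hX m fun T₁ f₁ c hc => ?_
  rw [Matrix.map_mul, Matrix.map_mul, parity_map, ← W_comp hX, ← W_comp hX, GrpObj.comp_inv, hc,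
    ← pt_neg, W_pt hX, W_pt hX, parity_heis_parity]
  rfl

/-- The points `q.pt c` of one frame are locally points of the other frame, and a nonzero point does
not become zero over a nonempty scheme. -/
lemma trace_W_pt (hX : X.HasType D) (hD : Odd D.card) (p q : Frame X D T) {c : D.K × D.K}
    (hc : c ≠ 0) : (p.W (q.pt c)).trace = 0 := by
  refine res_eq_of_locally _ _ fun t => ?_
  obtain ⟨U, ht, d, hd⟩ := p.exists_eq_pt hX (q.pt c) t
  refine ⟨U, ht, ?_⟩
  have h : res (inc T U) (p.W (q.pt c)).trace = ((p.W (q.pt c)).map (res (inc T U))).trace :=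
    AddMonoidHom.map_trace (res (inc T U)).toAddMonoidHom _
  rw [h, ← W_comp hX, hd, W_pt hX, PerfectPairing.trace_heis _ (by rwa [D.card_K]), map_zero]
  by_cases hd0 : d = 0
  · rw [hd0, pt_zero, comp_pt] at hd
    have := (q.pull (inc T U)).subsingleton_of_pt_eq_one hc hd
    exact Subsingleton.elim _ _
  · rw [if_neg fun h => hd0 (Prod.ext h.1 h.2)]

end Frame

/-! ### The normalized intertwiner of two frames -/

namespace Frame

variable {S : Scheme.{u}} {X : SymplecticModule S} {D : ModuleType} {T : Over S}

/-- A normalized matrix which intertwines the Heisenberg matrices of two frames. -/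
structure IsIntertwiner (p q : Frame X D T) (g : Matrix D.K D.K Γ(T.left, ⊤)) : Prop where
  mul_eq : ∀ m : T ⟶ X.M, p.W m * g = g * q.W m
  isNormalized : IsNormalized g

lemma mul_eq_of_pt (hX : X.HasType D) (r p q : Frame X D T) {g : Matrix D.K D.K Γ(T.left, ⊤)}
    (h : ∀ c, p.W (r.pt c) * g = g * q.W (r.pt c)) (m : T ⟶ X.M) : p.W m * g = g * q.W m := by
  refine r.matrix_eq_of_pt hX m fun T₁ f₁ c hc => ?_
  have := congrArg (fun A => Matrix.map A (res f₁)) (h c)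
  simp only [Matrix.map_mul, ← W_comp hX, comp_pt] at this
  rw [Matrix.map_mul, Matrix.map_mul, ← W_comp hX, ← W_comp hX, hc, this]

lemma IsIntertwiner.pull (hX : X.HasType D) {p q : Frame X D T}
    {g : Matrix D.K D.K Γ(T.left, ⊤)} (hg : IsIntertwiner p q g) {T' : Over S} (f : T' ⟶ T) :
    IsIntertwiner (p.pull f) (q.pull f) (g.map (res f)) where
  mul_eq := mul_eq_of_pt hX (p.pull f) _ _ fun c => by
    rw [← comp_pt, W_comp hX, W_comp hX, ← Matrix.map_mul, ← Matrix.map_mul, hg.mul_eq]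
  isNormalized := hg.isNormalized.map _

/-- Two invertible intertwiners are proportional, by Schur's lemma. -/
lemma exists_eq_smul (hX : X.HasType D) (hD : Odd D.card) {p q : Frame X D T}
    {g g' h : Matrix D.K D.K Γ(T.left, ⊤)} (hg : ∀ m : T ⟶ X.M, p.W m * g = g * q.W m)
    (hg' : ∀ m : T ⟶ X.M, p.W m * g' = g' * q.W m) (h1 : g * h = 1) (h2 : h * g = 1) :
    ∃ a : Γ(T.left, ⊤), g' = a • g := by
  have hh : ∀ m : T ⟶ X.M, q.W m * h = h * p.W m := by
    intro m
    calc q.W m * h = h * g * q.W m * h := by rw [h2, _root_.one_mul]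
      _ = h * (p.W m * g) * h := by rw [hg]; simp only [_root_.mul_assoc]
      _ = h * p.W m := by rw [_root_.mul_assoc, _root_.mul_assoc, h1, _root_.mul_one]
  obtain ⟨a, ha⟩ := p.pairing.eq_smul_one_of_commute (by rwa [D.card_K])
    (by rw [D.card_K]; exact hX.isUnit_card T) (g' * h) (fun α β => by
      rw [← W_pt hX p (α, β), ← _root_.mul_assoc, hg', _root_.mul_assoc, hh, _root_.mul_assoc])
  refine ⟨a, ?_⟩
  rw [← _root_.mul_one g', ← h2, ← _root_.mul_assoc, ha, Matrix.smul_mul, _root_.one_mul]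

lemma IsIntertwiner.unique (hX : X.HasType D) (hD : Odd D.card) {p q : Frame X D T}
    {g g' : Matrix D.K D.K Γ(T.left, ⊤)} (hg : IsIntertwiner p q g) (hg' : IsIntertwiner p q g') :
    g' = g := by
  obtain ⟨a, rfl⟩ := exists_eq_smul hX hD hg.mul_eq hg'.mul_eq
    (Matrix.mul_nonsing_inv g hg.isNormalized.isUnit_det)
    (Matrix.nonsing_inv_mul g hg.isNormalized.isUnit_det)
  rw [hg.isNormalized.eq_one_of_smul (by rwa [D.card_K]) hg'.isNormalized, one_smul]

/-- An invertible intertwiner commutes with the parity operator: it conjugates this operator to a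
multiple of it by Schur's lemma, and the trace of the parity operator is one. -/
lemma parity_comm_of_mul_eq (hX : X.HasType D) (hD : Odd D.card) {p q : Frame X D T}
    {g h : Matrix D.K D.K Γ(T.left, ⊤)} (hg : ∀ m : T ⟶ X.M, p.W m * g = g * q.W m)
    (h1 : g * h = 1) (h2 : h * g = 1) :
    parity D.K Γ(T.left, ⊤) * g = g * parity D.K Γ(T.left, ⊤) := by
  set I := parity D.K Γ(T.left, ⊤) with hI
  have hII : I * I = 1 := parity_mul_parity
  have hcomm : ∀ (r : Frame X D T) (m : T ⟶ X.M), I * r.W m = r.W m⁻¹ * I := by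
    intro r m
    rw [← parity_W_parity hX, _root_.mul_assoc, hII, _root_.mul_one]
  have hcomm' : ∀ (r : Frame X D T) (m : T ⟶ X.M), r.W m * I = I * r.W m⁻¹ := by
    intro r m
    rw [hcomm, _root_.inv_inv]
  obtain ⟨a, ha⟩ := exists_eq_smul hX hD (g' := I * g * I) hg (fun m => by
    calc p.W m * (I * g * I) = I * (p.W m⁻¹ * g) * I := by
          rw [← _root_.mul_assoc, ← _root_.mul_assoc, hcomm']; simp only [_root_.mul_assoc]
      _ = I * g * (q.W m⁻¹ * I) := by rw [hg]; simp only [_root_.mul_assoc]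
      _ = I * g * I * q.W m := by rw [← hcomm]; simp only [_root_.mul_assoc]) h1 h2
  have hIg : I * g = a • (g * I) := by
    rw [← _root_.mul_one (I * g), ← hII, ← _root_.mul_assoc, ha, Matrix.smul_mul]
  have hgIh : h * I * g = a • I := by
    rw [_root_.mul_assoc, hIg, Matrix.mul_smul, ← _root_.mul_assoc, h2, _root_.one_mul]
  have ha1 : a = 1 := by
    have := congrArg Matrix.trace hgIh
    rw [Matrix.trace_mul_comm, ← _root_.mul_assoc, h1, _root_.one_mul, Matrix.trace_smul,
      trace_parity (by rwa [D.card_K]), smul_eq_mul, _root_.mul_one] at this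
    exact this.symm
  rw [hIg, ha1, one_smul]

lemma exists_mem_basicOpen_of_isUnit_sum {J : Type*} [Fintype J] (a : J → Γ(T.left, ⊤))
    (h : IsUnit (∑ j, a j)) (t : T.left) : ∃ j, t ∈ T.left.basicOpen (a j) := by
  have h1 := h.map (T.left.presheaf.germ ⊤ t trivial).hom
  rw [map_sum] at h1
  by_contra! hne
  refine (IsLocalRing.mem_maximalIdeal _).mp (Ideal.sum_mem _ fun j _ => ?_) h1
  exact fun hj => hne j ((T.left.mem_basicOpen (a j) t trivial).mpr hj)

/-- Averages of elementary matrices are intertwiners. The product of two averages in opposite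
directions is a scalar, and for a suitable pair this scalar is invertible near `t`. After this the
determinants are normalized. -/
lemma exists_isIntertwiner_locally (hX : X.HasType D) (hD : Odd D.card) (p q : Frame X D T)
    (t : T.left) : ∃ U : T.left.Opens, t ∈ U ∧
      ∃ g, IsIntertwiner (p.pull (inc T U)) (q.pull (inc T U)) g := by
  have hcard : IsUnit (Fintype.card D.K : Γ(T.left, ⊤)) := by
    rw [D.card_K]; exact hX.isUnit_card T
  have hK : Odd (Fintype.card D.K) := by rwa [D.card_K]
  let Wp (c : D.K × D.K) := p.W (p.pt c)
  let Wq (c : D.K × D.K) := q.W (p.pt c)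
  let φ (c d : D.K × D.K) : Γ(T.left, ⊤) := (X.half D.card (p.pt c) (p.pt d) : Γ(T.left, ⊤))
  have hφ : ∀ c d, φ c d * φ (-d) (-c) = 1 := by
    intro c d
    simp only [φ, pt_neg, X.half_inv_left, X.half_inv_right, _root_.inv_inv]
    rw [← Units.val_mul, X.half_swap _ (p.pt c), mul_inv_cancel, Units.val_one]
  have hmul : ∀ (r : Frame X D T) c d,
      r.W (p.pt c) * r.W (p.pt d) = φ c d • r.W (p.pt (c + d)) := by
    intro r c d
    rw [W_mul hX hD, pt_add]
  have hinv : ∀ (r : Frame X D T) c, r.W (p.pt c) * r.W (p.pt (-c)) = 1 := by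
    intro r c
    rw [pt_neg, W_mul_W_inv hX hD]
  have hinv' : ∀ (r : Frame X D T) c, r.W (p.pt (-c)) * r.W (p.pt c) = 1 := by
    intro r c
    rw [pt_neg, W_inv_mul_W hX hD]
  have hzero : ∀ r : Frame X D T, r.W (p.pt 0) = 1 := by
    intro r
    rw [pt_zero, W_one hX]
  have hΦ : ∀ A m, p.W m * average Wp Wq A = average Wp Wq A * q.W m := fun A =>
    mul_eq_of_pt hX p p q (mul_average hφ (hmul p) (hmul q) (hinv q) A)
  have hΨ : ∀ A m, q.W m * average Wq Wp A = average Wq Wp A * p.W m := fun A =>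
    mul_eq_of_pt hX p q p (mul_average hφ (hmul q) (hmul p) (hinv p) A)
  -- the product of an average with an average in the other direction is a scalar
  have hscalar : ∀ A B, average Wp Wq A * average Wq Wp B =
      ((Fintype.card D.K : Γ(T.left, ⊤)) * (A * average Wq Wp B).trace) • 1 := by
    intro A B
    obtain ⟨a, ha⟩ := p.pairing.eq_smul_one_of_commute hK hcard
      (average Wp Wq A * average Wq Wp B) (fun α β => by
        rw [← W_pt hX p (α, β), ← _root_.mul_assoc, hΦ, _root_.mul_assoc, hΨ, _root_.mul_assoc])
    have htr := trace_average_mul (W := Wp) (W' := Wq) (hinv' p) (fun c => hΨ B (p.pt c)) A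
    rw [ha, Matrix.trace_smul, Matrix.trace_one, Fintype.card_prod, smul_eq_mul, Nat.cast_mul,
      mul_comm, _root_.mul_assoc] at htr
    rw [ha, hcard.mul_left_cancel htr]
  obtain ⟨a, ht⟩ := exists_mem_basicOpen_of_isUnit_sum
    (fun a => average Wq Wp (Matrix.single a 0 1) a 0) (by
      rw [sum_average_single (hzero p) (fun c hc => trace_W_pt hX hD q p hc) (hzero q)]
      exact hcard) t
  set w := average Wq Wp (Matrix.single a 0 1) a 0 with hw
  set U := T.left.basicOpen w
  set j := inc T U
  have hwU : IsUnit (res j w) := (isUnit_res_iff j w).mpr (inc_apply_mem T U)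
  have htr : (Matrix.single 0 a 1 * average Wq Wp (Matrix.single a 0 1)).trace = w := by
    rw [Matrix.trace_single_mul, smul_eq_mul, _root_.one_mul]
  set g := (average Wp Wq (Matrix.single 0 a 1)).map (res j) with hg
  set h := (average Wq Wp (Matrix.single a 0 1)).map (res j) with hh
  have hgh : g * h = ((Fintype.card D.K : Γ((opn T U).left, ⊤)) * res j w) • 1 := by
    rw [hg, hh, ← Matrix.map_mul, hscalar, htr, map_smul_matrix, map_mul, map_natCast]
    congr 1
    exact Matrix.map_one _ (map_zero _) (map_one _)
  have hunit : IsUnit ((Fintype.card D.K : Γ((opn T U).left, ⊤)) * res j w) := by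
    refine IsUnit.mul ?_ hwU
    have := hcard.map (res j)
    rwa [map_natCast] at this
  obtain ⟨v, hv⟩ := hunit.exists_left_inv
  have h1 : g * (v • h) = 1 := by
    rw [Matrix.mul_smul, hgh, smul_smul, hv, one_smul]
  have h2 : v • h * g = 1 := mul_eq_one_comm.mp h1
  have hgm : ∀ m, (p.pull j).W m * g = g * (q.pull j).W m :=
    mul_eq_of_pt hX (p.pull j) _ _ fun c => by
      rw [← comp_pt, W_comp hX, W_comp hX, hg, ← Matrix.map_mul, ← Matrix.map_mul, hΦ]
  obtain ⟨b, hb⟩ := IsNormalized.exists_smul hK (parity_comm_of_mul_eq hX hD hgm h1 h2) h1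
  exact ⟨U, ht, b • g, fun m => by rw [Matrix.mul_smul, hgm, Matrix.smul_mul], hb⟩

/-- Two frames have a unique normalized intertwiner: it exists locally, and by uniqueness the local
ones glue. -/
lemma exists_isIntertwiner (hX : X.HasType D) (hD : Odd D.card) (p q : Frame X D T) :
    ∃ g, IsIntertwiner p q g := by
  choose U hU g hg using exists_isIntertwiner_locally hX hD p q
  have hglue : ∀ a b, ∃ z : Γ(T.left, ⊤), ∀ t, res (inc T (U t)) z = g t a b := by
    intro a b
    refine exists_res_eq U (fun t => ⟨t, hU t⟩) (fun t => g t a b) fun s t V f f' hff' => ?_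
    have h1 := (hg s).pull hX f
    have h2 := (hg t).pull hX f'
    rw [pull_pull, pull_pull] at h1 h2
    rw [← hff'] at h2
    exact congrFun (congrFun (h2.unique hX hD h1) a) b
  choose z hz using hglue
  have hmap : ∀ t, (Matrix.of z).map (res (inc T (U t))) = g t := by
    intro t
    ext a b
    exact hz a b t
  refine ⟨Matrix.of z, fun m => ?_, ?_, ?_, ?_⟩
  · refine matrix_eq_of_locally fun t => ⟨U t, hU t, ?_⟩
    rw [Matrix.map_mul, Matrix.map_mul, ← W_comp hX, ← W_comp hX, hmap, (hg t).mul_eq]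
  · refine isUnit_of_forall _ fun t => ?_
    obtain ⟨w, hw⟩ := exists_inc_apply T (U t) t (hU t)
    refine ⟨_, inc T (U t), w, hw, ?_⟩
    rw [RingHom.map_det]
    have := (hg t).isNormalized.isUnit_det
    rwa [← hmap] at this
  · refine matrix_eq_of_locally fun t => ⟨U t, hU t, ?_⟩
    rw [Matrix.map_mul, Matrix.map_mul, parity_map, hmap, (hg t).isNormalized.parity_comm]
  · refine res_eq_of_locally _ _ fun t => ⟨U t, hU t, ?_⟩
    have := (hg t).isNormalized.det_eq
    rw [← hmap, oddPart_map] at this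
    rw [map_pow, RingHom.map_det, RingHom.map_det]
    exact this

variable (hX : X.HasType D) (hD : Odd D.card)

/-- The normalized intertwiner of two frames, the transition matrix from `q` to `p`. -/
def trans (p q : Frame X D T) : Matrix D.K D.K Γ(T.left, ⊤) :=
  (exists_isIntertwiner hX hD p q).choose

lemma isIntertwiner_trans (p q : Frame X D T) : IsIntertwiner p q (trans hX hD p q) :=
  (exists_isIntertwiner hX hD p q).choose_spec

lemma trans_pull (p q : Frame X D T) {T' : Over S} (f : T' ⟶ T) :
    trans hX hD (p.pull f) (q.pull f) = (trans hX hD p q).map (res f) :=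
  ((isIntertwiner_trans hX hD p q).pull hX f).unique hX hD (isIntertwiner_trans hX hD _ _)

lemma trans_self (p : Frame X D T) : trans hX hD p p = 1 :=
  IsIntertwiner.unique hX hD ⟨fun m => by rw [_root_.mul_one, _root_.one_mul], .one⟩
    (isIntertwiner_trans hX hD p p)

lemma trans_mul_trans (p q r : Frame X D T) :
    trans hX hD p q * trans hX hD q r = trans hX hD p r := by
  refine IsIntertwiner.unique hX hD (isIntertwiner_trans hX hD p r) ⟨fun m => ?_, ?_⟩
  · rw [← _root_.mul_assoc, (isIntertwiner_trans hX hD p q).mul_eq, _root_.mul_assoc,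
      (isIntertwiner_trans hX hD q r).mul_eq, _root_.mul_assoc]
  · exact (isIntertwiner_trans hX hD p q).isNormalized.mul (by rwa [D.card_K])
      (isIntertwiner_trans hX hD q r).isNormalized

lemma W_mul_trans (p q : Frame X D T) (m : T ⟶ X.M) :
    p.W m * trans hX hD p q = trans hX hD p q * q.W m :=
  (isIntertwiner_trans hX hD p q).mul_eq m

end Frame

/-! ### A finite étale covering over which a frame exists -/

section Cover

variable {S : Scheme.{u}}

/-- The `n`-fold product of a finite étale scheme with itself; only the existence of the point with
given coordinates is recorded. -/
lemma exists_finite_etale_power (M : Over S) [IsFinite M.hom] [Etale M.hom] (n : ℕ) :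
    ∃ P : Over S, IsFinite P.hom ∧ Etale P.hom ∧ ∃ c : Fin n → (P ⟶ M),
      ∀ (T : Over S) (v : Fin n → (T ⟶ M)), ∃ f : T ⟶ P, ∀ i, f ≫ c i = v i := by
  induction n with
  | zero =>
    exact ⟨Over.mk (𝟙 S), inferInstanceAs (IsFinite (𝟙 S)), inferInstanceAs (Etale (𝟙 S)),
      Fin.elim0, fun T _ => ⟨Over.homMk T.hom, fun i => i.elim0⟩⟩
  | succ n ih =>
    obtain ⟨P, _, _, c, hc⟩ := ih
    refine ⟨P ⊗ M, ?_, ?_, Fin.cons (SemiCartesianMonoidalCategory.snd P M) fun i =>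
      SemiCartesianMonoidalCategory.fst P M ≫ c i, fun T v => ?_⟩
    · rw [Over.tensorObj_hom]; infer_instance
    · rw [Over.tensorObj_hom]; infer_instance
    · obtain ⟨f, hf⟩ := hc T (Fin.tail v)
      refine ⟨CartesianMonoidalCategory.lift f (v 0), Fin.cases (by simp) fun i => ?_⟩
      simpa using! hf i

/-- A condition on the points of `P` is clopen if it holds exactly for the points with values in
some open and closed subscheme. -/
def IsClopenCondition {P : Over S} (C : ∀ T : Over S, (T ⟶ P) → Prop) : Prop :=
  ∃ L : P.left.Opens, IsClosed (L : Set P.left) ∧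
    ∀ (T : Over S) (f : T ⟶ P), C T f ↔ ∀ w, f.left w ∈ L

variable {P : Over S}

lemma IsClopenCondition.forall {I : Sort*} [Finite I] {C : I → ∀ T : Over S, (T ⟶ P) → Prop}
    (h : ∀ i, IsClopenCondition (C i)) : IsClopenCondition fun T f => ∀ i, C i T f := by
  choose L hL hC using h
  refine ⟨⟨⋂ i, L i, isOpen_iInter_of_finite fun i => (L i).2⟩, isClosed_iInter hL,
    fun T f => ?_⟩
  simp only [hC]
  constructor
  · exact fun h w => Set.mem_iInter.mpr fun i => h i w
  · exact fun h i w => Set.mem_iInter.mp (h w) i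

lemma IsClopenCondition.and {C C' : ∀ T : Over S, (T ⟶ P) → Prop}
    (h : IsClopenCondition C) (h' : IsClopenCondition C') :
    IsClopenCondition fun T f => C T f ∧ C' T f := by
  obtain ⟨L, hL, hC⟩ := h
  obtain ⟨L', hL', hC'⟩ := h'
  refine ⟨L ⊓ L', hL.inter hL', fun T f => ?_⟩
  change C T f ∧ C' T f ↔ _
  rw [hC, hC']
  exact ⟨fun h w => ⟨h.1 w, h.2 w⟩, fun h => ⟨fun w => (h w).1, fun w => (h w).2⟩⟩

lemma isClopenCondition_comp_eq {M : Over S} [IsFinite M.hom] [Etale M.hom] (x y : P ⟶ M) :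
    IsClopenCondition fun _ f => f ≫ x = f ≫ y :=
  ⟨eqLocus x y, isClosed_eqLocus x y, fun _ f => comp_eq_comp_iff x y f⟩

lemma eq_one_iff_isUnit_sum {R : Type*} [CommRing R] {n : ℕ} (hn : IsUnit (n : R)) {z : R}
    (hz : z ^ n = 1) : z = 1 ↔ IsUnit (∑ i ∈ Finset.range n, z ^ i) := by
  constructor
  · rintro rfl
    simpa using hn
  · intro h
    have := geom_sum_mul z n
    rw [hz, sub_self, h.mul_right_eq_zero, sub_eq_zero] at this
    exact this

/-- For an `n`-th root of unity `z`, with `n` invertible, the loci where `z - 1` and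
`1 + z + ⋯ + zⁿ⁻¹` are invertible are complementary. -/
lemma compl_basicOpen_sub_one {n : ℕ} (hn : IsUnit (n : Γ(P.left, ⊤))) {z : Γ(P.left, ⊤)}
    (hz : z ^ n = 1) : (P.left.basicOpen (z - 1) : Set P.left)ᶜ =
      P.left.basicOpen (∑ i ∈ Finset.range n, z ^ i) := by
  ext t
  simp only [Set.mem_compl_iff, SetLike.mem_coe, Scheme.mem_basicOpen _ _ t (show t ∈ ⊤ from trivial)]
  set g := (P.left.presheaf.germ ⊤ t trivial).hom
  have hgn : IsUnit (n : P.left.presheaf.stalk t) := by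
    have := hn.map g
    rwa [map_natCast] at this
  have hmul : g (∑ i ∈ Finset.range n, z ^ i) * g (z - 1) = 0 := by
    rw [← map_mul, geom_sum_mul, hz, sub_self, map_zero]
  constructor
  · intro h
    -- the sum is congruent to `n` modulo `z - 1`
    obtain ⟨w, hw⟩ : z - 1 ∣ (∑ i ∈ Finset.range n, z ^ i) - n := by
      have : (∑ i ∈ Finset.range n, z ^ i) - n = ∑ i ∈ Finset.range n, (z ^ i - 1) := by simp
      rw [this]
      exact Finset.dvd_sum fun i _ => sub_one_dvd_pow_sub_one z i
    have h1 : g (∑ i ∈ Finset.range n, z ^ i) + -(g (z - 1) * g w) = n := by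
      rw [← map_mul, ← hw, map_sub, map_natCast]; ring
    rw [← h1] at hgn
    refine (IsLocalRing.isUnit_or_isUnit_of_isUnit_add hgn).resolve_right fun h2 => h ?_
    exact isUnit_of_mul_isUnit_left (IsUnit.neg_iff _ |>.mp h2)
  · intro h h'
    rw [h.mul_right_eq_zero] at hmul
    exact h'.ne_zero hmul

lemma isClopenCondition_isUnit {n : ℕ} (hn : IsUnit (n : Γ(P.left, ⊤))) {z : Γ(P.left, ⊤)}
    (hz : z ^ n = 1) : IsClopenCondition fun _ (f : _ ⟶ P) => IsUnit (res f z - 1) := by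
  refine ⟨P.left.basicOpen (z - 1), ?_, fun T f => ?_⟩
  · rw [← isOpen_compl_iff, compl_basicOpen_sub_one hn hz]
    exact (P.left.basicOpen _).2
  · rw [← isUnit_res_iff, map_sub, map_one]

lemma isClopenCondition_eq_one {n : ℕ} (hn : IsUnit (n : Γ(P.left, ⊤))) {z : Γ(P.left, ⊤)}
    (hz : z ^ n = 1) : IsClopenCondition fun _ (f : _ ⟶ P) => res f z = 1 := by
  refine ⟨P.left.basicOpen (∑ i ∈ Finset.range n, z ^ i), ?_, fun T f => ?_⟩
  · rw [← compl_basicOpen_sub_one hn hz, isClosed_compl_iff]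
    exact (P.left.basicOpen _).2
  · have := hn.map (res f)
    rw [map_natCast] at this
    change res f z = 1 ↔ _
    rw [← isUnit_res_iff, map_sum, eq_one_iff_isUnit_sum this (by rw [← map_pow, hz, map_one])]
    simp

end Cover

section FrameCover

variable {S : Scheme.{u}} {X : SymplecticModule S} {D : ModuleType}

lemma isClopenCondition_isFrame (hX : X.HasType D) {P : Over S} (x y : D.K → (P ⟶ X.M)) :
    IsClopenCondition fun _ (f : _ ⟶ P) =>
      IsFrame X D.eps (fun a => f ≫ x a) (fun a => f ≫ y a) := by
  have hz : ∀ v w : P ⟶ X.M, (X.e P v w : Γ(P.left, ⊤)) ^ D.card = 1 := fun v w => by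
    rw [← Units.val_pow_eq_pow_val, hX.e_pow_card, Units.val_one]
  have hadd : ∀ v : D.K → (P ⟶ X.M), IsClopenCondition fun _ (f : _ ⟶ P) =>
      ∀ a b, f ≫ v (a + b) = f ≫ (v a * v b) := fun v =>
    .forall fun a => .forall fun b => isClopenCondition_comp_eq _ _
  have hone : ∀ v : D.K → (P ⟶ X.M), IsClopenCondition fun _ (f : _ ⟶ P) =>
      ∀ a b, res f (X.e P (v a) (v b) : Γ(P.left, ⊤)) = 1 := fun v =>
    .forall fun a => .forall fun b => isClopenCondition_eq_one (hX.isUnit_card P) (hz _ _)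
  have hunit : ∀ (v w : D.K → (P ⟶ X.M)), IsClopenCondition fun _ (f : _ ⟶ P) =>
      ∀ b, b ≠ 0 → IsUnit (res f (X.e P (v b) (w b) : Γ(P.left, ⊤)) - 1) := fun v w =>
    .forall fun b => .forall fun _ => isClopenCondition_isUnit (hX.isUnit_card P) (hz _ _)
  obtain ⟨L, hL, h⟩ := (hadd x).and <| (hadd y).and <| (hone x).and <| (hone y).and <|
    (hunit (fun b => x (D.eps b)) y).and (hunit x fun b => y (D.eps b))
  refine ⟨L, hL, fun T f => (Iff.trans ?_ (h T f))⟩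
  have he : ∀ v w : P ⟶ X.M, X.e T (f ≫ v) (f ≫ w) = 1 ↔ res f (X.e P v w : Γ(P.left, ⊤)) = 1 := by
    intro v w
    rw [X.e_natural, Units.ext_iff, GmPoints.val_map, Units.val_one]
  constructor
  · intro H
    refine ⟨?_, ?_, ?_, ?_, ?_, ?_⟩
    · intro a b; rw [MonObj.comp_mul]; exact H.x_add a b
    · intro a b; rw [MonObj.comp_mul]; exact H.y_add a b
    · intro a b; exact (he _ _).mp (H.x_x a b)
    · intro a b; exact (he _ _).mp (H.y_y a b)
    · intro b hb; rw [← GmPoints.val_map, ← X.e_natural]; exact H.isUnit_left b hb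
    · intro b hb; rw [← GmPoints.val_map, ← X.e_natural]; exact H.isUnit_right b hb
  · rintro ⟨h1, h2, h3, h4, h5, h6⟩
    refine ⟨?_, ?_, ?_, ?_, ?_, ?_⟩
    · intro a b; rw [← MonObj.comp_mul]; exact h1 a b
    · intro a b; rw [← MonObj.comp_mul]; exact h2 a b
    · intro a b; exact (he _ _).mpr (h3 a b)
    · intro a b; exact (he _ _).mpr (h4 a b)
    · intro b hb; rw [X.e_natural, GmPoints.val_map]; exact h5 b hb
    · intro b hb; rw [X.e_natural, GmPoints.val_map]; exact h6 b hb

/-- A symplectic module of type `D` has a frame over a finite étale covering of the base: the space of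
all frames is open and closed in a power of `M`, and it has a point over every geometric point. -/
lemma exists_frame_cover (hX : X.HasType D) : ∃ P : Over S, IsFinite P.hom ∧ Etale P.hom ∧
    Surjective P.hom ∧ Nonempty (Frame X D P) := by
  obtain ⟨P, _, _, c, hc⟩ := exists_finite_etale_power X.M (Fintype.card (D.K ⊕ D.K))
  let σ := Fintype.equivFin (D.K ⊕ D.K)
  let x (a : D.K) : P ⟶ X.M := c (σ (.inl a))
  let y (a : D.K) : P ⟶ X.M := c (σ (.inr a))
  obtain ⟨L, hL, h⟩ := isClopenCondition_isFrame hX x y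
  have hclosed : IsClosedImmersion L.ι := by
    refine IsClosedImmersion.of_isPreimmersion L.ι ?_
    rwa [Scheme.Opens.range_ι]
  refine ⟨opn P L, ?_, ?_, ⟨fun s => ?_⟩, ⟨⟨_, _, (h _ (inc P L)).mpr (inc_apply_mem P L)⟩⟩⟩
  · exact inferInstanceAs (IsFinite (L.ι ≫ P.hom))
  · exact inferInstanceAs (Etale (L.ι ≫ P.hom))
  · obtain ⟨Q, q, z, hz, -, -, -, -, -, x', y', hQ⟩ := exists_geometricPoint hX (Over.mk (𝟙 S)) s
    obtain ⟨f, hf⟩ := hc Q fun i => Sum.elim x' y' (σ.symm i)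
    have hx : ∀ a, f ≫ x a = x' a := fun a => by rw [hf, Equiv.symm_apply_apply, Sum.elim_inl]
    have hy : ∀ a, f ≫ y a = y' a := fun a => by rw [hf, Equiv.symm_apply_apply, Sum.elim_inr]
    have hmem := (h Q f).mp (by simpa only [hx, hy] using hQ)
    refine ⟨(opnLift L f hmem).left z, ?_⟩
    rw [← Scheme.Hom.comp_apply, Over.w, ← hz, ← Over.w q]
    simp

end FrameCover

/-! ### Homomorphisms of sheaves of modules -/

section Modules

open TopologicalSpace Opposite

variable {Y : Scheme.{u}}

/-- A linear morphism of the underlying abelian presheaves is a morphism of `𝒪_Y`-modules. -/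
def modulesHomMk {M N : Y.Modules} (φ : M.presheaf ⟶ N.presheaf)
    (hφ : ∀ (U : Y.Opens) (r : Γ(Y, U)) (x : Γ(M, U)),
      φ.app (op U) (r • x) = r • (φ.app (op U) x : Γ(N, U))) : M ⟶ N :=
  (⟨PresheafOfModules.homMk φ fun U r x => hφ U.unop r x⟩ : SheafOfModules.Hom M N)

lemma app_naturality {M N : Y.Modules} (ψ : M ⟶ N) {V U : Y.Opens} (i : V ⟶ U) (s : Γ(M, U)) :
    ψ.app V (M.presheaf.map i.op s) = N.presheaf.map i.op (ψ.app U s) :=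
  ConcreteCategory.congr_hom (ψ.mapPresheaf.naturality i.op) s

/-- Sections of an `𝒪_Y`-module agree if they agree on all members of a family of open sets which
cover the given open set. -/
lemma section_ext (M : Y.Modules) {U : Y.Opens} (s t : Γ(M, U))
    (h : ∀ y ∈ U, ∃ (V : Y.Opens) (i : V ≤ U), y ∈ V ∧
      M.presheaf.map (homOfLE i).op s = M.presheaf.map (homOfLE i).op t) : s = t := by
  choose! V i hV hst using h
  refine TopCat.Sheaf.eq_of_locally_eq' ⟨M.presheaf, M.isSheaf⟩ (fun y : U => V y) U
    (fun y => homOfLE (i y y.2)) (fun y hy => ?_) s t fun y => hst y y.2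
  exact Opens.mem_iSup.mpr ⟨⟨y, hy⟩, hV y hy⟩

/-- A morphism of `𝒪_Y`-modules may be given on a family of small open sets which covers `Y` and
contains every open subset of its members. -/
lemma exists_hom_of_small {M N : Y.Modules} (P : Y.Opens → Prop) (hP : ∀ U V, V ≤ U → P U → P V)
    (hcov : ∀ y, ∃ U, y ∈ U ∧ P U) (l : ∀ U, P U → Γ(M, U) →ₗ[Γ(Y, U)] Γ(N, U))
    (hl : ∀ (U V : Y.Opens) (h : V ≤ U) (hU : P U) (hV : P V) (s : Γ(M, U)),
      l V hV (M.presheaf.map (homOfLE h).op s) = N.presheaf.map (homOfLE h).op (l U hU s)) :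
    ∃ ψ : M ⟶ N, ∀ (U : Y.Opens) (hU : P U) (s : Γ(M, U)), ψ.app U s = l U hU s := by
  let B : {U : Y.Opens // P U} → Opens Y := fun U => U.1
  have hB : Opens.IsBasis (Set.range B) := by
    rw [Opens.isBasis_iff_nbhd]
    intro U y hy
    obtain ⟨V, hV, hPV⟩ := hcov y
    exact ⟨U ⊓ V, ⟨⟨_, hP V _ inf_le_right hPV⟩, rfl⟩, ⟨hy, hV⟩, inf_le_left⟩
  let α : (inducedFunctor B).op ⋙ M.presheaf ⟶ (inducedFunctor B).op ⋙ N.presheaf :=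
    { app := fun U => AddCommGrpCat.ofHom (l U.unop.1 U.unop.2).toAddMonoidHom
      naturality := fun U V i => by
        ext s
        exact hl U.unop.1 V.unop.1 (leOfHom i.unop.hom) U.unop.2 V.unop.2 s }
  let β := TopCat.Sheaf.restrictHomEquivHom M.presheaf ⟨N.presheaf, N.isSheaf⟩ hB α
  have hβ : ∀ (U : Y.Opens) (hU : P U) (s : Γ(M, U)), β.app (op U) s = l U hU s := fun U hU s =>
    ConcreteCategory.congr_hom
      (TopCat.Sheaf.extend_hom_app M.presheaf ⟨N.presheaf, N.isSheaf⟩ hB α ⟨U, hU⟩) s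
  have hn : ∀ {V U : Y.Opens} (i : V ⟶ U) (s : Γ(M, U)), β.app (op V) (M.presheaf.map i.op s) =
      N.presheaf.map i.op (β.app (op U) s) := fun i s =>
    ConcreteCategory.congr_hom (β.naturality i.op) s
  refine ⟨modulesHomMk β fun U r x => section_ext N _ _ fun y hy => ?_, hβ⟩
  obtain ⟨V, hV, hPV⟩ := hcov y
  have hPUV := hP V (U ⊓ V) inf_le_right hPV
  refine ⟨U ⊓ V, inf_le_left, ⟨hy, hV⟩, ?_⟩
  rw [← hn, Scheme.Modules.map_smul, Scheme.Modules.map_smul, ← hn, hβ _ hPUV, hβ _ hPUV, map_smul]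

end Modules

/-! ### Restriction to open subschemes -/

section Opens

variable {S : Scheme.{u}} {T' T : Over S} (f : T' ⟶ T)

/-- The restriction of `f` to the preimage of an open subset. -/
abbrev preim (U : T.left.Opens) : opn T' (f.left ⁻¹ᵁ U) ⟶ opn T U :=
  opnLift U (inc T' (f.left ⁻¹ᵁ U) ≫ f) fun z => inc_apply_mem T' (f.left ⁻¹ᵁ U) z

lemma toSection_res_preim (U : T.left.Opens) (a : Γ((opn T U).left, ⊤)) :
    toSection (f.left ⁻¹ᵁ U) (res (preim f U) a) = f.left.app U (toSection U a) := by
  have h1 : (preim f U).left = f.left ∣_ U := by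
    rw [← cancel_mono U.ι, morphismRestrict_ι]
    exact congrArg CommaMorphism.left (opnLift_inc U (inc T' (f.left ⁻¹ᵁ U) ≫ f) _)
  have h2 : (f.left ∣_ U).appTop ≫ (f.left ⁻¹ᵁ U).topIso.hom = U.topIso.hom ≫ f.left.app U := by
    rw [morphismRestrict_appTop, Scheme.Opens.topIso_hom, Scheme.Opens.topIso_hom]
    refine (Category.assoc _ _ _).trans ?_
    refine (congrArg (_ ≫ ·) (T'.left.presheaf.map_comp _ _).symm).trans ?_
    exact (f.left.naturality (eqToHom U.ι_image_top.symm).op).symm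
  have h3 : (preim f U).left.appTop ≫ (f.left ⁻¹ᵁ U).topIso.hom =
      U.topIso.hom ≫ f.left.app U := by rw [← h2]; exact congrArg (·.appTop ≫ _) h1
  exact ConcreteCategory.congr_hom h3 a

lemma preim_inc (U : T.left.Opens) :
    preim f U ≫ inc T U = inc T' (f.left ⁻¹ᵁ U) ≫ f := opnLift_inc _ _ _

lemma incLE_inc {V U : T.left.Opens} (h : V ≤ U) : incLE h ≫ inc T U = inc T V :=
  opnLift_inc _ _ _

lemma incLE_comp_incLE {W V U : T.left.Opens} (h : W ≤ V) (h' : V ≤ U) :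
    incLE h ≫ incLE h' = incLE (T := T) (h.trans h') := by
  rw [← cancel_mono (inc T U), Category.assoc, incLE_inc, incLE_inc, incLE_inc]

lemma incLE_refl {U : T.left.Opens} (h : U ≤ U) : incLE (T := T) h = 𝟙 _ := by
  rw [← cancel_mono (inc T U), incLE_inc, Category.id_comp]

lemma incLE_preim {V U : T.left.Opens} (h : V ≤ U) :
    incLE (show f.left ⁻¹ᵁ V ≤ f.left ⁻¹ᵁ U from fun _ ht => h ht) ≫ preim f U = preim f V ≫ incLE h := by
  rw [← cancel_mono (inc T U), Category.assoc, Category.assoc, preim_inc, incLE_inc, preim_inc,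
    reassoc_of% incLE_inc]

lemma preim_comp {T'' : Over S} (g : T'' ⟶ T') (U : T.left.Opens) :
    preim (g ≫ f) U = preim g (f.left ⁻¹ᵁ U) ≫ preim f U := by
  have h : (preim g (f.left ⁻¹ᵁ U) ≫ preim f U) ≫ inc T U =
      inc T'' (g.left ⁻¹ᵁ f.left ⁻¹ᵁ U) ≫ g ≫ f := by
    rw [Category.assoc, preim_inc, ← Category.assoc, preim_inc, Category.assoc]
  exact (cancel_mono (inc T U)).mp ((preim_inc (g ≫ f) U).trans h.symm)

/-- An open subset of an open subscheme `V`, regarded as an open subset of `V`. -/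
abbrev openIn (V U : T.left.Opens) : (opn T V).left.Opens := (inc T V).left ⁻¹ᵁ U

lemma preim_inc_incLE {U V : T.left.Opens} (h : U ≤ V) :
    preim (inc T V) U ≫ incLE h = inc (opn T V) (openIn V U) := by
  rw [← cancel_mono (inc T V), Category.assoc, incLE_inc, preim_inc]

/-- The inverse of `preim (inc T V) U` when `U ≤ V`. -/
abbrev toOpenIn {U V : T.left.Opens} (h : U ≤ V) : opn T U ⟶ opn (opn T V) (openIn V U) :=
  opnLift (openIn V U) (incLE h) fun z => by
    have h : (incLE h ≫ inc T V).left z ∈ U := by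
      rw [opnLift_inc]; exact inc_apply_mem T U z
    exact h

lemma toOpenIn_inc {U V : T.left.Opens} (h : U ≤ V) :
    toOpenIn h ≫ inc (opn T V) (openIn V U) = incLE h := opnLift_inc _ _ _

lemma toOpenIn_preim {U V : T.left.Opens} (h : U ≤ V) :
    toOpenIn h ≫ preim (inc T V) U = 𝟙 _ := by
  rw [← cancel_mono (inc T U), Category.assoc, preim_inc, reassoc_of% toOpenIn_inc, incLE_inc,
    Category.id_comp]

end Opens

/-! ### Sheaves of modules on the category of `S`-schemes -/

/-- A Zariski sheaf of modules on the category of all `S`-schemes, given by its values on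
`S`-schemes. It is not assumed to be quasi-coherent. -/
structure BigModule (S : Scheme.{u}) where
  /-- the sections over `T` -/
  obj : Over S → Type u
  [addCommGroup : ∀ T, AddCommGroup (obj T)]
  [module : ∀ T : Over S, Module Γ(T.left, ⊤) (obj T)]
  /-- the restriction maps -/
  map : ∀ {T' T : Over S}, (T' ⟶ T) → (obj T →+ obj T')
  map_smul : ∀ {T' T : Over S} (f : T' ⟶ T) (a : Γ(T.left, ⊤)) (v : obj T),
    map f (a • v) = res f a • map f v
  map_id : ∀ (T : Over S) (v : obj T), map (𝟙 T) v = v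
  map_comp : ∀ {T'' T' T : Over S} (g : T'' ⟶ T') (f : T' ⟶ T) (v : obj T),
    map (g ≫ f) v = map g (map f v)
  eq_of_locally : ∀ {T : Over S} (v w : obj T),
    (∀ t : T.left, ∃ U : T.left.Opens, t ∈ U ∧ map (inc T U) v = map (inc T U) w) → v = w
  exists_glue : ∀ {T : Over S} {I : Type u} (U : I → T.left.Opens) (_ : ∀ t, ∃ i, t ∈ U i)
    (v : ∀ i, obj (opn T (U i))),
    (∀ (i j : I) (W : Over S) (f : W ⟶ opn T (U i)) (g : W ⟶ opn T (U j)),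
      f ≫ inc T (U i) = g ≫ inc T (U j) → map f (v i) = map g (v j)) →
    ∃ w : obj T, ∀ i, map (inc T (U i)) w = v i

attribute [instance] BigModule.addCommGroup BigModule.module

namespace BigModule

open TopologicalSpace Opposite

variable {S : Scheme.{u}} (F : BigModule S)

section Sheaf

variable (T : Over S)

/-- The abelian presheaf on `T` defined by a sheaf of modules on the category of `S`-schemes. -/
def presheafOf : TopCat.Presheaf Ab.{u} T.left where
  obj U := AddCommGrpCat.of (F.obj (opn T U.unop))
  map i := AddCommGrpCat.ofHom (F.map (incLE (leOfHom i.unop)))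
  map_id U := by
    ext v
    exact (congrArg (F.map · v) (incLE_refl _)).trans (F.map_id _ v)
  map_comp i j := by
    ext v
    refine (congrArg (F.map · v) ?_).trans (F.map_comp _ _ v)
    exact (incLE_comp_incLE (leOfHom j.unop) (leOfHom i.unop)).symm

instance (U : T.left.Opensᵒᵖ) : Module (T.left.ringCatSheaf.obj.obj U) ((F.presheafOf T).obj U) :=
  Module.compHom (F.obj (opn T U.unop)) (toSection U.unop).symm.toRingHom

lemma map_eq_of_comp_eq {T : Over S} {U V : T.left.Opens} (v : F.obj (opn T U))
    (w : F.obj (opn T V))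
    (h : F.map (incLE (inf_le_left : U ⊓ V ≤ U)) v = F.map (incLE (inf_le_right : U ⊓ V ≤ V)) w)
    {W : Over S} (f : W ⟶ opn T U) (g : W ⟶ opn T V) (hfg : f ≫ inc T U = g ≫ inc T V) :
    F.map f v = F.map g w := by
  have hk : ∀ z, (f ≫ inc T U).left z ∈ U ⊓ V := fun z => by
    refine ⟨inc_apply_mem T U (f.left z), ?_⟩
    rw [hfg]
    exact inc_apply_mem T V (g.left z)
  have h1 : f = opnLift (U ⊓ V) (f ≫ inc T U) hk ≫ incLE inf_le_left := by
    rw [← cancel_mono (inc T U), Category.assoc, incLE_inc, opnLift_inc]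
  have h2 : g = opnLift (U ⊓ V) (f ≫ inc T U) hk ≫ incLE inf_le_right := by
    rw [← cancel_mono (inc T V), Category.assoc, incLE_inc, opnLift_inc, hfg]
  rw [h1, h2, F.map_comp, h, F.map_comp]

lemma isSheaf_presheafOf : (F.presheafOf T).IsSheaf := by
  rw [TopCat.Presheaf.isSheaf_iff_isSheafUniqueGluing]
  intro I U s hs
  have hU : ∀ t, ∃ i, t ∈ openIn (iSup U) (U i) := fun t => by
    obtain ⟨i, hi⟩ := Opens.mem_iSup.mp (inc_apply_mem T (iSup U) t)
    exact ⟨i, hi⟩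
  let s' : ∀ i, F.obj (opn T (U i)) := s
  obtain ⟨w, hw⟩ := F.exists_glue (fun i => openIn (iSup U) (U i)) hU
    (fun i => F.map (preim (inc T (iSup U)) (U i)) (s' i)) fun i j W f g hfg => by
      rw [← F.map_comp, ← F.map_comp]
      refine F.map_eq_of_comp_eq _ _ (hs i j) _ _ ?_
      rw [Category.assoc, Category.assoc, preim_inc, preim_inc, reassoc_of% hfg]
  have hw' : ∀ i, F.map (incLE (le_iSup U i)) w = s' i := fun i => by
    rw [← toOpenIn_inc, F.map_comp, hw, ← F.map_comp, toOpenIn_preim, F.map_id]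
  refine ⟨w, hw', fun w' hww => ?_⟩
  let w₁ : F.obj (opn T (iSup U)) := w'
  refine F.eq_of_locally w₁ w fun t => ?_
  obtain ⟨i, hi⟩ := hU t
  refine ⟨_, hi, ?_⟩
  rw [← preim_inc_incLE (le_iSup U i), F.map_comp, F.map_comp, hw']
  exact congrArg _ (hww i)

/-- The `𝒪_T`-module on `T` defined by a sheaf of modules on the category of `S`-schemes. -/
def sheafOf : T.left.Modules :=
  (⟨PresheafOfModules.ofPresheaf (F.presheafOf T) (fun U V i r v => by
    refine (F.map_smul _ _ _).trans (congrArg (· • _) ?_)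
    refine (toSection V.unop).injective ?_
    refine (toSection_res_incLE (leOfHom i.unop) _).trans ?_
    refine Eq.trans ?_ ((toSection V.unop).apply_symm_apply _).symm
    exact congrArg _ ((toSection U.unop).apply_symm_apply r)),
    F.isSheaf_presheafOf T⟩ : SheafOfModules T.left.ringCatSheaf)

/-- Sections of `F.sheafOf T` over `U` are sections of `F` over the open subscheme `U`. -/
def ofObj {T : Over S} {U : T.left.Opens} : F.obj (opn T U) ≃+ Γ(F.sheafOf T, U) := AddEquiv.refl _

variable {T}

lemma ofObj_map {V U : T.left.Opens} (h : V ≤ U) (v : F.obj (opn T U)) :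
    (F.sheafOf T).presheaf.map (homOfLE h).op (F.ofObj v) = F.ofObj (F.map (incLE h) v) := rfl

lemma ofObj_smul {U : T.left.Opens} (a : Γ((opn T U).left, ⊤)) (v : F.obj (opn T U)) :
    F.ofObj (a • v) = toSection U a • F.ofObj v := by
  change a • v = (toSection U).symm (toSection U a) • v
  rw [RingEquiv.symm_apply_apply]

end Sheaf

section Restriction

variable {T' T : Over S} (f : T' ⟶ T)

/-- The restriction map of sheaves along a morphism of `S`-schemes. -/
def restr : F.sheafOf T ⟶ (Scheme.Modules.pushforward f.left).obj (F.sheafOf T') :=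
  modulesHomMk
    { app := fun U => AddCommGrpCat.ofHom (F.map (preim f U.unop))
      naturality := fun U V i => by
        ext v
        refine (F.map_comp _ _ v).symm.trans (Eq.trans ?_ (F.map_comp _ _ v))
        exact congrArg (F.map · v) (incLE_preim f (leOfHom i.unop)).symm }
    (fun U r v => by
      obtain ⟨a, rfl⟩ := (toSection U).surjective r
      obtain ⟨v, rfl⟩ := F.ofObj.surjective v
      rw [← ofObj_smul]
      refine (F.map_smul _ _ _).trans ?_
      refine (F.ofObj_smul _ _).trans ?_
      exact congrArg (· • _) (toSection_res_preim f U a))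

end Restriction

section Basis

variable {K : Type} [Fintype K]

/-- A family of sections over `T` which is a basis of the sections over every `T`-scheme. -/
def IsBasis {T : Over S} (b : K → F.obj T) : Prop :=
  ∀ (T' : Over S) (f : T' ⟶ T),
    Function.Bijective fun c : K → Γ(T'.left, ⊤) => ∑ k, c k • F.map f (b k)

variable {F} in
lemma IsBasis.bijective {T : Over S} {b : K → F.obj T} (hb : F.IsBasis b) {T' : Over S}
    {W : T'.left.Opens} (g : opn T' W ⟶ T) :
    Function.Bijective fun c : K → Γ(T'.left, W) => ∑ k, c k • F.ofObj (F.map g (b k)) := by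
  have h : (fun c : K → Γ(T'.left, W) => ∑ k, c k • F.ofObj (F.map g (b k))) =
      F.ofObj ∘ (fun c : K → Γ((opn T' W).left, ⊤) => ∑ k, c k • F.map g (b k)) ∘
        fun c k => (toSection W).symm (c k) := by
    funext c
    rw [Function.comp_apply, Function.comp_apply, map_sum]
    refine Finset.sum_congr rfl fun k _ => ?_
    rw [ofObj_smul, RingEquiv.apply_symm_apply]
  rw [h]
  exact F.ofObj.bijective.comp ((hb _ g).comp
    (Equiv.piCongrRight fun _ => (toSection W).symm.toEquiv).bijective)

variable {F} in
/-- The basis of the sections of `F.sheafOf T'` over an open subset `W` of `T'` which is induced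
by a basis over `T` and a morphism `W ⟶ T`. -/
def IsBasis.basis {T : Over S} {b : K → F.obj T} (hb : F.IsBasis b) {T' : Over S}
    {W : T'.left.Opens} (g : opn T' W ⟶ T) :
    Module.Basis K Γ(T'.left, W) Γ(F.sheafOf T', W) :=
  .ofEquivFun (LinearEquiv.ofBijective
    (Fintype.linearCombination Γ(T'.left, W) fun k => F.ofObj (F.map g (b k)))
    (hb.bijective g)).symm

variable {F} in
lemma IsBasis.basis_apply {T : Over S} {b : K → F.obj T} (hb : F.IsBasis b) {T' : Over S}
    {W : T'.left.Opens} (g : opn T' W ⟶ T) (k : K) :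
    hb.basis g k = F.ofObj (F.map g (b k)) := by
  classical
  rw [IsBasis.basis, Module.Basis.coe_ofEquivFun, LinearEquiv.symm_symm]
  refine (Fintype.linearCombination_apply_single _ _ _ _).trans ?_
  rw [one_smul]

end Basis

section Extension

variable {T' T : Over S} (f : T' ⟶ T) {N : T'.left.Modules}
  (φ : F.sheafOf T ⟶ (Scheme.Modules.pushforward f.left).obj N)

/-- A section over an open subset `U` of `T`, restricted to an open subset `W` of the preimage
of `U`. -/
def restrTo {W : T'.left.Opens} {U : T.left.Opens} (h : W ≤ f.left ⁻¹ᵁ U)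
    (φ : F.sheafOf T ⟶ (Scheme.Modules.pushforward f.left).obj N) (s : Γ(F.sheafOf T, U)) :
    Γ(N, W) :=
  N.presheaf.map (homOfLE h).op (show Γ(N, f.left ⁻¹ᵁ U) from φ.app U s)

variable {f}

lemma restrTo_sum {W : T'.left.Opens} {U : T.left.Opens} (h : W ≤ f.left ⁻¹ᵁ U) {K : Type}
    [Fintype K] (c : K → Γ(T.left, U)) (s : K → Γ(F.sheafOf T, U)) :
    F.restrTo f h φ (∑ k, c k • s k) =
      ∑ k, T'.left.presheaf.map (homOfLE h).op (f.left.app U (c k)) • F.restrTo f h φ (s k) := by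
  rw [restrTo, map_sum]
  refine (map_sum (N.presheaf.map (homOfLE h).op).hom _ _).trans ?_
  refine Finset.sum_congr rfl fun k _ => ?_
  rw [Scheme.Modules.Hom.app_smul]
  exact Scheme.Modules.map_smul N (homOfLE h) _ _

lemma restrTo_map {W : T'.left.Opens} {V U : T.left.Opens} (h : W ≤ f.left ⁻¹ᵁ V) (h' : V ≤ U)
    (s : Γ(F.sheafOf T, U)) :
    F.restrTo f h φ ((F.sheafOf T).presheaf.map (homOfLE h').op s) =
      F.restrTo f (h.trans fun _ ht => h' ht) φ s := by
  rw [restrTo, app_naturality]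
  exact (ConcreteCategory.congr_hom (N.presheaf.map_comp _ _) _).symm

lemma map_restrTo {W' W : T'.left.Opens} {U : T.left.Opens} (h : W' ≤ W) (h' : W ≤ f.left ⁻¹ᵁ U)
    (s : Γ(F.sheafOf T, U)) :
    N.presheaf.map (homOfLE h).op (F.restrTo f h' φ s) = F.restrTo f (h.trans h') φ s :=
  (ConcreteCategory.congr_hom (N.presheaf.map_comp _ _) _).symm

lemma restrTo_restr {W : T'.left.Opens} {U : T.left.Opens} (h : W ≤ f.left ⁻¹ᵁ U)
    (s : F.obj (opn T U)) :
    F.restrTo f h (F.restr f) (F.ofObj s) = F.ofObj (F.map (incLE h ≫ preim f U) s) :=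
  (F.map_comp _ _ s).symm

lemma restrTo_comp {N' : T'.left.Modules} (ψ : N ⟶ N') {W : T'.left.Opens} {U : T.left.Opens}
    (h : W ≤ f.left ⁻¹ᵁ U) (s : Γ(F.sheafOf T, U)) :
    F.restrTo f h (φ ≫ (Scheme.Modules.pushforward f.left).map ψ) s =
      ψ.app W (F.restrTo f h φ s) :=
  (app_naturality ψ (homOfLE h) _).symm

variable {K : Type} [Fintype K]

/-- A sheaf of modules on the category of `S`-schemes which has bases locally on `T`. -/
def LocallyFreeOn (K : Type) [Fintype K] (T : Over S) : Prop :=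
  ∀ t : T.left, ∃ U : T.left.Opens, t ∈ U ∧ ∃ b : K → F.obj (opn T U), F.IsBasis b

variable {F}

lemma linearMap_ext_of_basis {U : T.left.Opens} {b : K → F.obj (opn T U)} (hb : F.IsBasis b)
    {W : T'.left.Opens} (h : W ≤ f.left ⁻¹ᵁ U) {N : Type u} [AddCommGroup N]
    [Module Γ(T'.left, W) N] (l l' : Γ(F.sheafOf T', W) →ₗ[Γ(T'.left, W)] N)
    (hl : ∀ s, l (F.restrTo f h (F.restr f) s) = l' (F.restrTo f h (F.restr f) s)) : l = l' := by
  refine (hb.basis (incLE h ≫ preim f U)).ext fun k => ?_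
  rw [hb.basis_apply, ← restrTo_restr]
  exact hl _

/-- If `F` has a basis over an open subset `U` of `T`, then over open subsets `W` of the preimage
of `U` a morphism out of `F.sheafOf T` extends linearly to sections of `F.sheafOf T'`. -/
lemma exists_linearMap_of_basis {U : T.left.Opens} {b : K → F.obj (opn T U)} (hb : F.IsBasis b)
    {W : T'.left.Opens} (h : W ≤ f.left ⁻¹ᵁ U) :
    ∃ l : Γ(F.sheafOf T', W) →ₗ[Γ(T'.left, W)] Γ(N, W),
      ∀ (U' : T.left.Opens) (h' : W ≤ f.left ⁻¹ᵁ U') (s : Γ(F.sheafOf T, U')),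
        l (F.restrTo f h' (F.restr f) s) = F.restrTo f h' φ s := by
  refine ⟨(hb.basis (incLE h ≫ preim f U)).constr Γ(T'.left, W)
    fun k => F.restrTo f h φ (F.ofObj (b k)), fun U' h' s => ?_⟩
  have hV : W ≤ f.left ⁻¹ᵁ (U ⊓ U') := fun _ ht => ⟨h ht, h' ht⟩
  rw [← F.restrTo_map (F.restr f) hV inf_le_right, ← F.restrTo_map φ hV inf_le_right]
  obtain ⟨c, hc⟩ := (hb.bijective (incLE (inf_le_left : U ⊓ U' ≤ U))).2
    ((F.sheafOf T).presheaf.map (homOfLE inf_le_right).op s)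
  rw [← hc, restrTo_sum, restrTo_sum, map_sum]
  refine Finset.sum_congr rfl fun k _ => ?_
  rw [_root_.map_smul, ← ofObj_map, F.restrTo_map, F.restrTo_map]
  congr 1
  rw [restrTo_restr, ← hb.basis_apply, Module.Basis.constr_basis]

/-- If `F` is locally free on `T`, then `F.sheafOf T'` satisfies the universal property of the
pullback of `F.sheafOf T` along `f : T' ⟶ T`. -/
lemma existsUnique_extension (hF : F.LocallyFreeOn K T) :
    ∃! ψ : F.sheafOf T' ⟶ N, F.restr f ≫ (Scheme.Modules.pushforward f.left).map ψ = φ := by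
  let P : T'.left.Opens → Prop := fun W =>
    ∃ (U : T.left.Opens) (b : K → F.obj (opn T U)), F.IsBasis b ∧ W ≤ f.left ⁻¹ᵁ U
  have hcov : ∀ y, ∃ W, y ∈ W ∧ P W := fun y => by
    obtain ⟨U, hU, b, hb⟩ := hF (f.left y)
    exact ⟨f.left ⁻¹ᵁ U, hU, U, b, hb, le_rfl⟩
  have hex : ∀ W, P W → ∃ l : Γ(F.sheafOf T', W) →ₗ[Γ(T'.left, W)] Γ(N, W),
      ∀ (U' : T.left.Opens) (h' : W ≤ f.left ⁻¹ᵁ U') (s : Γ(F.sheafOf T, U')),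
        l (F.restrTo f h' (F.restr f) s) = F.restrTo f h' φ s := by
    rintro W ⟨U, b, hb, h⟩
    exact exists_linearMap_of_basis φ hb h
  choose l hl using hex
  obtain ⟨ψ, hψ⟩ := exists_hom_of_small (M := F.sheafOf T') (N := N) P
    (fun U V h ⟨U', b, hb, h'⟩ => ⟨U', b, hb, h.trans h'⟩) hcov l (by
      intro W V h hW hV s
      obtain ⟨U, b, hb, hU⟩ := hW
      obtain ⟨c, hc⟩ := (hb.bijective (incLE hU ≫ preim f U)).2 s
      rw [← hc, map_sum, map_sum, map_sum, map_sum]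
      refine Finset.sum_congr rfl fun k _ => ?_
      rw [Scheme.Modules.map_smul, _root_.map_smul, _root_.map_smul, Scheme.Modules.map_smul, ← restrTo_restr,
        map_restrTo, hl, hl, map_restrTo])
  refine ⟨ψ, ?_, fun ψ' hψ' => ?_⟩
  · refine Scheme.Modules.hom_ext _ _ fun U => ?_
    ext s
    refine section_ext N (U := f.left ⁻¹ᵁ U) _ _ fun y hy => ?_
    obtain ⟨W, hyW, hW⟩ := hcov y
    obtain ⟨U', b, hb, hU'⟩ := hW
    have hP : P (f.left ⁻¹ᵁ U ⊓ W) := ⟨U', b, hb, inf_le_right.trans hU'⟩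
    refine ⟨f.left ⁻¹ᵁ U ⊓ W, inf_le_left, ⟨hy, hyW⟩, ?_⟩
    refine (F.restrTo_comp (F.restr f) ψ inf_le_left s).trans ?_
    rw [hψ _ hP, hl]
    rfl
  · refine Scheme.Modules.hom_ext _ _ fun W => ?_
    ext s
    refine section_ext N _ _ fun y hy => ?_
    obtain ⟨W', hyW, U', b, hb, hU'⟩ := hcov y
    have hP : P (W ⊓ W') := ⟨U', b, hb, inf_le_right.trans hU'⟩
    refine ⟨W ⊓ W', inf_le_left, ⟨hy, hyW⟩, ?_⟩
    rw [← app_naturality, ← app_naturality, hψ _ hP]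
    let l' : Γ(F.sheafOf T', W ⊓ W') →ₗ[Γ(T'.left, W ⊓ W')] Γ(N, W ⊓ W') :=
      { (ψ'.app (W ⊓ W')).hom with
        map_smul' := fun r x => Scheme.Modules.Hom.app_smul ψ' r x }
    have : l' = l _ hP := by
      refine linearMap_ext_of_basis hb (inf_le_right.trans hU') _ _ fun s => ?_
      rw [hl]
      exact (F.restrTo_comp (F.restr f) ψ' _ s).symm.trans (by rw [hψ'])
    exact DFunLike.congr_fun this _

end Extension

end BigModule

/-! ### Pullbacks and group actions -/

namespace BigModule

open TopologicalSpace Opposite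

variable {S : Scheme.{u}} (F : BigModule S)

section Pullback

variable {T'' T' T : Over S} (g : T'' ⟶ T') (f : T' ⟶ T)

/-- The comparison of the pullback along `f : T' ⟶ T` of the module on `T` defined by `F` with the
module on `T'` defined by `F`. -/
def comparison : (Scheme.Modules.pullback f.left).obj (F.sheafOf T) ⟶ F.sheafOf T' :=
  ((Scheme.Modules.pullbackPushforwardAdjunction f.left).homEquiv _ _).symm (F.restr f)

lemma homEquiv_comparison :
    (Scheme.Modules.pullbackPushforwardAdjunction f.left).homEquiv _ _ (F.comparison f) =
      F.restr f := Equiv.apply_symm_apply _ _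

/-- The module on `T'` defined by a locally free `F` has the universal property of the pullback. -/
lemma isIso_comparison {K : Type} [Fintype K] (hF : F.LocallyFreeOn K T) :
    IsIso (F.comparison f) := by
  obtain ⟨ψ, hψ, -⟩ := existsUnique_extension (f := f)
    ((Scheme.Modules.pullbackPushforwardAdjunction f.left).unit.app (F.sheafOf T)) hF
  refine ⟨ψ, ?_, ?_⟩
  · apply ((Scheme.Modules.pullbackPushforwardAdjunction f.left).homEquiv _ _).injective
    rw [Adjunction.homEquiv_naturality_right, homEquiv_comparison, hψ, Adjunction.homEquiv_id]
  · refine (existsUnique_extension (F.restr f) hF).unique ?_ ?_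
    · rw [Functor.map_comp, reassoc_of% hψ, ← Adjunction.homEquiv_unit, homEquiv_comparison]
    · rw [CategoryTheory.Functor.map_id, Category.comp_id]

lemma restr_comp :
    F.restr f ≫ (Scheme.Modules.pushforward f.left).map (F.restr g) ≫
      (Scheme.Modules.pushforwardComp g.left f.left).hom.app (F.sheafOf T'') =
    F.restr (g ≫ f) := by
  refine Scheme.Modules.hom_ext _ _ fun U => ?_
  ext v
  refine (F.map_comp (preim g (f.left ⁻¹ᵁ U)) (preim f U) v).symm.trans ?_
  exact congrArg (F.map · v) (preim_comp f g U).symm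

/-- The comparison morphisms are compatible with composition. The adjoint statement is `restr_comp`,
since the composition isomorphisms of pullbacks and of pushforwards are conjugate. -/
lemma pullbackComp_comparison :
    (Scheme.Modules.pullbackComp g.left f.left).hom.app (F.sheafOf T) ≫ F.comparison (g ≫ f) =
      (Scheme.Modules.pullback g.left).map (F.comparison f) ≫ F.comparison g := by
  let adjf := Scheme.Modules.pullbackPushforwardAdjunction f.left
  let adjg := Scheme.Modules.pullbackPushforwardAdjunction g.left
  let adj := Scheme.Modules.pullbackPushforwardAdjunction (g.left ≫ f.left)
  let c := Scheme.Modules.pullbackComp g.left f.left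
  set X := (Scheme.Modules.pullback g.left).map (F.comparison f) ≫ F.comparison g with hX
  have h1 : adj.homEquiv _ _ (c.inv.app (F.sheafOf T) ≫ X) = F.restr (g ≫ f) := by
    have h2 := unit_conjugateEquiv (adjf.comp adjg) adj c.inv (F.sheafOf T)
    rw [Scheme.Modules.conjugateEquiv_pullbackComp_inv] at h2
    rw [Adjunction.homEquiv_unit, Functor.map_comp, ← Category.assoc, ← h2, Category.assoc]
    have h3 := (Scheme.Modules.pushforwardComp g.left f.left).hom.naturality X
    refine (congrArg (_ ≫ ·) h3.symm).trans ?_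
    rw [← Category.assoc, ← Adjunction.homEquiv_unit, Adjunction.comp_homEquiv]
    have h4 : adjg.homEquiv _ _ X = F.comparison f ≫ F.restr g := by
      rw [hX, Adjunction.homEquiv_naturality_left, homEquiv_comparison]
    have h5 : adjf.homEquiv _ _ (F.comparison f ≫ F.restr g) =
        F.restr f ≫ (Scheme.Modules.pushforward f.left).map (F.restr g) := by
      rw [Adjunction.homEquiv_naturality_right, homEquiv_comparison]
    rw [← restr_comp, ← Category.assoc, ← h5, ← h4]
    rfl
  have h6 : c.inv.app (F.sheafOf T) ≫ X = F.comparison (g ≫ f) := by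
    apply (adj.homEquiv _ _).injective
    rw [h1]
    exact (F.homEquiv_comparison (g ≫ f)).symm
  rw [← h6]
  exact c.hom_inv_id_app_assoc _ _

lemma pullbackCongr_comparison {f f' : T' ⟶ T} (h : f = f') (h' : f.left = f'.left) :
    (Scheme.Modules.pullbackCongr h').hom.app (F.sheafOf T) ≫ F.comparison f' = F.comparison f := by
  subst h
  exact Category.id_comp _

end Pullback

section Base

variable (S) in
/-- The base scheme as a scheme over itself. -/
abbrev base : Over S := Over.mk (𝟙 S)

/-- The structure morphism of an `S`-scheme. -/
abbrev toBase (T : Over S) : T ⟶ base S := Over.homMk T.hom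

/-- The comparison of the pullback to `T` of the module on `S` defined by `F` with the module on `T`
defined by `F`. -/
def comparisonBase (T : Over S) :
    (Scheme.Modules.pullback T.hom).obj (F.sheafOf (base S)) ⟶ F.sheafOf T :=
  F.comparison (toBase T)

lemma pullbackIso_comparison {T' T : Over S} (f : T' ⟶ T) :
    (pullbackIso (F.sheafOf (base S)) f).hom ≫ F.comparisonBase T' =
      (Scheme.Modules.pullback f.left).map (F.comparisonBase T) ≫ F.comparison f := by
  refine Eq.trans ?_ (F.pullbackComp_comparison f (toBase T))
  refine (Category.assoc _ _ _).trans (congrArg (_ ≫ ·) ?_)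
  exact F.pullbackCongr_comparison (f := f ≫ toBase T) (f' := toBase T')
    (by ext1; exact Over.w f) (Over.w f)

/-- The comparison isomorphism between the pullback to `T` of the module on `S` defined by `F` and
the module on `T` defined by `F`. -/
def comparisonIso {K : Type} [Fintype K] (hF : F.LocallyFreeOn K (base S)) (T : Over S) :
    (Scheme.Modules.pullback T.hom).obj (F.sheafOf (base S)) ≅ F.sheafOf T :=
  @asIso _ _ _ _ (F.comparisonBase T) (F.isIso_comparison (toBase T) hF)

end Base

/-- A linear action of a group scheme on a sheaf of modules on the category of `S`-schemes. -/
structure Action (G : Over S) [GrpObj G] where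
  /-- the action of `T`-points -/
  act : ∀ T : Over S, (T ⟶ G) →* Module.End Γ(T.left, ⊤) (F.obj T)
  map_act : ∀ {T' T : Over S} (f : T' ⟶ T) (x : T ⟶ G) (v : F.obj T),
    F.map f (act T x v) = act T' (f ≫ x) (F.map f v)

namespace Action

variable {F} {G : Over S} [GrpObj G] (a : F.Action G)

/-- The action of a `T`-point of `G` on the `𝒪_T`-module defined by `F`. -/
def actHom {T : Over S} (x : T ⟶ G) : F.sheafOf T ⟶ F.sheafOf T :=
  modulesHomMk
    { app := fun U => AddCommGrpCat.ofHom (a.act _ (inc T U.unop ≫ x)).toAddMonoidHom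
      naturality := fun U V i => by
        ext v
        refine Eq.trans ?_ (a.map_act (incLE (leOfHom i.unop)) (inc T U.unop ≫ x) v).symm
        exact congrArg (fun y => a.act _ y _)
          (by rw [← Category.assoc]; exact congrArg (· ≫ x) (incLE_inc _).symm) }
    (fun U r v => _root_.map_smul (a.act _ (inc T U ≫ x)) _ _)

lemma actHom_app {T : Over S} (x : T ⟶ G) (U : T.left.Opens) (v : F.obj (opn T U)) :
    (a.actHom x).app U (F.ofObj v) = F.ofObj (a.act _ (inc T U ≫ x) v) := rfl

/-- The action of `T`-points of `G` on the `𝒪_T`-module defined by `F`. -/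
def actEnd (T : Over S) : (T ⟶ G) →* End (F.sheafOf T) where
  toFun := a.actHom
  map_one' := by
    refine Scheme.Modules.hom_ext _ _ fun U => ?_
    ext v
    refine (a.actHom_app 1 U v).trans ?_
    rw [show inc T U ≫ (1 : T ⟶ G) = 1 from comp_one _, map_one]
    rfl
  map_mul' x y := by
    refine Scheme.Modules.hom_ext _ _ fun U => ?_
    ext v
    refine (a.actHom_app (x * y) U v).trans ?_
    rw [show inc T U ≫ (x * y) = (inc T U ≫ x) * (inc T U ≫ y) from comp_mul _ _ _, map_mul]
    rfl

lemma restr_actHom {T' T : Over S} (f : T' ⟶ T) (x : T ⟶ G) :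
    F.restr f ≫ (Scheme.Modules.pushforward f.left).map (a.actHom (f ≫ x)) =
      a.actHom x ≫ F.restr f := by
  refine Scheme.Modules.hom_ext _ _ fun U => ?_
  ext v
  refine Eq.trans ?_ (a.map_act (preim f U) (inc T U ≫ x) v).symm
  exact congrArg (fun y => a.act _ y _)
    (by rw [← Category.assoc, ← Category.assoc]; exact congrArg (· ≫ x) (preim_inc f U).symm)

lemma comparison_actHom {T' T : Over S} (f : T' ⟶ T) (x : T ⟶ G) :
    F.comparison f ≫ a.actHom (f ≫ x) =
      (Scheme.Modules.pullback f.left).map (a.actHom x) ≫ F.comparison f := by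
  apply ((Scheme.Modules.pullbackPushforwardAdjunction f.left).homEquiv _ _).injective
  rw [Adjunction.homEquiv_naturality_right, Adjunction.homEquiv_naturality_left,
    homEquiv_comparison, restr_actHom]

section Representation

variable {K : Type} [Fintype K]

/-- The action of a `T`-point of `G` on the pullback to `T` of the module on `S` defined by `F`. -/
def pullbackHom (hF : F.LocallyFreeOn K (base S)) {T : Over S} (x : T ⟶ G) :
    (Scheme.Modules.pullback T.hom).obj (F.sheafOf (base S)) ⟶
      (Scheme.Modules.pullback T.hom).obj (F.sheafOf (base S)) :=
  (F.comparisonIso hF T).hom ≫ a.actHom x ≫ (F.comparisonIso hF T).inv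

lemma pullbackHom_comparison (hF : F.LocallyFreeOn K (base S)) {T : Over S} (x : T ⟶ G) :
    a.pullbackHom hF x ≫ F.comparisonBase T = F.comparisonBase T ≫ a.actHom x := by
  change ((F.comparisonIso hF T).hom ≫ a.actHom x ≫ (F.comparisonIso hF T).inv) ≫
    (F.comparisonIso hF T).hom = (F.comparisonIso hF T).hom ≫ a.actHom x
  rw [Category.assoc, Category.assoc, Iso.inv_hom_id, Category.comp_id]

lemma pullbackIso_pullbackHom (hF : F.LocallyFreeOn K (base S)) {T' T : Over S} (f : T' ⟶ T)
    (x : T ⟶ G) :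
    (pullbackIso (F.sheafOf (base S)) f).hom ≫ a.pullbackHom hF (f ≫ x) =
      (Scheme.Modules.pullback f.left).map (a.pullbackHom hF x) ≫
        (pullbackIso (F.sheafOf (base S)) f).hom := by
  rw [← cancel_mono (F.comparisonIso hF T').hom]
  change (_ ≫ _) ≫ F.comparisonBase T' = (_ ≫ _) ≫ F.comparisonBase T'
  rw [Category.assoc, Category.assoc, pullbackHom_comparison, pullbackIso_comparison,
    reassoc_of% F.pullbackIso_comparison f,
    comparison_actHom, ← Functor.map_comp_assoc, ← Functor.map_comp_assoc, pullbackHom_comparison]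

lemma pullbackHom_eq_smul (hF : F.LocallyFreeOn K (base S)) {T : Over S} (x : T ⟶ G)
    (c : Γ(T.left, ⊤)) (hx : ∀ (U : T.left.Opens) (v : F.obj (opn T U)),
      a.act _ (inc T U ≫ x) v = res (inc T U) c • v) (U : T.left.Opens)
    (v : Γ((Scheme.Modules.pullback T.hom).obj (F.sheafOf (base S)), U)) :
    (a.pullbackHom hF x).app U v = T.left.presheaf.map (homOfLE (le_top : U ≤ ⊤)).op c • v := by
  have hinj : Function.Injective ((F.comparisonIso hF T).hom.app U) :=
    (ConcreteCategory.bijective_of_isIso ((F.comparisonIso hF T).hom.app U)).1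
  apply hinj
  have h1 := congrArg (fun α => Scheme.Modules.Hom.app α U v) (a.pullbackHom_comparison hF x)
  refine h1.trans ?_
  rw [Scheme.Modules.Hom.app_smul]
  refine (congrArg F.ofObj (hx U _)).trans ((F.ofObj_smul _ _).trans ?_)
  exact congrArg (· • _) (toSection_res_inc U c)

/-- The action of `T`-points of `G` on the pullback to `T` of the module on `S` defined by `F`. -/
def autHom (hF : F.LocallyFreeOn K (base S)) (T : Over S) :
    (T ⟶ G) →* Aut ((Scheme.Modules.pullback T.hom).obj (F.sheafOf (base S))) :=
  (F.comparisonIso hF T).symm.conjAut.toMonoidHom.comp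
    ((Aut.unitsEndEquivAut _).toMonoidHom.comp (a.actEnd T).toHomUnits)

end Representation

end Action
end BigModule

/-! ### Finite free sheaves of modules -/

section Free

open Opposite

universe v₁ u₁

variable {C : Type u₁} [Category.{v₁} C] {J : GrothendieckTopology C} {R : Sheaf J RingCat.{u}}

/-- The basis of `M(X)` defined by global sections of `M` which form a basis over every object. -/
def sectionsBasis {M : SheafOfModules.{u} R} {I : Type u} [Fintype I] (b : I → M.sections)
    (hb : ∀ X : Cᵒᵖ, Function.Bijective fun c : I → R.obj.obj X => ∑ i, c i • (b i).eval X)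
    (X : Cᵒᵖ) : Module.Basis I (R.obj.obj X) (M.val.obj X) :=
  .ofEquivFun (LinearEquiv.ofBijective
    (Fintype.linearCombination (R.obj.obj X) fun i => (b i).eval X) (hb X)).symm

lemma sectionsBasis_apply {M : SheafOfModules.{u} R} {I : Type u} [Fintype I] (b : I → M.sections)
    (hb : ∀ X : Cᵒᵖ, Function.Bijective fun c : I → R.obj.obj X => ∑ i, c i • (b i).eval X)
    (X : Cᵒᵖ) (i : I) : sectionsBasis b hb X i = (b i).eval X := by
  classical
  rw [sectionsBasis, Module.Basis.coe_ofEquivFun, LinearEquiv.symm_symm]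
  refine (Fintype.linearCombination_apply_single _ _ _ _).trans ?_
  rw [one_smul]

lemma hom_ext_of_basis {M N : SheafOfModules.{u} R} {I : Type u} [Fintype I] (b : I → M.sections)
    (hb : ∀ X : Cᵒᵖ, Function.Bijective fun c : I → R.obj.obj X => ∑ i, c i • (b i).eval X)
    (p q : M ⟶ N)
    (h : ∀ i, SheafOfModules.sectionsMap p (b i) = SheafOfModules.sectionsMap q (b i)) :
    p = q := by
  refine SheafOfModules.hom_ext (PresheafOfModules.hom_ext fun X => ?_)
  refine ModuleCat.hom_ext ((sectionsBasis b hb X).ext fun i => ?_)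
  rw [sectionsBasis_apply]
  exact congrArg (fun s => PresheafOfModules.sections.eval s X) (h i)

lemma exists_hom_of_basis {M N : SheafOfModules.{u} R} {I : Type u} [Fintype I]
    (b : I → M.sections)
    (hb : ∀ X : Cᵒᵖ, Function.Bijective fun c : I → R.obj.obj X => ∑ i, c i • (b i).eval X)
    (d : I → N.sections) :
    ∃ p : M ⟶ N, ∀ i, SheafOfModules.sectionsMap p (b i) = d i := by
  let l : ∀ X : Cᵒᵖ, M.val.obj X →ₗ[R.obj.obj X] N.val.obj X := fun X =>
    (sectionsBasis b hb X).constr ℤ fun i => (d i).eval X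
  have hl : ∀ X i, l X ((b i).eval X) = (d i).eval X := fun X i => by
    rw [← sectionsBasis_apply b hb, Module.Basis.constr_basis]
  refine ⟨⟨PresheafOfModules.homMk
    { app := fun X => AddCommGrpCat.ofHom (l X).toAddMonoidHom
      naturality := fun X Y f => by
        ext v
        obtain ⟨c, rfl⟩ := (hb X).2 v
        change l Y (M.val.map f (∑ i, c i • (b i).eval X)) =
          N.val.map f (l X (∑ i, c i • (b i).eval X))
        refine (congrArg (l Y) (map_sum (M.val.map f).hom _ _)).trans ?_
        rw [map_sum, map_sum]
        refine (map_sum (l Y) _ _).trans (Fintype.sum_congr _ _ fun i => ?_)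
        have h : l X (c i • (b i).eval X) = c i • (d i).eval X := by rw [map_smul, hl]
        refine Eq.trans ?_ ((congrArg (N.val.map f) h).trans (N.val.map_smul f (c i) _)).symm
        refine (congrArg (l Y) (M.val.map_smul f (c i) _)).trans ?_
        refine (map_smul (l Y) _ _).trans (congrArg (_ • ·) ?_)
        refine (congrArg (l Y) (PresheafOfModules.sections_property (b i) f)).trans ?_
        rw [hl]
        exact (PresheafOfModules.sections_property (d i) f).symm }
    fun X r v => map_smul (l X) r v⟩, fun i => ?_⟩
  refine PresheafOfModules.sections_ext _ _ fun X => ?_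
  exact hl X i

/-- A sheaf of modules with a finite basis is free. -/
lemma isIso_freeHomEquiv_symm [HasWeakSheafify J AddCommGrpCat.{u}]
    [J.WEqualsLocallyBijective AddCommGrpCat.{u}] (M : SheafOfModules.{u} R) {I : Type u} [Fintype I]
    (b : I → M.sections)
    (hb : ∀ X : Cᵒᵖ, Function.Bijective fun c : I → R.obj.obj X => ∑ i, c i • (b i).eval X) :
    IsIso (M.freeHomEquiv.symm b) := by
  obtain ⟨p, hp⟩ := exists_hom_of_basis b hb (SheafOfModules.freeSection (R := R))
  refine ⟨p, ?_, ?_⟩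
  · apply (SheafOfModules.freeHomEquiv _).injective
    funext i
    rw [SheafOfModules.freeHomEquiv_comp_apply, Equiv.apply_symm_apply, hp]
  · refine hom_ext_of_basis b hb _ _ fun i => ?_
    rw [SheafOfModules.sectionsMap_comp, hp,
      SheafOfModules.sectionsMap_freeHomEquiv_symm_freeSection, SheafOfModules.sectionsMap_id]

end Free

/-! ### Representations from sheaves on the category of `S`-schemes -/

namespace BigModule

open TopologicalSpace Opposite

variable {S : Scheme.{u}} {F : BigModule S} {K : Type} [Fintype K]

lemma LocallyFreeOn.isQuasicoherent (hF : F.LocallyFreeOn K (base S)) :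
    SheafOfModules.IsQuasicoherent.{u} (F.sheafOf (base S)) := by
  choose U hU b hb using hF
  let M : SheafOfModules S.ringCatSheaf := F.sheafOf (base S)
  let s : ∀ x : S, ULift.{u} K → (M.over (U x)).sections := fun x k =>
    PresheafOfModules.sectionsMk
      (fun V => (F.ofObj (F.map (incLE (leOfHom V.unop.hom)) (b x k.down)) :
        Γ(F.sheafOf (base S), V.unop.left)))
      (fun V W f => by
        refine (F.map_comp _ _ _).symm.trans ?_
        exact congrArg (F.map · _) (incLE_comp_incLE _ _))
  have hs : ∀ x, IsIso ((M.over (U x)).freeHomEquiv.symm (s x)) := fun x => by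
    refine isIso_freeHomEquiv_symm _ _ fun V => ?_
    have h := (hb x).bijective (incLE (leOfHom V.unop.hom) : opn (base S) V.unop.left ⟶ _)
    have h' := h.comp (Equiv.arrowCongr Equiv.ulift.{u} (Equiv.refl _)).bijective
    convert! h' using 1
    funext c
    exact Fintype.sum_equiv Equiv.ulift _ _ fun _ => rfl
  let q : M.LocalGeneratorsData :=
    { I := S
      X := U
      coversTop := by
        rw [Opens.coversTop_iff, IsOpenCover, eq_top_iff]
        exact fun x _ => Opens.mem_iSup.mpr ⟨x, hU x⟩
      generators := fun x =>
        { I := ULift K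
          s := s x
          epi := by have := hs x; infer_instance } }
  have : q.IsLocallyFreeData := SheafOfModules.LocalGeneratorsData.IsLocallyFreeData.mk (q := q) hs
  exact q.quasiCoherentData.isQuasicoherent

lemma LocallyFreeOn.isLocallyFreeOfRank (hF : F.LocallyFreeOn K (base S)) :
    IsLocallyFreeOfRank (F.sheafOf (base S)) (Fintype.card K) := by
  intro x
  obtain ⟨U, hU, b, hb⟩ := hF x
  let e : Fin (Fintype.card K) ≃ K := (Fintype.equivFin K).symm
  refine ⟨U, hU, fun i => F.ofObj (b (e i)), fun V h => ?_⟩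
  have h1 := hb.bijective (incLE h : opn (base S) V ⟶ _)
  have h' := h1.comp (Equiv.arrowCongr e (Equiv.refl _)).bijective
  convert! h' using 1
  funext c
  refine Eq.trans ?_ (e.sum_comp _)
  refine Finset.sum_congr rfl fun i _ => ?_
  congr 1
  exact congrArg c (e.symm_apply_apply i).symm

namespace Action

variable {G : Over S} [GrpObj G]

/-- The representation on a quasi-coherent sheaf which is defined by a linear action on a locally
free sheaf of modules on the category of `S`-schemes. -/
def representation (a : F.Action G) (hF : F.LocallyFreeOn K (base S)) : Representation G where
  F := F.sheafOf (base S)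
  quasicoherent := hF.isQuasicoherent
  ρ := a.autHom hF
  natural := a.pullbackIso_pullbackHom hF

/-- A linear action of weight one on a sheaf of modules on the category of `S`-schemes which has
bases of `#D` elements locally on `S` defines a Schrödinger representation. -/
lemma isLinear {X : SymplecticModule S} {𝒢 : ThetaGroup X} (a : F.Action 𝒢.G) {D : ModuleType}
    (hF : F.LocallyFreeOn D.K (base S))
    (ha : ∀ (T : Over S) (c : GmPoints T) (v : F.obj T),
      a.act T (𝒢.incl T c) v = (c : Γ(T.left, ⊤)) • v) : 𝒢.IsLinear D := by
  refine ⟨a.representation hF, fun T c U v => ?_, ?_⟩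
  · refine a.pullbackHom_eq_smul hF (𝒢.incl T c) c (fun U v => ?_) U v
    rw [← 𝒢.incl_natural, ha]
    rfl
  · rw [← D.card_K]
    exact hF.isLocallyFreeOfRank

end Action

end BigModule

/-! ### Twisted forms of free modules -/

open CartesianMonoidalCategory SemiCartesianMonoidalCategory Matrix

section Vectors

variable {S : Scheme.{u}} {P : Over S} {K : Type}

/-- The vector of functions on `W` which is obtained from a vector of functions on `P × T`, a point
of `P` and a point of `T`. -/
def ev {W T : Over S} (v : K → Γ((P ⊗ T).left, ⊤)) (p : W ⟶ P) (t : W ⟶ T) : K → Γ(W.left, ⊤) :=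
  fun k => res (lift p t) (v k)

lemma res_ev {W' W T : Over S} (f : W' ⟶ W) (v : K → Γ((P ⊗ T).left, ⊤)) (p : W ⟶ P) (t : W ⟶ T) :
    res f ∘ ev v p t = ev v (f ≫ p) (f ≫ t) := by
  funext k
  simp only [ev, Function.comp_apply, res_res, comp_lift]

lemma ev_fst_snd {T : Over S} (v : K → Γ((P ⊗ T).left, ⊤)) : ev v (fst P T) (snd P T) = v := by
  funext k
  simp [ev]

lemma vec_eq_of_locally {T : Over S} {v w : K → Γ(T.left, ⊤)}
    (h : ∀ t : T.left, ∃ U : T.left.Opens, t ∈ U ∧ res (inc T U) ∘ v = res (inc T U) ∘ w) :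
    v = w := by
  funext k
  refine res_eq_of_locally _ _ fun t => ?_
  obtain ⟨U, ht, hU⟩ := h t
  exact ⟨U, ht, congrFun hU k⟩

lemma res_comp_mulVec [Fintype K] {W' W : Over S} (f : W' ⟶ W) (A : Matrix K K Γ(W.left, ⊤))
    (v : K → Γ(W.left, ⊤)) : res f ∘ (A *ᵥ v) = A.map (res f) *ᵥ (res f ∘ v) :=
  funext fun k => RingHom.map_mulVec (res f) A v k

end Vectors

/-- A descent datum for the free module with basis `K` along `P → S`: transition matrices between
any two points of `P` with values in the same `S`-scheme, which satisfy the cocycle condition. -/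
structure Cocycle {S : Scheme.{u}} (P : Over S) (K : Type) [Fintype K] [DecidableEq K] where
  /-- the transition matrix from `q` to `p` -/
  g : ∀ {W : Over S} (_ _ : W ⟶ P), Matrix K K Γ(W.left, ⊤)
  map_g : ∀ {W' W : Over S} (f : W' ⟶ W) (p q : W ⟶ P),
    (g p q).map (res f) = g (f ≫ p) (f ≫ q)
  g_self : ∀ {W : Over S} (p : W ⟶ P), g p p = 1
  g_mul : ∀ {W : Over S} (p q r : W ⟶ P), g p q * g q r = g p r

namespace Cocycle

variable {S : Scheme.{u}} {P : Over S} {K : Type} [Fintype K] [DecidableEq K] (c : Cocycle P K)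

/-- The sections over `T` of the twisted form of the free module defined by a descent datum. -/
def sections (T : Over S) : AddSubgroup (K → Γ((P ⊗ T).left, ⊤)) where
  carrier := {v | ∀ (W : Over S) (p q : W ⟶ P) (t : W ⟶ T), ev v p t = c.g p q *ᵥ ev v q t}
  zero_mem' W p q t := by
    have h : ∀ p : W ⟶ P, ev (0 : K → Γ((P ⊗ T).left, ⊤)) p t = 0 := fun p =>
      funext fun _ => map_zero _
    rw [h, h, Matrix.mulVec_zero]
  add_mem' {v w} hv hw W p q t := by
    have h : ∀ p : W ⟶ P, ev (v + w) p t = ev v p t + ev w p t := fun p =>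
      funext fun _ => map_add _ _ _
    rw [h, h, Matrix.mulVec_add, hv, hw]
  neg_mem' {v} hv W p q t := by
    have h : ∀ p : W ⟶ P, ev (-v) p t = - ev v p t := fun p => funext fun k => map_neg _ _
    rw [h, h, Matrix.mulVec_neg, hv]

variable {c} in
lemma ev_eq {T : Over S} (v : c.sections T) {W : Over S} (p q : W ⟶ P) (t : W ⟶ T) :
    ev v.1 p t = c.g p q *ᵥ ev v.1 q t := v.2 W p q t

/-- Sections of a twisted form correspond to natural families of vectors. -/
def ofFamily {T : Over S} (φ : ∀ (W : Over S) (_ : W ⟶ P) (_ : W ⟶ T), K → Γ(W.left, ⊤))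
    (hφ : ∀ {W' W : Over S} (f : W' ⟶ W) (p : W ⟶ P) (t : W ⟶ T),
      res f ∘ φ W p t = φ W' (f ≫ p) (f ≫ t))
    (h : ∀ (W : Over S) (p q : W ⟶ P) (t : W ⟶ T), φ W p t = c.g p q *ᵥ φ W q t) :
    c.sections T :=
  ⟨φ _ (fst P T) (snd P T), fun W p q t => by
    have h' : ∀ p : W ⟶ P, ev (φ _ (fst P T) (snd P T)) p t = φ W p t := fun p => by
      refine (hφ (lift p t) (fst P T) (snd P T)).trans ?_
      rw [lift_fst, lift_snd]
    rw [h', h']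
    exact h W p q t⟩

lemma ev_ofFamily {T : Over S} (φ : ∀ (W : Over S) (_ : W ⟶ P) (_ : W ⟶ T), K → Γ(W.left, ⊤)) (hφ h)
    {W : Over S} (p : W ⟶ P) (t : W ⟶ T) : ev (c.ofFamily φ hφ h).1 p t = φ W p t := by
  refine (hφ (lift p t) (fst P T) (snd P T)).trans ?_
  rw [lift_fst, lift_snd]

variable {c} in
lemma sections_ext {T : Over S} {v w : c.sections T}
    (h : ∀ (W : Over S) (p : W ⟶ P) (t : W ⟶ T), ev v.1 p t = ev w.1 p t) : v = w :=
  Subtype.ext (by simpa only [ev_fst_snd] using h _ (fst P T) (snd P T))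

instance (T : Over S) : SMul Γ(T.left, ⊤) (c.sections T) where
  smul a v := c.ofFamily (fun _ p t => res t a • ev v.1 p t)
    (fun f p t => by
      rw [← res_ev, ← res_res]
      exact funext fun k => map_mul _ _ _)
    (fun W p q t => by rw [Matrix.mulVec_smul, ← ev_eq])

lemma ev_smul {T : Over S} (a : Γ(T.left, ⊤)) (v : c.sections T) {W : Over S} (p : W ⟶ P)
    (t : W ⟶ T) : ev (a • v).1 p t = res t a • ev v.1 p t := c.ev_ofFamily _ _ _ _ _

lemma ev_add {T : Over S} (v w : c.sections T) {W : Over S} (p : W ⟶ P) (t : W ⟶ T) :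
    ev (v + w).1 p t = ev v.1 p t + ev w.1 p t := funext fun _ => map_add _ _ _

lemma ev_zero {T : Over S} {W : Over S} (p : W ⟶ P) (t : W ⟶ T) :
    ev (0 : c.sections T).1 p t = 0 := funext fun _ => map_zero _

instance (T : Over S) : Module Γ(T.left, ⊤) (c.sections T) where
  one_smul v := sections_ext fun W p t => by rw [ev_smul, map_one, one_smul]
  mul_smul a b v := sections_ext fun W p t => by rw [ev_smul, ev_smul, ev_smul, map_mul, mul_smul]
  smul_zero a := sections_ext fun W p t => by rw [ev_smul, ev_zero, smul_zero]
  smul_add a v w := sections_ext fun W p t => by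
    rw [ev_smul, ev_add, ev_add, ev_smul, ev_smul, smul_add]
  add_smul a b v := sections_ext fun W p t => by
    rw [ev_smul, ev_add, ev_smul, ev_smul, map_add, add_smul]
  zero_smul v := sections_ext fun W p t => by rw [ev_smul, ev_zero, map_zero, zero_smul]

/-- The restriction map of the twisted form. -/
def restrict {T' T : Over S} (f : T' ⟶ T) : c.sections T →+ c.sections T' where
  toFun v := c.ofFamily (fun _ p t => ev v.1 p (t ≫ f))
    (fun h p t => by rw [res_ev, Category.assoc]) (fun W p q t => ev_eq v p q (t ≫ f))
  map_zero' := sections_ext fun W p t => by rw [ev_ofFamily, ev_zero, ev_zero]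
  map_add' v w := sections_ext fun W p t => by rw [ev_ofFamily, ev_add, ev_add, ev_ofFamily, ev_ofFamily]

lemma ev_restrict {T' T : Over S} (f : T' ⟶ T) (v : c.sections T) {W : Over S} (p : W ⟶ P)
    (t : W ⟶ T') : ev (c.restrict f v).1 p t = ev v.1 p (t ≫ f) := c.ev_ofFamily _ _ _ _ _

lemma eq_of_locally {T : Over S} (v w : c.sections T)
    (h : ∀ t : T.left, ∃ U : T.left.Opens, t ∈ U ∧
      c.restrict (inc T U) v = c.restrict (inc T U) w) : v = w := by
  refine sections_ext fun W p t => vec_eq_of_locally fun z => ?_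
  obtain ⟨U, hU, h⟩ := h (t.left z)
  refine ⟨t.left ⁻¹ᵁ U, hU, ?_⟩
  rw [res_ev, res_ev, ← preim_inc, ← ev_restrict, ← ev_restrict, h]

lemma exists_glue {T : Over S} {I : Type u} (U : I → T.left.Opens) (hU : ∀ t, ∃ i, t ∈ U i)
    (v : ∀ i, c.sections (opn T (U i)))
    (hv : ∀ (i j : I) (W : Over S) (f : W ⟶ opn T (U i)) (g : W ⟶ opn T (U j)),
      f ≫ inc T (U i) = g ≫ inc T (U j) → c.restrict f (v i) = c.restrict g (v j)) :
    ∃ w : c.sections T, ∀ i, c.restrict (inc T (U i)) w = v i := by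
  let s : P ⊗ T ⟶ T := snd P T
  have hglue : ∀ k, ∃ a : Γ((P ⊗ T).left, ⊤), ∀ i, res (inc (P ⊗ T) (s.left ⁻¹ᵁ U i)) a =
      ev (v i).1 (inc (P ⊗ T) (s.left ⁻¹ᵁ U i) ≫ fst P T) (preim s (U i)) k := fun k => by
    refine exists_res_eq (fun i => s.left ⁻¹ᵁ U i) (fun y => hU (s.left y)) _
      fun i j W f g hfg => ?_
    have h := hv i j W (f ≫ preim s (U i)) (g ≫ preim s (U j)) (by
      rw [Category.assoc, Category.assoc, preim_inc, preim_inc, reassoc_of% hfg])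
    have h' := congrArg (fun u : c.sections W =>
      ev u.1 (f ≫ inc (P ⊗ T) (s.left ⁻¹ᵁ U i) ≫ fst P T) (𝟙 W) k) h
    simp only [ev_restrict, Category.id_comp] at h'
    refine (congrFun (res_ev f (v i).1 _ _) k).trans (h'.trans ?_)
    refine Eq.trans ?_ (congrFun (res_ev g (v j).1 _ _) k).symm
    rw [reassoc_of% hfg]
  choose w hw using hglue
  have hw' : ∀ i (W : Over S) (p : W ⟶ P) (t : W ⟶ opn T (U i)),
      ev w p (t ≫ inc T (U i)) = ev (v i).1 p t := fun i W p t => by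
    have hmem : ∀ z, (lift p (t ≫ inc T (U i))).left z ∈ s.left ⁻¹ᵁ U i := fun z => by
      have h : (lift p (t ≫ inc T (U i)) ≫ s).left z ∈ U i := by
        rw [lift_snd]
        exact inc_apply_mem T (U i) (t.left z)
      exact h
    let l := opnLift (s.left ⁻¹ᵁ U i) (lift p (t ≫ inc T (U i))) hmem
    have h1 : l ≫ inc (P ⊗ T) (s.left ⁻¹ᵁ U i) = lift p (t ≫ inc T (U i)) := opnLift_inc _ _ _
    have h2 : l ≫ inc (P ⊗ T) (s.left ⁻¹ᵁ U i) ≫ fst P T = p := by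
      rw [reassoc_of% h1, lift_fst]
    have h3 : l ≫ preim s (U i) = t := by
      rw [← cancel_mono (inc T (U i)), Category.assoc, preim_inc, reassoc_of% h1, lift_snd]
    funext k
    have h4 := congrArg (res l) (hw k i)
    rw [res_res, h1] at h4
    refine h4.trans ((congrFun (res_ev l (v i).1 _ _) k).trans ?_)
    rw [h2, h3]
  refine ⟨⟨w, fun W p q t => vec_eq_of_locally fun z => ?_⟩, fun i => sections_ext fun W p t => ?_⟩
  · obtain ⟨i, hi⟩ := hU (t.left z)
    refine ⟨t.left ⁻¹ᵁ U i, hi, ?_⟩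
    rw [res_comp_mulVec, res_ev, res_ev, c.map_g, ← preim_inc, hw', hw', ← ev_eq]
  · rw [ev_restrict]
    exact hw' i W p t

/-- The twisted form of the free module defined by a descent datum. -/
def bigModule : BigModule S where
  obj T := c.sections T
  map f := c.restrict f
  map_smul f a v := sections_ext fun W p t => by
    rw [ev_restrict, ev_smul, ev_smul, ev_restrict, res_res]
  map_id T v := sections_ext fun W p t => by rw [ev_restrict, Category.comp_id]
  map_comp g f v := sections_ext fun W p t => by
    rw [ev_restrict, ev_restrict, ev_restrict, Category.assoc]
  eq_of_locally := c.eq_of_locally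
  exists_glue := c.exists_glue

end Cocycle

/-! ### The Heisenberg action -/

namespace Frame

variable {S : Scheme.{u}} {X : SymplecticModule S} {D : ModuleType} {P : Over S}
  (hX : X.HasType D) (hD : Odd D.card) (p₀ : Frame X D P)

/-- The normalized intertwiners between the pullbacks of a frame form a descent datum. -/
def cocycle : Cocycle P D.K where
  g p q := trans hX hD (p₀.pull p) (p₀.pull q)
  map_g f p q := by rw [← trans_pull, pull_pull, pull_pull]
  g_self p := trans_self hX hD _
  g_mul p q r := trans_mul_trans hX hD _ _ _

/-- The Heisenberg matrices act on the twisted form of the free module defined by the normalized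
intertwiners. -/
def act {T : Over S} (x : StdTheta X D.card T) (v : (p₀.cocycle hX hD).sections T) :
    (p₀.cocycle hX hD).sections T :=
  Cocycle.ofFamily _ (fun _ p t => res t (x.fst : Γ(T.left, ⊤)) •
      ((p₀.pull p).W (t ≫ x.snd) *ᵥ ev v.1 p t))
    (fun f p t => by
      rw [← res_ev, ← res_res, ← pull_pull, Category.assoc, W_comp hX,
        ← res_comp_mulVec]
      exact funext fun k => map_mul _ _ _)
    (fun W p q t => by
      rw [Matrix.mulVec_smul, Matrix.mulVec_mulVec, Cocycle.ev_eq v p q, Matrix.mulVec_mulVec]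
      congr 2
      exact W_mul_trans hX hD _ _ _)

lemma ev_act {T : Over S} (x : StdTheta X D.card T) (v : (p₀.cocycle hX hD).sections T)
    {W : Over S} (p : W ⟶ P) (t : W ⟶ T) :
    ev (p₀.act hX hD x v).1 p t = res t (x.fst : Γ(T.left, ⊤)) •
      ((p₀.pull p).W (t ≫ x.snd) *ᵥ ev v.1 p t) :=
  Cocycle.ev_ofFamily _ _ _ _ _ _

/-- The action of the standard theta group by Heisenberg matrices. -/
def actHom (T : Over S) :
    StdTheta X D.card T →* Module.End Γ(T.left, ⊤) ((p₀.cocycle hX hD).sections T) where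
  toFun x :=
    { toFun := p₀.act hX hD x
      map_add' := fun v w => Cocycle.sections_ext fun W p t => by
        rw [Cocycle.ev_add, ev_act, ev_act, ev_act, Cocycle.ev_add, Matrix.mulVec_add, smul_add]
      map_smul' := fun a v => Cocycle.sections_ext fun W p t => by
        rw [RingHom.id_apply, Cocycle.ev_smul, ev_act, ev_act, Cocycle.ev_smul, Matrix.mulVec_smul,
          smul_comm] }
  map_one' := LinearMap.ext fun v => Cocycle.sections_ext fun W p t => by
    refine (p₀.ev_act hX hD _ _ _ _).trans ?_
    rw [StdTheta.one_fst, StdTheta.one_snd, Units.val_one, map_one, one_smul, MonObj.comp_one,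
      W_one hX, Matrix.one_mulVec]
    rfl
  map_mul' x y := LinearMap.ext fun v => Cocycle.sections_ext fun W p t => by
    refine (p₀.ev_act hX hD _ _ _ _).trans ?_
    refine Eq.trans ?_ (p₀.ev_act hX hD x _ p t).symm
    refine Eq.trans ?_ (congrArg (fun w => res t (x.fst : Γ(T.left, ⊤)) •
      ((p₀.pull p).W (t ≫ x.snd) *ᵥ w)) (p₀.ev_act hX hD y v p t)).symm
    rw [Matrix.mulVec_smul, Matrix.mulVec_mulVec, W_mul hX hD, StdTheta.mul_fst, StdTheta.mul_snd,
      MonObj.comp_mul, X.half_natural, Matrix.smul_mulVec, smul_smul, smul_smul,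
      Units.val_mul, Units.val_mul, map_mul, map_mul]
    rfl

end Frame

/-- The Heisenberg action of a symmetrized theta group on the twisted form of the free module
defined by the normalized intertwiners. -/
def SymmetrizedThetaGroup.action {S : Scheme.{u}} {X : SymplecticModule S} {D : ModuleType}
    (A : SymmetrizedThetaGroup X) (hX : X.HasType D) (hD : Odd D.card) {P : Over S}
    (p₀ : Frame X D P) : (p₀.cocycle hX hD).bigModule.Action A.theta.G where
  act T := (p₀.actHom hX hD T).comp (A.pointsEquiv hX hD T).symm.toMonoidHom
  map_act {T' T} f x v := Cocycle.sections_ext fun W p t => by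
    refine (Cocycle.ev_restrict _ f _ p t).trans ?_
    refine (p₀.ev_act hX hD _ _ _ _).trans ?_
    refine Eq.trans ?_ (p₀.ev_act hX hD ((A.pointsEquiv hX hD T').symm (f ≫ x))
      (Cocycle.restrict _ f v) p t).symm
    rw [A.pointsEquiv_symm_comp]
    refine Eq.trans ?_ (congrArg (fun w => res t _ • (Frame.W _ _ *ᵥ w))
      (Cocycle.ev_restrict _ f v p t)).symm
    simp only [StdTheta.map, GmPoints.val_map, res_res, Category.assoc]
    rfl

lemma SymmetrizedThetaGroup.action_incl {S : Scheme.{u}} {X : SymplecticModule S} {D : ModuleType}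
    (A : SymmetrizedThetaGroup X) (hX : X.HasType D) (hD : Odd D.card) {P : Over S}
    (p₀ : Frame X D P) (T : Over S) (a : GmPoints T) (v : (p₀.cocycle hX hD).bigModule.obj T) :
    (A.action hX hD p₀).act T (A.theta.incl T a) v = (a : Γ(T.left, ⊤)) • v :=
  Cocycle.sections_ext fun W p t => by
    refine (p₀.ev_act hX hD _ _ _ _).trans ?_
    refine Eq.trans ?_ (Cocycle.ev_smul _ _ _ p t).symm
    have h : (A.pointsEquiv hX hD T).symm.toMonoidHom (A.theta.incl T a) = ⟨a, 1⟩ :=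
      A.pointsEquiv_symm_incl hX hD a
    rw [h, MonObj.comp_one, Frame.W_one hX, Matrix.one_mulVec]

/-! ### Descent of free modules along flat ring homomorphisms -/

section FlatDescent

open TensorProduct Matrix Algebra.TensorProduct

variable {R B : Type u} [CommRing R] [CommRing B] [Algebra R B] {K : Type} [Fintype K]
  [DecidableEq K] (G : Matrix K K (B ⊗[R] B))

/-- The vectors over `B` which satisfy the descent condition given by a matrix `G` over `B ⊗ B`. -/
def descended : Submodule R (K → B) :=
  LinearMap.eqLocus
    (LinearMap.pi fun k => (includeLeft (R := R) (S := R) (A := B) (B := B)).toLinearMap ∘ₗ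
      LinearMap.proj k)
    (LinearMap.pi fun k => ∑ l, LinearMap.mulLeft R (G k l) ∘ₗ
      (includeRight (R := R) (A := B) (B := B)).toLinearMap ∘ₗ LinearMap.proj l)

omit [DecidableEq K] in
lemma mem_descended_iff (v : K → B) : v ∈ descended G ↔
    (fun k => v k ⊗ₜ[R] (1 : B)) = G *ᵥ fun k => (1 : B) ⊗ₜ[R] v k := by
  rw [descended, LinearMap.mem_eqLocus, funext_iff, funext_iff]
  refine forall_congr' fun k => ?_
  simp [Matrix.mulVec, dotProduct]

variable (hG : ∀ (A : Type u) [CommRing A] [Algebra R A] (φ₁ φ₂ φ₃ : B →ₐ[R] A),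
  G.map (productMap φ₁ φ₂) * G.map (productMap φ₂ φ₃) = G.map (productMap φ₁ φ₃))
  (hG₁ : G.map (productMap (AlgHom.id R B) (AlgHom.id R B)) = 1)

include hG hG₁ in
/-- Flat descent: if `G` is a cocycle then the descended vectors span `Bᴷ` over `B`. For a vector
`w` the vector `G(p, q) w(q)` in `B ⊗ Bᴷ`, where `q` and `p` refer to the two factors, satisfies the
descent condition in the second variable `p`. By flatness it comes from `B ⊗ E`, where `E` is the
module of descended vectors, and on the diagonal it restricts to `w`. -/
lemma span_descended [Module.Flat R B] :
    Submodule.span B (descended G : Set (K → B)) = ⊤ := by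
  rw [eq_top_iff]
  intro w _
  set f : (K → B) →ₗ[R] (K → B ⊗[R] B) := LinearMap.pi fun k =>
    (includeLeft (R := R) (S := R) (A := B) (B := B)).toLinearMap ∘ₗ LinearMap.proj k with hf
  set g : (K → B) →ₗ[R] (K → B ⊗[R] B) := LinearMap.pi fun k => ∑ l, LinearMap.mulLeft R (G k l) ∘ₗ
    (includeRight (R := R) (A := B) (B := B)).toLinearMap ∘ₗ LinearMap.proj l with hg
  -- the three coordinates of the triple tensor product
  let s₁ : B →ₐ[R] B ⊗[R] (B ⊗[R] B) := includeLeft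
  let s₂ : B →ₐ[R] B ⊗[R] (B ⊗[R] B) := includeRight.comp includeLeft
  let s₃ : B →ₐ[R] B ⊗[R] (B ⊗[R] B) := includeRight.comp includeRight
  have hf' : ∀ (x : B ⊗[R] (K → B)) (k : K),
      TensorProduct.piRight R R B (fun _ : K => B ⊗[R] B) (f.lTensor B x) k =
        productMap s₁ s₂ (TensorProduct.piRight R R B (fun _ : K => B) x k) := by
    intro x k
    induction x using TensorProduct.induction_on with
    | zero => simp
    | add x y hx hy => simp only [map_add, Pi.add_apply, hx, hy]
    | tmul b v => simp [f, s₁, s₂]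
  have hg' : ∀ (x : B ⊗[R] (K → B)) (k : K),
      TensorProduct.piRight R R B (fun _ : K => B ⊗[R] B) (g.lTensor B x) k =
        ∑ l, productMap s₂ s₃ (G k l) *
          productMap s₁ s₃ (TensorProduct.piRight R R B (fun _ : K => B) x l) := by
    intro x k
    have h23 : ∀ y : B ⊗[R] B, productMap s₂ s₃ y = 1 ⊗ₜ y := by
      intro y
      induction y using TensorProduct.induction_on with
      | zero => simp
      | add x y hx hy => rw [map_add, hx, hy, TensorProduct.tmul_add]
      | tmul a b => simp [s₂, s₃]
    induction x using TensorProduct.induction_on with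
    | zero => simp
    | add x y hx hy => simp only [map_add, Pi.add_apply, hx, hy, mul_add, Finset.sum_add_distrib]
    | tmul b v =>
      simp only [h23]
      simp [g, s₁, s₃, TensorProduct.tmul_sum]
  -- the vector `G(p, q) w(q)`, where `q` and `p` are the first and the second factor
  let U : B ⊗[R] (K → B) := (TensorProduct.piRight R R B (fun _ : K => B)).symm
    fun k => ∑ l, productMap includeRight includeLeft (G k l) * (w l ⊗ₜ[R] (1 : B))
  have hU : ∀ k, TensorProduct.piRight R R B (fun _ : K => B) U k =
      ∑ l, productMap includeRight includeLeft (G k l) * (w l ⊗ₜ[R] (1 : B)) := fun k =>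
    congrFun ((TensorProduct.piRight R R B (fun _ : K => B)).apply_symm_apply _) k
  have hcomp : ∀ (t : B →ₐ[R] B ⊗[R] (B ⊗[R] B)) (y : B ⊗[R] B),
      productMap s₁ t (productMap includeRight includeLeft y) = productMap t s₁ y := by
    intro t y
    induction y using TensorProduct.induction_on with
    | zero => simp
    | add x y hx hy => simp only [map_add, hx, hy]
    | tmul a b => simp [mul_comm]
  have hfg : f.lTensor B U = g.lTensor B U := by
    apply (TensorProduct.piRight R R B (fun _ : K => B ⊗[R] B)).injective
    funext k
    rw [hf', hg', hU]
    simp only [hU, map_sum, map_mul, hcomp, Finset.mul_sum]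
    rw [Finset.sum_comm]
    refine Finset.sum_congr rfl fun l _ => ?_
    have h := congrFun (congrFun (hG _ s₂ s₃ s₁) k) l
    rw [Matrix.mul_apply] at h
    simp only [Matrix.map_apply] at h
    rw [← h, Finset.sum_mul]
    refine Finset.sum_congr rfl fun m _ => ?_
    simp [_root_.mul_assoc, s₁]
  have hmem : U ∈ LinearMap.range ((descended G).subtype.lTensor B) := by
    have h := Module.Flat.eqLocus_lTensor_eq R B f g
    have hU' : U ∈ LinearMap.eqLocus (AlgebraTensorModule.lTensor R B f)
        (AlgebraTensorModule.lTensor R B g) := hfg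
    rw [h] at hU'
    exact hU'
  obtain ⟨z, hz⟩ := hmem
  -- the restriction to the diagonal
  let δ : B ⊗[R] (K → B) →ₗ[R] (K → B) :=
    LinearMap.pi fun k => (productMap (AlgHom.id R B) (AlgHom.id R B)).toLinearMap ∘ₗ
      LinearMap.proj k ∘ₗ (TensorProduct.piRight R R B (fun _ : K => B)).toLinearMap
  have hδ : δ U = w := by
    funext k
    have h1 : ∀ y : B ⊗[R] B, productMap (AlgHom.id R B) (AlgHom.id R B)
        (productMap includeRight includeLeft y) =
          productMap (AlgHom.id R B) (AlgHom.id R B) y := by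
      intro y
      induction y using TensorProduct.induction_on with
      | zero => simp
      | add x y hx hy => simp only [map_add, hx, hy]
      | tmul a b => simp [mul_comm]
    change productMap (AlgHom.id R B) (AlgHom.id R B) (TensorProduct.piRight R R B (fun _ : K => B) U k) = w k
    rw [hU]
    simp only [map_sum, map_mul, h1]
    have h2 := congrFun (congrFun hG₁ k)
    simp only [Matrix.map_apply] at h2
    simp [h2, Matrix.one_apply]
  have hspan : ∀ z : B ⊗[R] descended G,
      δ ((descended G).subtype.lTensor B z) ∈ Submodule.span B (descended G : Set (K → B)) := by
    intro z
    induction z using TensorProduct.induction_on with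
    | zero => rw [map_zero, map_zero]; exact Submodule.zero_mem _
    | add x y hx hy => rw [map_add, map_add]; exact Submodule.add_mem _ hx hy
    | tmul b v =>
      have : δ ((descended G).subtype.lTensor B (b ⊗ₜ v)) = b • (v : K → B) := by
        funext k
        simp [δ]
      rw [this]
      exact Submodule.smul_mem _ _ (Submodule.subset_span v.2)
  rw [← hδ, ← hz]
  exact hspan z

end FlatDescent

/-- If a set spans `Bᴷ`, then at a given prime ideal the determinant of suitable members of the set
does not vanish. -/
lemma exists_det_notMem {B : Type*} [CommRing B] {K : Type} [Fintype K] [DecidableEq K]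
    (E : Set (K → B)) (hE : Submodule.span B E = ⊤) (𝔮 : Ideal B) [𝔮.IsPrime] :
    ∃ b : K → K → B, (∀ j, b j ∈ E) ∧ (Matrix.of b).det ∉ 𝔮 := by
  let κ := 𝔮.ResidueField
  let r : B →+* κ := algebraMap B κ
  let E' : Set (K → κ) := (fun v k => r (v k)) '' E
  have hE' : Submodule.span κ E' = ⊤ := by
    rw [eq_top_iff, ← (Pi.basisFun κ K).span_eq, Submodule.span_le]
    rintro _ ⟨k, rfl⟩
    have h : ∀ v ∈ Submodule.span B E, (fun k => r (v k)) ∈ Submodule.span κ E' := by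
      intro v hv
      induction hv using Submodule.span_induction with
      | mem v hv => exact Submodule.subset_span ⟨v, hv, rfl⟩
      | zero =>
        have h0 : (fun k => r ((0 : K → B) k)) = 0 := funext fun _ => map_zero r
        rw [h0]
        exact Submodule.zero_mem _
      | add v w _ _ hv hw =>
        have h0 : (fun k => r ((v + w) k)) = (fun k => r (v k)) + fun k => r (w k) :=
          funext fun _ => map_add r _ _
        rw [h0]
        exact Submodule.add_mem _ hv hw
      | smul a v _ hv =>
        have h0 : (fun k => r ((a • v) k)) = r a • fun k => r (v k) := funext fun _ => map_mul r _ _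
        rw [h0]
        exact Submodule.smul_mem _ _ hv
    have h1 := h (Pi.single k 1) (hE ▸ Submodule.mem_top)
    have h2 : Pi.basisFun κ K k = fun l => r ((Pi.single k 1 : K → B) l) := by
      funext l
      by_cases hl : l = k
      · subst hl; simp
      · simp [hl]
    rw [h2]
    exact h1
  obtain ⟨s, hs, hspan, hli⟩ := exists_linearIndependent κ E'
  rw [hE'] at hspan
  let β : Module.Basis s κ (K → κ) := .mk hli (by rw [Subtype.range_coe, hspan])
  let e : s ≃ K := β.indexEquiv (Pi.basisFun κ K)
  have hb : ∀ j, ∃ v ∈ E, (fun k => r (v k)) = (e.symm j : K → κ) := fun j => hs (e.symm j).2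
  choose b hbE hb using hb
  refine ⟨b, hbE, fun hdet => ?_⟩
  have h1 : r (Matrix.of b).det = 0 := by
    exact (Ideal.algebraMap_residueField_eq_zero).mpr hdet
  have h2 : r (Matrix.of b).det = ((Pi.basisFun κ K).toMatrix (β.reindex e)).det := by
    rw [RingHom.map_det, ← Matrix.det_transpose]
    congr 1
    ext k j
    have h3 := congrFun (hb j) k
    rw [Module.Basis.toMatrix_apply, Module.Basis.reindex_apply, Module.Basis.mk_apply,
      Pi.basisFun_repr]
    exact h3
  rw [h1] at h2
  exact ((Pi.basisFun κ K).isUnit_det (β.reindex e)).ne_zero h2.symm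

/-! ### Descent of functions and a criterion for bases -/

open CartesianMonoidalCategory SemiCartesianMonoidalCategory Matrix

section Descent

variable {S : Scheme.{u}}

lemma res_injective {U T : Over S} (f : U ⟶ T) [Epi f.left] : Function.Injective (res f) := by
  intro a b h
  have := hom_eq_of_comp_eq f (x := homAffineLine a) (y := homAffineLine b)
    (affineLine_hom_ext (by rw [← res_res, ← res_res, res_homAffineLine, res_homAffineLine, h]))
  rw [← res_homAffineLine a, this, res_homAffineLine]

lemma exists_res_eq_of_effectiveEpi {U T : Over S} (f : U ⟶ T) [EffectiveEpi f.left]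
    (a : Γ(U.left, ⊤))
    (h : ∀ (W : Over S) (p q : W ⟶ U), p ≫ f = q ≫ f → res p a = res q a) :
    ∃ b, res f b = a := by
  obtain ⟨y, hy⟩ := exists_comp_eq f (homAffineLine a) fun W p q hpq =>
    affineLine_hom_ext (by
      rw [← res_res, ← res_res, res_homAffineLine, h W p q hpq])
  refine ⟨res y (coordinate S), ?_⟩
  rw [res_res, hy, res_homAffineLine]

variable {P : Over S} (T : Over S)

instance [Surjective P.hom] : Surjective (snd P T).left :=
  inferInstanceAs (Surjective (Limits.pullback.snd P.hom T.hom))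

instance [Etale P.hom] : Etale (snd P T).left :=
  inferInstanceAs (Etale (Limits.pullback.snd P.hom T.hom))

instance [IsFinite P.hom] : IsFinite (snd P T).left :=
  inferInstanceAs (IsFinite (Limits.pullback.snd P.hom T.hom))

end Descent

namespace Cocycle

variable {S : Scheme.{u}} {P : Over S} {K : Type} [Fintype K] [DecidableEq K] (c : Cocycle P K)

/-- Sections of a twisted form which have an invertible determinant on the covering `P` are a
basis. The coefficients of a section are determined on the covering, and they descend because
sections and basis transform by the same cocycle. -/
lemma isBasis_of_isUnit_det [Etale P.hom] [Surjective P.hom] {T : Over S} (b : K → c.sections T)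
    (hb : IsUnit (Matrix.of fun j => (b j).1).det) : c.bigModule.IsBasis b := by
  have hM : ∀ {W : Over S} (p : W ⟶ P) (t : W ⟶ T),
      IsUnit (Matrix.of fun k j => ev (b j).1 p t k).det := fun p t => by
    have h := hb.map (res (lift p t))
    rw [RingHom.map_det, ← Matrix.det_transpose] at h
    exact h
  have hinj : ∀ {W : Over S} (p : W ⟶ P) (t : W ⟶ T),
      Function.Injective ((Matrix.of fun k j => ev (b j).1 p t k).mulVec) := fun p t =>
    Matrix.mulVec_injective_of_isUnit ((Matrix.isUnit_iff_isUnit_det _).mpr (hM p t))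
  intro T' f
  have hev : ∀ (a : K → Γ(T'.left, ⊤)) {W : Over S} (p : W ⟶ P) (t : W ⟶ T'),
      ev (Subtype.val (p := (· ∈ c.sections T')) (∑ j, a j • c.restrict f (b j))) p t =
        (Matrix.of fun k j => ev (b j).1 p (t ≫ f) k) *ᵥ (res t ∘ a) := fun a W p t => by
    have h1 : ∀ s : Finset K, ev (Subtype.val (p := (· ∈ c.sections T'))
        (∑ j ∈ s, a j • c.restrict f (b j))) p t =
          ∑ j ∈ s, res t (a j) • ev (b j).1 p (t ≫ f) := fun s => by
      induction s using Finset.cons_induction with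
      | empty => simp only [Finset.sum_empty, ev_zero]
      | cons i s hi ih => rw [Finset.sum_cons, Finset.sum_cons, ev_add, ih, ev_smul, ev_restrict]
    rw [h1]
    funext k
    rw [Finset.sum_apply]
    exact Finset.sum_congr rfl fun j _ => _root_.mul_comm _ _
  constructor
  · intro a a' h
    have h1 := hev a (fst P T') (snd P T')
    have h2 := hev a' (fst P T') (snd P T')
    have h3 := hinj _ _ (h1.symm.trans ((congrArg (fun v : c.sections T' =>
      ev v.1 (fst P T') (snd P T')) h).trans h2))
    exact funext fun k => res_injective (snd P T') (congrFun h3 k)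
  · intro v
    let M := Matrix.of fun k j => ev (b j).1 (fst P T') (snd P T' ≫ f) k
    have hMu : IsUnit M.det := hM _ _
    let a' := M⁻¹ *ᵥ Subtype.val (p := (· ∈ c.sections T')) v
    have ha' : ∀ {W : Over S} (r : W ⟶ P ⊗ T'),
        (Matrix.of fun k j => ev (b j).1 (r ≫ fst P T') ((r ≫ snd P T') ≫ f) k) *ᵥ (res r ∘ a') =
          ev (Subtype.val (p := (· ∈ c.sections T')) v) (r ≫ fst P T') (r ≫ snd P T') :=
      fun {W} r => by
        have h1 : M *ᵥ a' = Subtype.val (p := (· ∈ c.sections T')) v := by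
          rw [Matrix.mulVec_mulVec, Matrix.mul_nonsing_inv _ hMu, Matrix.one_mulVec]
        have h2 := res_comp_mulVec r M a'
        rw [h1] at h2
        have h3 : M.map (res r) =
            Matrix.of fun k j => ev (b j).1 (r ≫ fst P T') ((r ≫ snd P T') ≫ f) k := by
          ext k j
          refine (congrFun (res_ev r (b j).1 _ _) k).trans ?_
          rw [Category.assoc]
          rfl
        rw [← h3, ← h2, ← res_ev, ev_fst_snd]
    have hd : ∀ k, ∃ x, res (snd P T') x = a' k := fun k => by
      refine exists_res_eq_of_effectiveEpi _ _ fun W p q hpq => ?_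
      have h1 := ha' p
      rw [ev_eq (c := c) v (p ≫ fst P T') (q ≫ fst P T'), hpq, ← ha' q, Matrix.mulVec_mulVec] at h1
      have h2 : c.g (p ≫ fst P T') (q ≫ fst P T') *
          (Matrix.of fun k j => ev (b j).1 (q ≫ fst P T') ((q ≫ snd P T') ≫ f) k) =
          Matrix.of fun k j => ev (b j).1 (p ≫ fst P T') ((q ≫ snd P T') ≫ f) k := by
        ext k j
        exact (congrFun (ev_eq (b j) (p ≫ fst P T') (q ≫ fst P T') ((q ≫ snd P T') ≫ f)) k).symm
      rw [h2] at h1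
      exact congrFun (hinj _ _ h1) k
    choose a ha using hd
    refine ⟨a, sections_ext fun W p t => ?_⟩
    refine (hev a p t).trans ?_
    have h1 := ha' (lift p t)
    rw [lift_fst, lift_snd] at h1
    rw [← h1]
    congr 1
    funext k
    rw [Function.comp_apply, Function.comp_apply, ← ha, res_res, lift_snd]

end Cocycle

/-! ### Descent over an affine base -/

open CartesianMonoidalCategory SemiCartesianMonoidalCategory Matrix

section Affine

variable {S : Scheme.{u}}

lemma hom_ext_of_isAffine {W Y : Over S} [IsAffine Y.left] {y y' : W ⟶ Y} (h : res y = res y') :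
    y = y' := by
  ext1
  refine ext_of_isAffine ?_
  ext a
  exact congrArg (fun φ => φ a) h

/-- Morphisms to an affine scheme are given by ring homomorphisms. -/
lemma exists_appTop_eq {W Y : Scheme.{u}} [IsAffine Y] (φ : Γ(Y, ⊤) ⟶ Γ(W, ⊤)) :
    ∃ l : W ⟶ Y, l.appTop = φ := by
  let l : W ⟶ Y := W.toSpecΓ ≫ Spec.map φ ≫ Y.isoSpec.inv
  refine ⟨l, ?_⟩
  have h1 : l ≫ Y.toSpecΓ = W.toSpecΓ ≫ Spec.map φ := by
    rw [Category.assoc, Category.assoc, Scheme.isoSpec_inv_toSpecΓ, Category.comp_id]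
  clear_value l
  have h2 := congrArg Scheme.Hom.appTop h1
  rw [Scheme.Hom.comp_appTop, Scheme.Hom.comp_appTop, Scheme.toSpecΓ_appTop, Scheme.toSpecΓ_appTop,
    Scheme.ΓSpecIso_naturality, Iso.cancel_iso_hom_left] at h2
  exact h2

/-- Morphisms over an affine scheme `Q` to an affine scheme `Y` are given by homomorphisms of
algebras. -/
lemma exists_hom_of_ringHom {W Y Q : Over S} [IsAffine Y.left] [IsAffine Q.left] (s : Y ⟶ Q)
    (t : W ⟶ Q) (φ : Γ(Y.left, ⊤) →+* Γ(W.left, ⊤)) (h : φ.comp (res s) = res t) :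
    ∃ y : W ⟶ Y, res y = φ ∧ y ≫ s = t := by
  obtain ⟨l, hl⟩ := exists_appTop_eq (CommRingCat.ofHom φ)
  have hs : l ≫ s.left = t.left := by
    refine ext_of_isAffine ?_
    rw [Scheme.Hom.comp_appTop, hl]
    ext a
    exact congrArg (fun φ => φ a) h
  refine ⟨Over.homMk l (by rw [← Over.w s, ← Category.assoc, hs, Over.w]), ?_, ?_⟩
  · ext a
    exact ConcreteCategory.congr_hom hl a
  · ext1
    exact hs

/-- An algebra over the ring of functions on an affine `S`-scheme `Q` is the ring of functions on an
affine scheme over `Q`. -/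
lemma exists_isAffine_of_ringHom {Q : Over S} [IsAffine Q.left] {A : Type u} [CommRing A]
    (ρ : Γ(Q.left, ⊤) →+* A) :
    ∃ (W : Over S) (t : W ⟶ Q) (σ : A ≃+* Γ(W.left, ⊤)), IsAffine W.left ∧
      ∀ a, σ (ρ a) = res t a := by
  let σ : A ≃+* Γ(Spec (.of A), ⊤) := (Scheme.ΓSpecIso (.of A)).symm.commRingCatIsoToRingEquiv
  obtain ⟨l, hl⟩ := exists_appTop_eq (W := Spec (.of A)) (Y := Q.left)
    (CommRingCat.ofHom ρ ≫ (Scheme.ΓSpecIso (.of A)).inv)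
  exact ⟨Over.mk (l ≫ Q.hom), Over.homMk l, σ, inferInstanceAs (IsAffine (Spec _)), fun a =>
    (ConcreteCategory.congr_hom hl a).symm⟩

end Affine

namespace Cocycle

variable {S : Scheme.{u}} {P : Over S} {K : Type} [Fintype K] [DecidableEq K] (c : Cocycle P K)

open scoped TensorProduct in
open Algebra.TensorProduct in
/-- Over an affine base the sections of a twisted form generate the vectors on the covering `P`. This
is flat descent, for the matrix over `B ⊗ B` which is the value of the cocycle at the two projections
from `Spec (B ⊗ B)`, where `B` is the ring of functions on the covering. -/
lemma span_sections [IsFinite P.hom] [Etale P.hom] [Surjective P.hom] (Q : Over S)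
    [IsAffine Q.left] :
    Submodule.span Γ((P ⊗ Q).left, ⊤) (c.sections Q : Set (K → Γ((P ⊗ Q).left, ⊤))) = ⊤ := by
  let Y := P ⊗ Q
  let s : Y ⟶ Q := snd P Q
  have hY : IsAffine Y.left := isAffine_of_isAffineHom s.left
  let R := Γ(Q.left, ⊤)
  let B := Γ(Y.left, ⊤)
  algebraize [res s]
  have hflat : Module.Flat R B := Scheme.Hom.flat_appTop s.left
  obtain ⟨W₂, t₂, σ₂, hW₂, hσ₂⟩ :=
    exists_isAffine_of_ringHom (Q := Q) (algebraMap R (TensorProduct R B B))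
  obtain ⟨i₁, hi₁, hi₁s⟩ := exists_hom_of_ringHom s t₂
    (σ₂.toRingHom.comp (includeLeft (R := R) (S := R) (A := B) (B := B)).toRingHom)
    (RingHom.ext fun a => by
      rw [← hσ₂ a]
      exact congrArg σ₂ ((includeLeft (R := R) (S := R) (A := B) (B := B)).commutes a))
  obtain ⟨i₂, hi₂, hi₂s⟩ := exists_hom_of_ringHom s t₂
    (σ₂.toRingHom.comp (includeRight (R := R) (A := B) (B := B)).toRingHom)
    (RingHom.ext fun a => by
      rw [← hσ₂ a]
      exact congrArg σ₂ ((includeRight (R := R) (A := B) (B := B)).commutes a))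
  -- `W₂` is the fibre product of `Y` with itself over `Q`
  have hfib : ∀ {A : Type u} [CommRing A] [Algebra R A] (φ φ' : B →ₐ[R] A) {W : Over S} (t : W ⟶ Q)
      (σ : A →+* Γ(W.left, ⊤)) (_ : ∀ a, σ (algebraMap R A a) = res t a) (y y' : W ⟶ Y)
      (_ : res y = σ.comp φ.toRingHom) (_ : res y' = σ.comp φ'.toRingHom),
      ∃ r : W ⟶ W₂, r ≫ i₁ = y ∧ r ≫ i₂ = y' ∧
        ∀ z, res r (σ₂ z) = σ (productMap φ φ' z) := by
    intro A _ _ φ φ' W t σ hσ y y' hy hy'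
    obtain ⟨r, hr, -⟩ := exists_hom_of_ringHom t₂ t
      ((σ.comp (productMap φ φ').toRingHom).comp σ₂.symm.toRingHom) (RingHom.ext fun a => by
        rw [← hσ a, ← (productMap φ φ').commutes a]
        refine congrArg (fun z => σ (productMap φ φ' z)) ?_
        exact (RingEquiv.symm_apply_eq σ₂).mpr (hσ₂ a).symm)
    have hr' : ∀ z, res r (σ₂ z) = σ (productMap φ φ' z) := fun z => by
      rw [hr]
      exact congrArg (fun z => σ (productMap φ φ' z)) (σ₂.symm_apply_apply z)
    refine ⟨r, hom_ext_of_isAffine ?_, hom_ext_of_isAffine ?_, hr'⟩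
    · rw [res_comp, hi₁, hy]
      refine RingHom.ext fun b => (hr' _).trans ?_
      exact congrArg σ (by simp)
    · rw [res_comp, hi₂, hy']
      refine RingHom.ext fun b => (hr' _).trans ?_
      exact congrArg σ (by simp)
  let G : Matrix K K (TensorProduct R B B) :=
    (c.g (i₁ ≫ fst P Q) (i₂ ≫ fst P Q)).map σ₂.symm
  have hG : ∀ {A : Type u} [CommRing A] [Algebra R A] (φ φ' : B →ₐ[R] A) {W : Over S} (t : W ⟶ Q)
      (σ : A →+* Γ(W.left, ⊤)) (_ : ∀ a, σ (algebraMap R A a) = res t a) (y y' : W ⟶ Y)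
      (_ : res y = σ.comp φ.toRingHom) (_ : res y' = σ.comp φ'.toRingHom),
      (G.map (productMap φ φ')).map σ = c.g (y ≫ fst P Q) (y' ≫ fst P Q) := by
    intro A _ _ φ φ' W t σ hσ y y' hy hy'
    obtain ⟨r, rfl, rfl, hr⟩ := hfib φ φ' t σ hσ y y' hy hy'
    rw [Category.assoc, Category.assoc, ← c.map_g]
    ext k l
    refine (hr _).symm.trans ?_
    exact congrArg (res r) (σ₂.apply_symm_apply _)
  have hpt : ∀ {A : Type u} [CommRing A] [Algebra R A] {W : Over S} (t : W ⟶ Q)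
      (σ : A →+* Γ(W.left, ⊤)) (_ : ∀ a, σ (algebraMap R A a) = res t a) (φ : B →ₐ[R] A),
      ∃ y : W ⟶ Y, res y = σ.comp φ.toRingHom := by
    intro A _ _ W t σ hσ φ
    obtain ⟨y, hy, -⟩ := exists_hom_of_ringHom s t (σ.comp φ.toRingHom) (RingHom.ext fun a => by
      rw [← hσ a]
      exact congrArg σ (φ.commutes a))
    exact ⟨y, hy⟩
  have hspan : Submodule.span B (descended G : Set (K → B)) = ⊤ := by
    refine span_descended G (fun A _ _ φ₁ φ₂ φ₃ => ?_) ?_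
    · obtain ⟨W, t, σ, -, hσ⟩ := exists_isAffine_of_ringHom (Q := Q) (algebraMap R A)
      obtain ⟨y₁, h₁⟩ := hpt t σ.toRingHom hσ φ₁
      obtain ⟨y₂, h₂⟩ := hpt t σ.toRingHom hσ φ₂
      obtain ⟨y₃, h₃⟩ := hpt t σ.toRingHom hσ φ₃
      refine Matrix.map_injective σ.injective ?_
      refine (Matrix.map_mul (f := σ.toRingHom)).trans ?_
      refine (congrArg₂ (· * ·) (hG φ₁ φ₂ t σ.toRingHom hσ y₁ y₂ h₁ h₂)
        (hG φ₂ φ₃ t σ.toRingHom hσ y₂ y₃ h₂ h₃)).trans ?_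
      rw [c.g_mul]
      exact (hG φ₁ φ₃ t σ.toRingHom hσ y₁ y₃ h₁ h₃).symm
    · have h := hG (AlgHom.id R B) (AlgHom.id R B) s (RingHom.id B) (fun _ => rfl) (𝟙 Y) (𝟙 Y)
        (res_id Y) (res_id Y)
      rw [c.g_self] at h
      exact (Matrix.map_id _).symm.trans h
  rw [eq_top_iff, ← hspan, Submodule.span_le]
  refine fun v hv => Submodule.subset_span fun W p q t => ?_
  rw [SetLike.mem_coe, mem_descended_iff] at hv
  let _ : Algebra R Γ(W.left, ⊤) := (res t).toAlgebra
  let φ (p : W ⟶ P) : B →ₐ[R] Γ(W.left, ⊤) :=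
    { res (lift p t) with
      commutes' := fun a => by
        change res (lift p t) (res s a) = res t a
        rw [res_res, lift_snd] }
  obtain ⟨r, h₁, h₂, hr⟩ := hfib (φ p) (φ q) t (RingHom.id _) (fun _ => rfl) (lift p t) (lift q t)
    rfl rfl
  have hG' := hG (φ p) (φ q) t (RingHom.id _) (fun _ => rfl) (lift p t) (lift q t) rfl rfl
  rw [lift_fst, lift_fst] at hG'
  rw [← hG']
  funext k
  have h := congrArg (productMap (φ p) (φ q)) (congrFun hv k)
  have h' : productMap (φ p) (φ q) ((G *ᵥ fun k => (1 : B) ⊗ₜ[R] v k) k) =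
      (G.map (productMap (φ p) (φ q)) *ᵥ fun k => productMap (φ p) (φ q) ((1 : B) ⊗ₜ[R] v k)) k :=
    RingHom.map_mulVec (productMap (φ p) (φ q)).toRingHom G _ k
  rw [h'] at h
  simp only [productMap_apply_tmul, map_one, _root_.mul_one, _root_.one_mul] at h
  exact h

end Cocycle

/-! ### Zariski-local bases -/

open CartesianMonoidalCategory SemiCartesianMonoidalCategory Matrix

lemma basicOpen_res {S : Scheme.{u}} {W T : Over S} (f : W ⟶ T) (a : Γ(T.left, ⊤)) (w : W.left) :
    w ∈ W.left.basicOpen (res f a) ↔ f.left w ∈ T.left.basicOpen a := by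
  have : W.left.basicOpen (res f a) = f.left ⁻¹ᵁ T.left.basicOpen a :=
    (Scheme.preimage_basicOpen f.left a).symm
  rw [this]
  rfl

namespace Cocycle

variable {S : Scheme.{u}} {P : Over S} {K : Type} [Fintype K] [DecidableEq K] (c : Cocycle P K)

lemma res_det {T W : Over S} (b : K → c.sections T) (p : W ⟶ P ⊗ T) :
    res p (Matrix.of fun j => (b j).1).det =
      (Matrix.of fun j => ev (b j).1 (p ≫ fst P T) (p ≫ snd P T)).det := by
  rw [RingHom.map_det]
  congr 1
  ext j k
  have h : lift (p ≫ fst P T) (p ≫ snd P T) = p := by ext1 <;> simp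
  change _ = res (lift (p ≫ fst P T) (p ≫ snd P T)) _
  rw [h]
  rfl

/-- Whether the determinant of a family of sections vanishes at a point of the covering `P` depends
only on the image of the point in the base. -/
lemma mem_basicOpen_det {T : Over S} (b : K → c.sections T) {y y' : (P ⊗ T).left}
    (h : (snd P T).left y = (snd P T).left y')
    (hy : y ∈ (P ⊗ T).left.basicOpen (Matrix.of fun j => (b j).1).det) :
    y' ∈ (P ⊗ T).left.basicOpen (Matrix.of fun j => (b j).1).det := by
  obtain ⟨z, rfl, rfl⟩ := Scheme.Pullback.exists_preimage_pullback y y' h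
  let W : Over S :=
    Over.mk (Limits.pullback.fst (snd P T).left (snd P T).left ≫ (P ⊗ T).hom)
  let p : W ⟶ P ⊗ T := Over.homMk (Limits.pullback.fst _ _)
  have hpq := Limits.pullback.condition (f := (snd P T).left) (g := (snd P T).left)
  let q : W ⟶ P ⊗ T := Over.homMk (Limits.pullback.snd _ _) (by
    change _ = Limits.pullback.fst (snd P T).left (snd P T).left ≫ (P ⊗ T).hom
    rw [← Over.w (snd P T), ← Category.assoc, ← Category.assoc, hpq])
  have hpq' : p ≫ snd P T = q ≫ snd P T := by
    ext1
    exact hpq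
  have hdet : res p (Matrix.of fun j => (b j).1).det =
      res q (Matrix.of fun j => (b j).1).det * (c.g (p ≫ fst P T) (q ≫ fst P T))ᵀ.det := by
    rw [res_det, res_det, ← Matrix.det_mul, hpq']
    congr 1
    ext j k
    rw [Matrix.of_apply, ev_eq (b j) (p ≫ fst P T) (q ≫ fst P T)]
    exact Finset.sum_congr rfl fun l _ => _root_.mul_comm _ _
  have h1 := (basicOpen_res p _ z).mpr hy
  rw [hdet, Scheme.basicOpen_mul] at h1
  exact (basicOpen_res q _ z).mp h1.1

/-- A twisted form of a free module is locally free if the covering is finite étale. Near a point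
`s` choose sections whose determinant is invertible at one point over `s`. It is then invertible at
all points over `s`, and over a neighbourhood of `s` because finite morphisms are closed. -/
lemma locallyFreeOn_bigModule [IsFinite P.hom] [Etale P.hom] [Surjective P.hom] :
    c.bigModule.LocallyFreeOn K (BigModule.base S) := by
  intro s
  obtain ⟨U₀, hU₀, hs, -⟩ := exists_isAffineOpen_mem_and_subset
    (show s ∈ (⊤ : (BigModule.base S).left.Opens) from trivial)
  let Q := opn (BigModule.base S) U₀
  have hQ : IsAffine Q.left := hU₀
  obtain ⟨s', hs'⟩ := exists_inc_apply (BigModule.base S) U₀ s hs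
  obtain ⟨y, hy⟩ := (snd P Q).left.surjective s'
  let g := ((P ⊗ Q).left.presheaf.germ ⊤ y trivial).hom
  obtain ⟨b, hb, hdet⟩ := exists_det_notMem _ (c.span_sections Q)
    ((IsLocalRing.maximalIdeal ((P ⊗ Q).left.presheaf.stalk y)).comap g)
  let b' : K → c.sections Q := fun j => ⟨b j, hb j⟩
  let O : (P ⊗ Q).left.Opens := (P ⊗ Q).left.basicOpen (Matrix.of fun j => (b' j).1).det
  have hyO : y ∈ O := by
    refine ((P ⊗ Q).left.mem_basicOpen (U := ⊤) _ y trivial).mpr ?_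
    by_contra h
    exact hdet h
  have hclosed : IsClosed ((snd P Q).left '' (O : Set (P ⊗ Q).left)ᶜ) :=
    (snd P Q).left.isClosedMap _ O.isOpen.isClosed_compl
  let V : Q.left.Opens := ⟨_, hclosed.isOpen_compl⟩
  have hV : ∀ z : (P ⊗ Q).left, (snd P Q).left z ∈ V → z ∈ O := fun z hz => by
    by_contra h
    exact hz ⟨z, h, rfl⟩
  have hsV : s' ∈ V := by
    rintro ⟨z, hz, hzs⟩
    exact hz (c.mem_basicOpen_det b' (hy.trans hzs.symm) hyO)
  let U : (BigModule.base S).left.Opens := U₀.ι ''ᵁ V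
  have hUU₀ : U ≤ U₀ := by
    rintro _ ⟨z, -, rfl⟩
    exact inc_apply_mem (BigModule.base S) U₀ z
  let f : opn (BigModule.base S) U ⟶ Q := incLE hUU₀
  have hf : ∀ z, f.left z ∈ V := fun z => by
    obtain ⟨v, hv, hvz⟩ := inc_apply_mem (BigModule.base S) U z
    have h : (inc (BigModule.base S) U₀).left (f.left z) = (inc (BigModule.base S) U).left z :=
      congrArg (fun h : opn (BigModule.base S) U ⟶ BigModule.base S => h.left z) (incLE_inc hUU₀)
    rw [← U₀.ι.isOpenEmbedding.injective (hvz.trans h.symm)]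
    exact hv
  refine ⟨U, ⟨s', hsV, hs'⟩, fun j => c.restrict f (b' j), c.isBasis_of_isUnit_det _ ?_⟩
  let r : P ⊗ opn (BigModule.base S) U ⟶ P ⊗ Q := lift (fst _ _) (snd _ _ ≫ f)
  have hr : (Matrix.of fun j => Subtype.val (p := (· ∈ c.sections (opn (BigModule.base S) U)))
      (c.restrict f (b' j))).det = res r (Matrix.of fun j => (b' j).1).det := by
    rw [res_det, lift_fst, lift_snd]
    simp only [← ev_restrict, ev_fst_snd]
  refine hr ▸ (isUnit_res_iff r _).mpr ?_
  intro w
  refine hV _ ?_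
  have h : (snd P Q).left (r.left w) = f.left ((snd P (opn (BigModule.base S) U)).left w) :=
    congrArg (fun h : P ⊗ opn (BigModule.base S) U ⟶ Q => h.left w)
      (lift_snd (fst _ _) (snd _ _ ≫ f))
  rw [h]
  exact hf _

end Cocycle

end ThetaGroups

end

theorem mainTheorem8 (S : Scheme.{u}) (X : ThetaGroups.SymplecticModule S)
    (D : ThetaGroups.ModuleType) (hX : X.HasType D) (hD : Odd D.card) :
    (∃ 𝒢 : ThetaGroups.ThetaGroup X, 𝒢.IsSymmetric) ∧
    (∀ A A' : ThetaGroups.SymmetrizedThetaGroup X,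
      ∃! α : A.theta.G ≅ A'.theta.G, ThetaGroups.SymmetrizedThetaGroup.IsFramedIso A A' α) ∧
    (∀ 𝒢 : ThetaGroups.ThetaGroup X, 𝒢.IsSymmetric → 𝒢.IsLinear D) := by
  refine ⟨⟨ThetaGroups.stdTheta hX hD, ⟨ThetaGroups.stdInversion hX hD⟩⟩,
    ThetaGroups.SymmetrizedThetaGroup.existsUnique_isFramedIso hX hD, fun 𝒢 ⟨i⟩ => ?_⟩
  let A : ThetaGroups.SymmetrizedThetaGroup X := ⟨𝒢, i⟩
  obtain ⟨P, _, _, _, ⟨p₀⟩⟩ := ThetaGroups.exists_frame_cover hX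
  exact (A.action hX hD p₀).isLinear (p₀.cocycle hX hD).locallyFreeOn_bigModule
    (A.action_incl hX hD p₀)
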